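/- **Setting.** Inner products are conjugate linear in the first variable. Let $\mathcal H$ be a finite dimensional complex Hilbert space and $H\subset\mathcal H$ a standard subspace: a closed real subspace with $H\cap iH=\{0\}$ and $H+iH$ dense (hence equal to $\mathcal H$). Let $S_H(h+ih')=h-ih'$ ($h,h'\in H$), $\Delta_H=S_H^*S_H$, and $S_H=J_H\Delta_H^{1/2}$ the polar decomposition. For $T\in B(\mathcal H\otimes\mathcal H)$ let $T_k=1^{\otimes(k-1)}\otimes T\otimes 1^{\otimes(n-k-1)}$ on $\mathcal H^{\otimes n}$, $R_{T,n}=1+T_1+T_1T_2+\dots+T_1\cdots T_{n-1}$, $P_{T,0}=P_{T,1}=1$, $P_{T,n}=(1\otimes P_{T,n-1})R_{T,n}$. $T$ is a *strict twist* if $\|T\|\le1$ and every $P_{T,n}$, $n\ge1$, is strictly positive; *braided* if $T_1T_2T_1=T_2T_1T_2$; *compatible* with $H$ if it commutes with $\Delta_H^{it}\otimes\Delta_H^{it}$ for all $t\in\mathbb R$; *crossing symmetric* if for all $\psi_1,\dots,\psi_4\in\mathcal H$ the function $t\mapsto\langle\psi_2\otimes\psi_1,(\Delta_H^{it}\otimes1)T(1\otimes\Delta_H^{-it})(\psi_3\otimes\psi_4)\rangle$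 extends to a bounded continuous function on $\{0\le\operatorname{Im}z\le\frac12\}$, analytic in the interior, with value $\langle\psi_1\otimes J_H\psi_4,(1\otimes\Delta_H^{it})T(\Delta_H^{-it}\otimes1)(J_H\psi_2\otimes\psi_3)\rangle$ at $t+\frac i2$, $t\in\mathbb R$. The twisted Fock space $\mathcal F_T(\mathcal H)$ is the Hilbert sum over $n\ge0$ of $\mathcal H^{\otimes n}$ with inner product $\langle\cdot,P_{T,n}\cdot\rangle$; $\Omega\in\mathcal H^{\otimes0}=\mathbb C$ is the vacuum, $a_T^*(\xi)$ is the continuous extension of $\Phi\mapsto\xi\otimes\Phi$, $a_T(\xi)$ is its adjoint, $X_T(\xi)=a_T^*(\xi)+a_T(S_H\xi)$, and $\mathcal L_T(H)=\{\exp(iX_T(\xi)):\xi\in\mathcal H\}''$. Let $C_k:\mathcal H^{\otimes n}\to\mathcal H^{\otimes(n-2)}$ contract the factors $k,k+1$ by $\xi\otimes\eta\mapsto\langle S_H\xi,\eta\rangle$. For a partition $\pi$ of $\{1,\dots,n\}$ into singletons and pairs, with pairs $\{i_1<j_1\},\dots,\{i_s<j_s\}$ listed so that $i_1<\dots<i_s$,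 and with $r_k(m)$ the number of elements of $\{i_t,j_t:t<k\}$ smaller than $m$, put $$W^T_\pi=V_s\cdots V_1:\mathcal H^{\otimes n}\to\mathcal H^{\otimes(n-2s)},\qquad V_k=C_aT_{a+1}T_{a+2}\cdots T_{b-1},\quad a=i_k-r_k(i_k),\ b=j_k-r_k(j_k).$$ Let $B(2n+1)$ be the set of such partitions of $\{1,\dots,2n+1\}$ in which $n+1$ is a singleton and each $k\le n$ is paired with an element of $\{n+2,\dots,2n+1\}$. For a von Neumann algebra $M$ generated by $X_1,\dots,X_d$ and acting on a Hilbert space containing the vector $\Omega$, with vector state $\varphi=\langle\Omega,\cdot\,\Omega\rangle$ and $L^2(M,\varphi)=\overline{M\Omega}$, a *conjugate system* is a family $\Xi_1,\dots,\Xi_d\in L^2(M,\varphi)$ with $\langle1\otimes1,(\partial_ip)(X_1,\dots,X_d)\rangle_{\varphi\otimes\varphi^{op}}=\langle\Xi_i,p(X_1,\dots,X_d)\Omega\rangle$ for all $i$ and all $p\in\mathbb C\langle x_1,\dots,x_d\rangle$, where $\partial_i(x_{j_1}\cdots x_{j_k})=\sum_{m}\delta_{i,j_m}\,x_{j_1}\cdots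 x_{j_{m-1}}\otimes x_{j_{m+1}}\cdots x_{j_k}$. **Theorem.** Let $T$ be a compatible, braided, crossing symmetric strict twist with $\|T\|=q<1$, let $e_1,\dots,e_d$ be a linear basis of $\mathcal H$ and $f_1,\dots,f_d$ its dual basis, $\langle f_i,e_j\rangle=\delta_{ij}$. Then the operators $a_T^*(\xi)$ are bounded, each $P_{T,n}$ is invertible, and for all $n\ge0$ and $\pi\in B(2n+1)$ $$\|W^T_\pi\|\le\bigl(\sqrt d\,\|S_H\|\bigr)^n\,q^{n(n+1)/2}.$$ Moreover $X_T(e_1),\dots,X_T(e_d)$ generate $\mathcal L_T(H)$ and have, in the vacuum state, a unique conjugate system $(\Xi_1,\dots,\Xi_d)$ in $L^2(\mathcal L_T(H),\langle\Omega,\cdot\,\Omega\rangle)\subseteq\mathcal F_T(\mathcal H)$ with respect to the free difference quotients. It is given by the series, convergent in $\mathcal F_T(\mathcal H)$, $$\Xi_i=\sum_{n=0}^\infty(-1)^n\,P_{T,2n+1}^{-1}\sum_{\pi\in B(2n+1)}(W^T_\pi)^*f_i,\qquad1\le i\le d,$$ where the adjoints are those for the untwisted inner products of the tensor powers. -/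

import Mathlib

open scoped TensorProduct InnerProductSpace

noncomputable section

universe u

namespace TwistedArakiWoods

/-! ### The modular data `S`, `Δ`, `J` of a standard subspace of a finite dimensional space -/

section Modular

variable {𝓗 : Type u} [NormedAddCommGroup 𝓗] [InnerProductSpace ℂ 𝓗]

/-- The real linear subspace underlying the standard subspace `H`. -/
def realPart (H : StandardSubspace 𝓗) : Submodule ℝ 𝓗 := H.toClosedSubmodule.toSubmodule

/-- The real linear subspace `iH`. -/
def imagPart (H : StandardSubspace 𝓗) : Submodule ℝ 𝓗 := H.toClosedSubmodule.mulI.toSubmodule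

theorem mem_imagPart (H : StandardSubspace 𝓗) (x : 𝓗) :
    x ∈ imagPart H ↔ ∃ h ∈ realPart H, Complex.I • h = x := by
  change x ∈ H.toClosedSubmodule.mulI ↔ _
  rw [ClosedSubmodule.mem_mapEquiv_iff, scalarSMulCLE_symm_apply]
  constructor
  · intro h
    refine ⟨_, h, ?_⟩
    simp [Units.smul_def, smul_smul]
  · rintro ⟨h, hh, rfl⟩
    have : (Complex.UnitI⁻¹ : ℂˣ) • (Complex.I • h) = h := by
      simp [Units.smul_def, smul_smul]
    rw [this]; exact hh

variable [FiniteDimensional ℂ 𝓗]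

theorem isCompl_realPart_imagPart (H : StandardSubspace 𝓗) :
    IsCompl (realPart H) (imagPart H) := by
  have : FiniteDimensional ℝ 𝓗 := FiniteDimensional.complexToReal 𝓗
  constructor
  · rw [disjoint_iff]
    have := congrArg ClosedSubmodule.toSubmodule H.IsSeparating
    simpa [realPart, imagPart] using this
  · rw [codisjoint_iff]
    have := congrArg ClosedSubmodule.toSubmodule H.IsCyclic
    rw [ClosedSubmodule.toSubmodule_sup] at this
    have hc : IsClosed ((realPart H ⊔ imagPart H : Submodule ℝ 𝓗) : Set 𝓗) :=
      Submodule.closed_of_finiteDimensional _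
    apply SetLike.coe_injective
    have h2 := congrArg (fun K : Submodule ℝ 𝓗 => (K : Set 𝓗)) this
    simp only [ClosedSubmodule.coe_toSubmodule, Submodule.coe_closure] at h2
    rw [← hc.closure_eq]
    exact h2

/-- The real linear map `h + ih' ↦ h - ih'` (`h, h' ∈ H`). -/
def tomitaReal (H : StandardSubspace 𝓗) : 𝓗 →ₗ[ℝ] 𝓗 :=
  (realPart H).subtype ∘ₗ (realPart H).projectionOnto (imagPart H) (isCompl_realPart_imagPart H)
  - (imagPart H).subtype ∘ₗ
    (imagPart H).projectionOnto (realPart H) (isCompl_realPart_imagPart H).symm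

theorem tomitaReal_apply (H : StandardSubspace 𝓗) {h h' : 𝓗} (hh : h ∈ realPart H)
    (hh' : h' ∈ realPart H) :
    tomitaReal H (h + Complex.I • h') = h - Complex.I • h' := by
  have hi : Complex.I • h' ∈ imagPart H := (mem_imagPart H _).2 ⟨h', hh', rfl⟩
  have e1 := Submodule.projectionOnto_apply_left (isCompl_realPart_imagPart H) ⟨h, hh⟩
  have e2 := Submodule.projectionOnto_apply_right (isCompl_realPart_imagPart H) ⟨_, hi⟩
  have e3 := Submodule.projectionOnto_apply_left (isCompl_realPart_imagPart H).symm ⟨_, hi⟩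
  have e4 := Submodule.projectionOnto_apply_right (isCompl_realPart_imagPart H).symm ⟨h, hh⟩
  simp only at e1 e2 e3 e4
  simp [tomitaReal, e1, e2, e3, e4]

theorem exists_real_add_imag (H : StandardSubspace 𝓗) (x : 𝓗) :
    ∃ h ∈ realPart H, ∃ h' ∈ realPart H, h + Complex.I • h' = x := by
  have hx : x ∈ realPart H ⊔ imagPart H := by
    rw [(isCompl_realPart_imagPart H).sup_eq_top]; trivial
  obtain ⟨h, hh, k, hk, rfl⟩ := Submodule.mem_sup.1 hx
  obtain ⟨h', hh', rfl⟩ := (mem_imagPart H k).1 hk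
  exact ⟨h, hh, h', hh', rfl⟩

theorem tomitaReal_smul (H : StandardSubspace 𝓗) (c : ℂ) (x : 𝓗) :
    tomitaReal H (c • x) = (starRingEnd ℂ) c • tomitaReal H x := by
  obtain ⟨h, hh, h', hh', rfl⟩ := exists_real_add_imag H x
  have e : c • (h + Complex.I • h')
      = (c.re • h - c.im • h') + Complex.I • (c.im • h + c.re • h') := by
    conv_lhs => rw [← Complex.re_add_im c]
    simp only [← Complex.coe_smul]
    linear_combination (norm := module) ((c.im : ℂ) • congrArg (fun z : ℂ => z • h') Complex.I_mul_I)
  rw [e, tomitaReal_apply H (sub_mem (Submodule.smul_mem _ _ hh) (Submodule.smul_mem _ _ hh'))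
    (add_mem (Submodule.smul_mem _ _ hh) (Submodule.smul_mem _ _ hh')), tomitaReal_apply H hh hh']
  conv_rhs => rw [← Complex.re_add_im c]
  simp only [← Complex.coe_smul, map_add, map_mul, Complex.conj_ofReal, Complex.conj_I]
  linear_combination (norm := module) ((-c.im : ℂ) • congrArg (fun z : ℂ => z • h') Complex.I_mul_I)

/-- The Tomita operator `S_H`, the conjugate linear map with `S_H (h + ih') = h - ih'`. In finite
dimension `H + iH` is the whole space and `S_H` is bounded. -/
def tomita (H : StandardSubspace 𝓗) : 𝓗 →L⋆[ℂ] 𝓗 where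
  toFun := tomitaReal H
  map_add' := map_add _
  map_smul' := tomitaReal_smul H
  cont := by
    have : FiniteDimensional ℝ 𝓗 := FiniteDimensional.complexToReal 𝓗
    exact LinearMap.continuous_of_finiteDimensional (tomitaReal H)

variable [CompleteSpace 𝓗]

/-- The linear functional `x ↦ ⟪S x, y⟫`. -/
def tomitaFunctional (H : StandardSubspace 𝓗) (y : 𝓗) : StrongDual ℂ 𝓗 :=
  LinearMap.toContinuousLinearMap
    { toFun := fun x => ⟪tomita H x, y⟫_ℂ
      map_add' := fun x x' => by rw [map_add, inner_add_left]
      map_smul' := fun c x => by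
        rw [ContinuousLinearMap.map_smulₛₗ, inner_smul_left]; simp }

/-- The adjoint `S_H^*` of the conjugate linear map `S_H`: `⟪S^* y, x⟫ = ⟪S x, y⟫`. -/
def tomitaAdjoint (H : StandardSubspace 𝓗) : 𝓗 →ₗ⋆[ℂ] 𝓗 where
  toFun y := (InnerProductSpace.toDual ℂ 𝓗).symm (tomitaFunctional H y)
  map_add' y y' := by
    rw [← map_add]; congr 1; ext x; simp [tomitaFunctional]
  map_smul' c y := by
    rw [← LinearIsometryEquiv.map_smulₛₗ]; congr 1; ext x
    simp [tomitaFunctional]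

theorem inner_tomitaAdjoint_left (H : StandardSubspace 𝓗) (x y : 𝓗) :
    ⟪tomitaAdjoint H y, x⟫_ℂ = ⟪tomita H x, y⟫_ℂ := by
  simp [tomitaAdjoint, tomitaFunctional]

/-- The modular operator `Δ_H = S_H^* S_H`. -/
def modularOp (H : StandardSubspace 𝓗) : 𝓗 →L[ℂ] 𝓗 :=
  LinearMap.toContinuousLinearMap (tomitaAdjoint H ∘ₛₗ (tomita H : 𝓗 →ₗ⋆[ℂ] 𝓗))

/-- The complex powers `Δ_H^s` of the (positive, invertible) modular operator, by functional
calculus. -/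
def modularPow (H : StandardSubspace 𝓗) (s : ℂ) : 𝓗 →L[ℂ] 𝓗 :=
  cfc (fun z : ℂ => z ^ s) (modularOp H)

/-- The modular conjugation `J_H`, given by the polar decomposition `S_H = J_H Δ_H^{1/2}`. -/
def modularConj (H : StandardSubspace 𝓗) : 𝓗 →L⋆[ℂ] 𝓗 :=
  (tomita H).comp (modularPow H (-(1 / 2)))

/-- The unitaries `Δ_H^{it}`, `t ∈ ℝ`. -/
def modularUnitary (H : StandardSubspace 𝓗) (t : ℝ) : 𝓗 →L[ℂ] 𝓗 :=
  modularPow H (t * Complex.I)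

/-- `T` is compatible with `H`: `T` commutes with `Δ_H^{it} ⊗ Δ_H^{it}` for all real `t`. -/
def IsCompatible (H : StandardSubspace 𝓗) (T : 𝓗 ⊗[ℂ] 𝓗 →L[ℂ] 𝓗 ⊗[ℂ] 𝓗) : Prop :=
  ∀ t : ℝ, Commute (TensorProduct.mapL (modularUnitary H t) (modularUnitary H t)) T

/-- `T` is crossing symmetric with respect to `H`: for all vectors `ψ₁, …, ψ₄`, the function
`t ↦ ⟪ψ₂ ⊗ ψ₁, (Δ^{it} ⊗ 1) T (1 ⊗ Δ^{-it}) (ψ₃ ⊗ ψ₄)⟫` on the real line extends to a bounded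
continuous function on the closed strip `0 ≤ Im z ≤ 1/2`, analytic in the interior, whose boundary
values on the upper line are
`t + i/2 ↦ ⟪ψ₁ ⊗ Jψ₄, (1 ⊗ Δ^{it}) T (Δ^{-it} ⊗ 1) (Jψ₂ ⊗ ψ₃)⟫`. -/
def IsCrossingSymmetric (H : StandardSubspace 𝓗) (T : 𝓗 ⊗[ℂ] 𝓗 →L[ℂ] 𝓗 ⊗[ℂ] 𝓗) : Prop :=
  ∀ ψ₁ ψ₂ ψ₃ ψ₄ : 𝓗, ∃ F : ℂ → ℂ,
    DiffContOnCl ℂ F {z : ℂ | 0 < z.im ∧ z.im < 1 / 2} ∧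
    (∃ C : ℝ, ∀ z : ℂ, 0 ≤ z.im → z.im ≤ 1 / 2 → ‖F z‖ ≤ C) ∧
    (∀ t : ℝ, F t = ⟪ψ₂ ⊗ₜ[ℂ] ψ₁, ((modularUnitary H t).rTensor 𝓗)
      (T (((modularUnitary H (-t)).lTensor 𝓗) (ψ₃ ⊗ₜ[ℂ] ψ₄)))⟫_ℂ) ∧
    (∀ t : ℝ, F (t + Complex.I / 2) =
      ⟪ψ₁ ⊗ₜ[ℂ] modularConj H ψ₄, ((modularUnitary H t).lTensor 𝓗)
        (T (((modularUnitary H (-t)).rTensor 𝓗) (modularConj H ψ₂ ⊗ₜ[ℂ] ψ₃)))⟫_ℂ)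

end Modular

/-! ### Tensor powers, and the operators `T_k`, `R_{T,n}`, `P_{T,n}` -/

section TensorPowers

/-- A finite dimensional complex Hilbert space, as a bundled object. -/
structure FinHilb : Type (u + 1) where
  /-- The underlying space. -/
  carrier : Type u
  /-- The norm. -/
  [normed : NormedAddCommGroup carrier]
  /-- The inner product. -/
  [hilb : InnerProductSpace ℂ carrier]
  /-- Finite dimensionality. -/
  [fin : FiniteDimensional ℂ carrier]

attribute [instance] FinHilb.normed FinHilb.hilb FinHilb.fin

variable (𝓗 : Type u) [NormedAddCommGroup 𝓗] [InnerProductSpace ℂ 𝓗] [FiniteDimensional ℂ 𝓗]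

/-- The Hilbert spaces `𝓗^{⊗ n}`, with `𝓗^{⊗ 0} = ℂ` and `𝓗^{⊗ (n+1)} = 𝓗 ⊗ 𝓗^{⊗ n}`. The
one dimensional space `𝓗^{⊗ 0}` is realized in the universe of `𝓗`. -/
def tpowObj : ℕ → FinHilb.{u}
  | 0 => ⟨EuclideanSpace ℂ PUnit.{u + 1}⟩
  | n + 1 => ⟨𝓗 ⊗[ℂ] (tpowObj n).carrier⟩

/-- The Hilbert space `𝓗^{⊗ n}`. -/
abbrev TPow (n : ℕ) : Type u := (tpowObj 𝓗 n).carrier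

instance (n : ℕ) : CompleteSpace (TPow 𝓗 n) := FiniteDimensional.complete ℂ _

/-- The unit vector spanning `𝓗^{⊗ 0}`. -/
def tvac : TPow 𝓗 0 := EuclideanSpace.single (PUnit.unit : PUnit.{u + 1}) (1 : ℂ)

/-- The defining identification `𝓗^{⊗ (n+1)} = 𝓗 ⊗ 𝓗^{⊗ n}`. -/
def tpowSucc (n : ℕ) : TPow 𝓗 (n + 1) ≃ₗᵢ[ℂ] 𝓗 ⊗[ℂ] TPow 𝓗 n :=
  LinearIsometryEquiv.refl ℂ (𝓗 ⊗[ℂ] TPow 𝓗 n)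

/-- The identification `𝓗^{⊗ (n+2)} = (𝓗 ⊗ 𝓗) ⊗ 𝓗^{⊗ n}`. -/
def tpowSuccSucc (n : ℕ) : TPow 𝓗 (n + 2) ≃ₗᵢ[ℂ] (𝓗 ⊗[ℂ] 𝓗) ⊗[ℂ] TPow 𝓗 n :=
  ((tpowSucc 𝓗 (n + 1)).trans ((tpowSucc 𝓗 n).lTensor 𝓗)).trans
    (TensorProduct.assocIsometry ℂ 𝓗 𝓗 (TPow 𝓗 n)).symm

variable {𝓗}

/-- Tensoring on the left: `v ↦ ξ ⊗ v` from `𝓗^{⊗ n}` to `𝓗^{⊗ (n+1)}`. -/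
def tcons (ξ : 𝓗) (n : ℕ) : TPow 𝓗 n →ₗ[ℂ] TPow 𝓗 (n + 1) :=
  ((tpowSucc 𝓗 n).symm.toLinearEquiv : 𝓗 ⊗[ℂ] TPow 𝓗 n →ₗ[ℂ] TPow 𝓗 (n + 1)) ∘ₗ
    TensorProduct.mk ℂ 𝓗 (TPow 𝓗 n) ξ

/-- The operator `1 ⊗ A`. -/
def idTensor {n m : ℕ} (A : TPow 𝓗 n →L[ℂ] TPow 𝓗 m) : TPow 𝓗 (n + 1) →L[ℂ] TPow 𝓗 (m + 1) :=
  ((tpowSucc 𝓗 m).symm : 𝓗 ⊗[ℂ] TPow 𝓗 m →L[ℂ] TPow 𝓗 (m + 1)) ∘L (A.lTensor 𝓗) ∘L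
    (tpowSucc 𝓗 n : TPow 𝓗 (n + 1) →L[ℂ] 𝓗 ⊗[ℂ] TPow 𝓗 n)

/-- The operator `T` acting on the tensor factors with numbers `k, k + 1` of `𝓗^{⊗ n}`, where the
factors are numbered `0, …, n - 1` from the left (and `0` if `n < k + 2`). -/
def twistAt (T : 𝓗 ⊗[ℂ] 𝓗 →L[ℂ] 𝓗 ⊗[ℂ] 𝓗) : ℕ → (n : ℕ) → (TPow 𝓗 n →L[ℂ] TPow 𝓗 n)
  | 0, n + 2 =>
    ((tpowSuccSucc 𝓗 n).symm : (𝓗 ⊗[ℂ] 𝓗) ⊗[ℂ] TPow 𝓗 n →L[ℂ] TPow 𝓗 (n + 2)) ∘L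
      (T.rTensor (TPow 𝓗 n)) ∘L
      (tpowSuccSucc 𝓗 n : TPow 𝓗 (n + 2) →L[ℂ] (𝓗 ⊗[ℂ] 𝓗) ⊗[ℂ] TPow 𝓗 n)
  | k + 1, n + 1 => idTensor (twistAt T k n)
  | _, _ => 0

/-- The product `T_a T_{a+1} ⋯ T_{b-1}` on `𝓗^{⊗ n}` (the identity if `b ≤ a`). -/
def twistProd (T : 𝓗 ⊗[ℂ] 𝓗 →L[ℂ] 𝓗 ⊗[ℂ] 𝓗) (a b n : ℕ) : TPow 𝓗 n →L[ℂ] TPow 𝓗 n :=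
  ((List.range' a (b - a)).map (fun k => twistAt T k n)).prod

/-- `R_{T,n} = 1 + T_1 + T_1 T_2 + ⋯ + T_1 ⋯ T_{n-1}` (with factors numbered from `1`). -/
def opR (T : 𝓗 ⊗[ℂ] 𝓗 →L[ℂ] 𝓗 ⊗[ℂ] 𝓗) (n : ℕ) : TPow 𝓗 n →L[ℂ] TPow 𝓗 n :=
  ∑ k ∈ Finset.range n, twistProd T 0 k n

/-- `P_{T,0} = 1` and `P_{T,n+1} = (1 ⊗ P_{T,n}) R_{T,n+1}`; in particular `P_{T,1} = 1`. -/
def opP (T : 𝓗 ⊗[ℂ] 𝓗 →L[ℂ] 𝓗 ⊗[ℂ] 𝓗) : (n : ℕ) → (TPow 𝓗 n →L[ℂ] TPow 𝓗 n)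
  | 0 => 1
  | n + 1 => idTensor (opP T n) * opR T (n + 1)

/-- A strictly positive operator: positive, with `⟪A v, v⟫ > 0` for all `v ≠ 0`. -/
def IsStrictlyPos {V : Type*} [NormedAddCommGroup V] [InnerProductSpace ℂ V] (A : V →L[ℂ] V) :
    Prop :=
  A.IsPositive ∧ ∀ v : V, v ≠ 0 → 0 < (⟪A v, v⟫_ℂ).re

/-- A strict twist: `‖T‖ ≤ 1` and `P_{T,n}` is strictly positive for all `n ≥ 1`. -/
def IsStrictTwist (T : 𝓗 ⊗[ℂ] 𝓗 →L[ℂ] 𝓗 ⊗[ℂ] 𝓗) : Prop :=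
  ‖T‖ ≤ 1 ∧ ∀ n : ℕ, 1 ≤ n → IsStrictlyPos (opP T n)

theorem IsStrictTwist.strictlyPos {T : 𝓗 ⊗[ℂ] 𝓗 →L[ℂ] 𝓗 ⊗[ℂ] 𝓗} (hT : IsStrictTwist T) (n : ℕ) :
    IsStrictlyPos (opP T n) := by
  rcases Nat.eq_zero_or_pos n with rfl | hn
  · refine ⟨ContinuousLinearMap.isPositive_one, fun v hv => ?_⟩
    have h : opP T 0 v = v := rfl
    rw [h]
    have := inner_self_eq_norm_sq (𝕜 := ℂ) v
    simp only [RCLike.re_to_complex] at this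
    rw [this]
    positivity
  · exact hT.2 n hn

/-- The Yang-Baxter equation `T_1 T_2 T_1 = T_2 T_1 T_2` on `𝓗 ⊗ 𝓗 ⊗ 𝓗`. -/
def IsBraided (T : 𝓗 ⊗[ℂ] 𝓗 →L[ℂ] 𝓗 ⊗[ℂ] 𝓗) : Prop :=
  twistAt T 0 3 * twistAt T 1 3 * twistAt T 0 3 = twistAt T 1 3 * twistAt T 0 3 * twistAt T 1 3

end TensorPowers

/-! ### The `T`-twisted Fock space and the field operators -/

section Fock

/-- The vector space `V` with the new inner product `⟪x, A y⟫`, for a strictly positive `A`. -/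
def Weighted {V : Type*} [NormedAddCommGroup V] [InnerProductSpace ℂ V] (A : V →L[ℂ] V)
    (_hA : IsStrictlyPos A) : Type _ := V

section Weighted

variable {V : Type*} [NormedAddCommGroup V] [InnerProductSpace ℂ V] {A : V →L[ℂ] V}
  (hA : IsStrictlyPos A)

instance : AddCommGroup (Weighted A hA) := inferInstanceAs (AddCommGroup V)
instance : Module ℂ (Weighted A hA) := inferInstanceAs (Module ℂ V)

/-- The identity map from `V` to the reweighted space. -/
def toWeighted : V ≃ₗ[ℂ] Weighted A hA := LinearEquiv.refl ℂ V

/-- The new inner product `⟪x, y⟫_A = ⟪x, A y⟫`. -/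
@[reducible] def weightedCore : InnerProductSpace.Core ℂ (Weighted A hA) where
  inner x y := ⟪(toWeighted hA).symm x, A ((toWeighted hA).symm y)⟫_ℂ
  conj_inner_symm x y := by
    change (starRingEnd ℂ) ⟪(toWeighted hA).symm y, A ((toWeighted hA).symm x)⟫_ℂ = _
    rw [inner_conj_symm]; exact hA.1.isSymmetric _ _
  re_inner_nonneg x := hA.1.re_inner_nonneg_right _
  add_left x y z := by
    rw [map_add, inner_add_left]
  smul_left x y r := by
    change ⟪(toWeighted hA).symm (r • x), _⟫_ℂ = _
    rw [map_smul, inner_smul_left]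
  definite x hx := by
    by_contra hne
    have h := hA.2 ((toWeighted hA).symm x) (by simpa using hne)
    change ⟪(toWeighted hA).symm x, A ((toWeighted hA).symm x)⟫_ℂ = 0 at hx
    have h2 : ⟪A ((toWeighted hA).symm x), (toWeighted hA).symm x⟫_ℂ = 0 := by
      rw [← inner_conj_symm, hx, map_zero]
    rw [h2] at h
    simp at h

instance : NormedAddCommGroup (Weighted A hA) :=
  @InnerProductSpace.Core.toNormedAddCommGroup ℂ _ _ _ _ (weightedCore hA)
instance : InnerProductSpace ℂ (Weighted A hA) := InnerProductSpace.ofCore _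

instance [FiniteDimensional ℂ V] : FiniteDimensional ℂ (Weighted A hA) :=
  inferInstanceAs (FiniteDimensional ℂ V)
instance [FiniteDimensional ℂ V] : CompleteSpace (Weighted A hA) :=
  FiniteDimensional.complete ℂ _

theorem inner_toWeighted (x y : V) :
    ⟪toWeighted hA x, toWeighted hA y⟫_ℂ = ⟪x, A y⟫_ℂ := rfl

end Weighted

variable {𝓗 : Type u} [NormedAddCommGroup 𝓗] [InnerProductSpace ℂ 𝓗] [FiniteDimensional ℂ 𝓗]
  {T : 𝓗 ⊗[ℂ] 𝓗 →L[ℂ] 𝓗 ⊗[ℂ] 𝓗}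

/-- The `n`-particle space `𝓗_{T,n}`: `𝓗^{⊗ n}` with the inner product `⟪x, P_{T,n} y⟫`. -/
abbrev Particle (hT : IsStrictTwist T) (n : ℕ) : Type u := Weighted (opP T n) (hT.strictlyPos n)

/-- The `T`-twisted Fock space `𝓕_T(𝓗)`, the Hilbert sum of the `𝓗_{T,n}`, `n ≥ 0`. -/
abbrev Fock (hT : IsStrictTwist T) : Type u := lp (fun n : ℕ => Particle hT n) 2

/-- The inclusion of `𝓗^{⊗ n} = 𝓗_{T,n}` in the Fock space. -/
def incl (hT : IsStrictTwist T) (n : ℕ) : TPow 𝓗 n →ₗ[ℂ] Fock hT :=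
  lp.lsingle 2 n ∘ₗ (toWeighted (hT.strictlyPos n)).toLinearMap

/-- The vacuum vector `Ω`. -/
def vacuum (hT : IsStrictTwist T) : Fock hT := incl hT 0 (tvac 𝓗)

/-- The inclusion of the algebraic direct sum of the `𝓗^{⊗ n}` (the finite particle vectors) in
the Fock space. -/
def finiteParticle (hT : IsStrictTwist T) :
    (DirectSum ℕ fun n : ℕ => TPow 𝓗 n) →ₗ[ℂ] Fock hT :=
  DirectSum.toModule ℂ ℕ (Fock hT) (fun n => incl hT n)

/-- `Φ_n ↦ ξ ⊗ Φ_n` on finite particle vectors. -/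
def finiteCreation (hT : IsStrictTwist T) (ξ : 𝓗) :
    (DirectSum ℕ fun n : ℕ => TPow 𝓗 n) →ₗ[ℂ] Fock hT :=
  DirectSum.toModule ℂ ℕ (Fock hT) (fun n => incl hT (n + 1) ∘ₗ tcons ξ n)

/-- The left creation operator `a_T^*(ξ)`: the extension by continuity to the Fock space of
`Φ_n ↦ ξ ⊗ Φ_n`. (It exists when `‖T‖ < 1`.) -/
def creation (hT : IsStrictTwist T) (ξ : 𝓗) : Fock hT →L[ℂ] Fock hT :=
  (finiteCreation hT ξ).extendOfNorm (finiteParticle hT)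

/-- The left annihilation operator `a_T(ξ)`, the adjoint of `a_T^*(ξ)`. -/
def annihilation (hT : IsStrictTwist T) (ξ : 𝓗) : Fock hT →L[ℂ] Fock hT :=
  ContinuousLinearMap.adjoint (creation hT ξ)

variable [CompleteSpace 𝓗]

/-- The left field operator `X_T(ξ) = a_T^*(ξ) + a_T(S_H ξ)`. -/
def field (H : StandardSubspace 𝓗) (hT : IsStrictTwist T) (ξ : 𝓗) : Fock hT →L[ℂ] Fock hT :=
  creation hT ξ + annihilation hT (tomita H ξ)

end Fock

/-! ### Von Neumann algebras and conjugate systems -/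

section VonNeumann

variable {K : Type*} [NormedAddCommGroup K] [InnerProductSpace ℂ K] [CompleteSpace K]

/-- The von Neumann algebra generated by a set `s` of bounded operators: the double commutant of
`s ∪ s^*`. -/
def generatedBy (s : Set (K →L[ℂ] K)) : VonNeumannAlgebra K where
  toStarSubalgebra :=
    StarSubalgebra.centralizer ℂ (StarSubalgebra.centralizer ℂ s : Set (K →L[ℂ] K))
  centralizer_centralizer' := by
    change Set.centralizer (Set.centralizer ((StarSubalgebra.centralizer ℂ
      (StarSubalgebra.centralizer ℂ s : Set (K →L[ℂ] K)) : StarSubalgebra ℂ (K →L[ℂ] K)) :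
        Set (K →L[ℂ] K))) = ((StarSubalgebra.centralizer ℂ
      (StarSubalgebra.centralizer ℂ s : Set (K →L[ℂ] K)) : StarSubalgebra ℂ (K →L[ℂ] K)) :
        Set (K →L[ℂ] K))
    simp only [StarSubalgebra.coe_centralizer, Set.centralizer_centralizer_centralizer]

/-- The monomial `x_{i_1} ⋯ x_{i_k}` attached to the word `i_1 ⋯ i_k`. -/
def monomial {d : ℕ} (w : List (Fin d)) : FreeAlgebra ℂ (Fin d) :=
  (w.map (FreeAlgebra.ι ℂ)).prod

/-- The free difference quotient `∂_i : ℂ⟨x_1, …, x_d⟩ → ℂ⟨x_1, …, x_d⟩ ⊗ ℂ⟨x_1, …, x_d⟩`,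
`∂_i (x_{j_1} ⋯ x_{j_k}) = ∑_m δ_{i,j_m} x_{j_1} ⋯ x_{j_{m-1}} ⊗ x_{j_{m+1}} ⋯ x_{j_k}`. -/
def freeDiff {d : ℕ} (i : Fin d) :
    FreeAlgebra ℂ (Fin d) →ₗ[ℂ] FreeAlgebra ℂ (Fin d) ⊗[ℂ] FreeAlgebra ℂ (Fin d) :=
  (FreeAlgebra.basisFreeMonoid ℂ (Fin d)).constr ℂ fun w =>
    ∑ m : Fin w.toList.length,
      if w.toList.get m = i then
        monomial (w.toList.take m) ⊗ₜ[ℂ] monomial (w.toList.drop (m + 1))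
      else 0

/-- The value `φ(p(X_1, …, X_d))` of the vector state `φ = ⟪Ω, · Ω⟫`. -/
def vectorState {d : ℕ} (Ω : K) (X : Fin d → K →L[ℂ] K) : FreeAlgebra ℂ (Fin d) →ₗ[ℂ] ℂ :=
  (innerSL ℂ Ω).toLinearMap ∘ₗ (ContinuousLinearMap.apply ℂ K Ω).toLinearMap ∘ₗ
    (FreeAlgebra.lift ℂ X).toLinearMap

/-- The linear functional `⟪1 ⊗ 1, ·⟫_{φ ⊗ φ^op}`, that is `p ⊗ q ↦ φ(p(X)) φ(q(X))`. -/
def vectorStateTensor {d : ℕ} (Ω : K) (X : Fin d → K →L[ℂ] K) :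
    FreeAlgebra ℂ (Fin d) ⊗[ℂ] FreeAlgebra ℂ (Fin d) →ₗ[ℂ] ℂ :=
  LinearMap.mul' ℂ ℂ ∘ₗ TensorProduct.map (vectorState Ω X) (vectorState Ω X)

/-- `Ξ = (Ξ_1, …, Ξ_d)` is a conjugate system for the generators `X = (X_1, …, X_d)` of the
von Neumann algebra `M`, taken in the vector state `φ` of `Ω`, with respect to the free difference
quotients. The space `L²(M, φ)` is the closure of `M Ω`. -/
structure IsConjugateSystem {d : ℕ} (M : VonNeumannAlgebra K) (Ω : K) (X : Fin d → K →L[ℂ] K)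
    (Ξ : Fin d → K) : Prop where
  generates : generatedBy (Set.range X) = M
  mem_L2 : ∀ i, Ξ i ∈ closure {v : K | ∃ a ∈ M, a Ω = v}
  conj : ∀ (i : Fin d) (p : FreeAlgebra ℂ (Fin d)),
    vectorStateTensor Ω X (freeDiff i p) = ⟪Ξ i, FreeAlgebra.lift ℂ X p Ω⟫_ℂ

end VonNeumann

section ArakiWoods

variable {𝓗 : Type u} [NormedAddCommGroup 𝓗] [InnerProductSpace ℂ 𝓗] [FiniteDimensional ℂ 𝓗]
  [CompleteSpace 𝓗] {T : 𝓗 ⊗[ℂ] 𝓗 →L[ℂ] 𝓗 ⊗[ℂ] 𝓗}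

/-- The `T`-twisted Araki-Woods von Neumann algebra `𝓛_T(H) = {exp(i X_T(ξ)) : ξ ∈ H + iH}''`
(here `H + iH` is the whole space). -/
def twistedArakiWoods (H : StandardSubspace 𝓗) (hT : IsStrictTwist T) :
    VonNeumannAlgebra (Fock hT) :=
  generatedBy (Set.range fun ξ : 𝓗 => NormedSpace.exp (Complex.I • field H hT ξ))

end ArakiWoods

/-! ### Incomplete matchings and the twisted contractions `W^T_π` -/

section Contractions

/-- An incomplete matching of `{0, …, n - 1}`: all blocks are singletons or pairings. -/
def IsIncompleteMatching {n : ℕ} (π : Finpartition (Finset.univ : Finset (Fin n))) : Prop :=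
  ∀ V ∈ π.parts, V.card = 1 ∨ V.card = 2

open Classical in
/-- The pairings `{i, j}`, `i < j`, of `π`, as pairs `(i, j)` listed in the left standard order
`i_1 < i_2 < ⋯ < i_s`. -/
def pairings {n : ℕ} (π : Finpartition (Finset.univ : Finset (Fin n))) : List (ℕ × ℕ) :=
  (((Finset.univ : Finset (Fin n ×ₗ Fin n)).filter fun v =>
      (ofLex v).1 < (ofLex v).2 ∧ {(ofLex v).1, (ofLex v).2} ∈ π.parts).sort (· ≤ ·)).map
    fun v => (((ofLex v).1 : ℕ), ((ofLex v).2 : ℕ))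

open Classical in
/-- `B(2n+1)`: the incomplete matchings of `{1, …, 2n+1}` for which `n + 1` is a singleton and each
`k ≤ n` is paired with an element of `{n+2, …, 2n+1}`. (With elements numbered `0, …, 2n`, the
element `n` is a singleton and each `k < n` is paired with some `l > n`.) -/
def matchingsB (n : ℕ) : Finset (Finpartition (Finset.univ : Finset (Fin (2 * n + 1)))) :=
  Finset.univ.filter fun π =>
    IsIncompleteMatching π ∧
    (∀ k : Fin (2 * n + 1), (k : ℕ) = n → {k} ∈ π.parts) ∧
    (∀ k : Fin (2 * n + 1), (k : ℕ) < n → ∃ l : Fin (2 * n + 1), n < (l : ℕ) ∧ {k, l} ∈ π.parts)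

variable {𝓗 : Type u} [NormedAddCommGroup 𝓗] [InnerProductSpace ℂ 𝓗] [FiniteDimensional ℂ 𝓗]
  [CompleteSpace 𝓗]

/-- The contraction `𝓗 ⊗ 𝓗 → ℂ`, `ξ ⊗ η ↦ ⟪S_H ξ, η⟫`. -/
def contraction (H : StandardSubspace 𝓗) : 𝓗 ⊗[ℂ] 𝓗 →L[ℂ] ℂ :=
  LinearMap.toContinuousLinearMap (TensorProduct.lift
    (LinearMap.mk₂ ℂ (fun ξ η => ⟪tomita H ξ, η⟫_ℂ)
      (fun ξ ξ' η => by rw [map_add, inner_add_left])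
      (fun c ξ η => by rw [ContinuousLinearMap.map_smulₛₗ, inner_smul_left]; simp)
      (fun ξ η η' => by rw [inner_add_right])
      (fun c ξ η => by rw [inner_smul_right]; simp)))

/-- The contraction `𝓗^{⊗ (n+2)} → 𝓗^{⊗ n}` of the tensor factors with numbers `k, k + 1`, where
the factors are numbered from `0` (and `0` if `n < k`):
`ξ_0 ⊗ ⋯ ⊗ ξ_{n+1} ↦ ⟪S_H ξ_k, ξ_{k+1}⟫ ξ_0 ⊗ ⋯ ⊗ ξ_{k-1} ⊗ ξ_{k+2} ⊗ ⋯ ⊗ ξ_{n+1}`. -/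
def contractAt (H : StandardSubspace 𝓗) : ℕ → (n : ℕ) → (TPow 𝓗 (n + 2) →L[ℂ] TPow 𝓗 n)
  | 0, n =>
    (TensorProduct.lidIsometry ℂ (TPow 𝓗 n) : ℂ ⊗[ℂ] TPow 𝓗 n →L[ℂ] TPow 𝓗 n) ∘L
      ((contraction H).rTensor (TPow 𝓗 n)) ∘L
      (tpowSuccSucc 𝓗 n : TPow 𝓗 (n + 2) →L[ℂ] (𝓗 ⊗[ℂ] 𝓗) ⊗[ℂ] TPow 𝓗 n)
  | k + 1, n + 1 => idTensor (contractAt H k n)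
  | _ + 1, 0 => 0

/-- The composition, over a list of pairs `(i_1, j_1), …, (i_s, j_s)`, of the twisted contractions
`C_{i_k - r_k(i_k)} T_{i_k - r_k(i_k) + 1} ⋯ T_{j_k - r_k(j_k) - 1}` in this order (that of
`(i_1, j_1)` is applied first), as an operator `𝓗^{⊗ n} → 𝓗^{⊗ m}`. Here `r_k(x)` is the number of
elements less than `x` among the `i_t, j_t` with `t < k`; these are collected in the list `used`.
(It is `0` unless `n = m + 2 s`.) -/
def contractSeq (H : StandardSubspace 𝓗) (T : 𝓗 ⊗[ℂ] 𝓗 →L[ℂ] 𝓗 ⊗[ℂ] 𝓗) (m : ℕ) :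
    List (ℕ × ℕ) → List ℕ → (n : ℕ) → (TPow 𝓗 n →L[ℂ] TPow 𝓗 m)
  | [], _, n => if h : n = m then h ▸ ContinuousLinearMap.id ℂ (TPow 𝓗 n) else 0
  | (i, j) :: L, used, n + 2 =>
    let i' := i - used.countP (· < i)
    let j' := j - used.countP (· < j)
    contractSeq H T m L (i :: j :: used) n ∘L contractAt H i' n ∘L twistProd T (i' + 1) j' (n + 2)
  | _ :: _, _, _ => 0

/-- The twisted contraction operator `W^T_π : 𝓗^{⊗ n} → 𝓗^{⊗ m}`, `m = |s(π)|`, formed along the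
left standard order of the pairings of `π`. -/
def opW (H : StandardSubspace 𝓗) (T : 𝓗 ⊗[ℂ] 𝓗 →L[ℂ] 𝓗 ⊗[ℂ] 𝓗) {n : ℕ}
    (π : Finpartition (Finset.univ : Finset (Fin n))) (m : ℕ) : TPow 𝓗 n →L[ℂ] TPow 𝓗 m :=
  contractSeq H T m (pairings π) [] n

/-- The `n`-th term `(-1)^n P_{T,2n+1}^{-1} ∑_{π ∈ B(2n+1)} (W^T_π)^* f`, `f ∈ 𝓗 = 𝓗^{⊗ 1}`. The
adjoint is that with respect to the standard inner products of `𝓗^{⊗ (2n+1)}` and `𝓗`. -/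
def conjugateTerm (H : StandardSubspace 𝓗) (T : 𝓗 ⊗[ℂ] 𝓗 →L[ℂ] 𝓗 ⊗[ℂ] 𝓗) (f : 𝓗) (n : ℕ) :
    TPow 𝓗 (2 * n + 1) :=
  (-1 : ℂ) ^ n • Ring.inverse (opP T (2 * n + 1))
    (∑ π ∈ matchingsB n, ContinuousLinearMap.adjoint (opW H T π 1) (tcons f 0 (tvac 𝓗)))

end Contractions

end TwistedArakiWoods

end

open TwistedArakiWoods

/-!
The field operators act on the vacuum by a Wick formula: the component in `𝓗^{⊗ n}` of
`X_T(ξ_1) ⋯ X_T(ξ_k) Ω` is the vector `fieldWord`, which satisfies a recursion in the first letter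
(`prod_field_vacuum`): a new letter is either put in front of the tensor, or contracted with the
tensor through the operator `C_1 (1 ⊗ R_{T,n})`. Contracting such a word across a middle factor, that
is, pairing *all* factors on the right of the middle one with factors on its left, gives the
operators `crossContract`. They are the sums of the `W^T_π`, `π ∈ B(2n+1)`
(`sum_opW_eq_crossContract`), since the recursive removal of the first pair of such a matching leaves
a matching of the same type.

Crossing symmetry is used through the single identity `C_1 T_2 = C_2 T_1` (`ContractsThrough`). On
eigenvectors of `Δ_H` the function `F` of the crossing condition is an exponential on the real line,
so by uniqueness it is this exponential on the strip, and comparing the two boundary values gives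
the identity (`IsCrossingSymmetric.contractsThrough`). With the braid relation it
implies that `crossContract` intertwines the operators `R_T` of the factors on the left of the
middle one (`ContractsThrough.idTensor_crossContract_comp`). Hence the alternating sum
`∑_N (-1)^N W_N` of the cross contractions of a word satisfies the same recursion in the first letter
as the sum `∑ X(A) Ω ⊗ x · φ(X(B))` over the decompositions `L = A x B` of the word: the alternating
signs cancel all correlations between the two sides of the middle letter
(`ContractsThrough.crossSum_eq_splitSum`). This is the conjugate relation for the monomial `L`,
because the inverses `P_{T,2n+1}⁻¹` in the series turn the inner product of the Fock space into that
of the tensor powers.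

Analytically, `R_{T,n}` is inverted by the telescoping relation with the products `T_1 ⋯ T_k`, which
gives `‖P_{T,n}⁻¹‖ ≤ Kⁿ` (`IsStrictTwist.norm_inverse_opP_le`). A contraction `C_1 T_2 ⋯ T_{a+1}`
across `a` other factors gains a factor `‖T‖^a`, and the first of `N` remaining factors on the left
is contracted across at least the `N - 1` others and the middle one. Hence the `n!` matchings of
`B(2n+1)` contribute at most `n! Cⁿ ‖T‖^{n(n+1)/2}`, and the series converges. The creation
operators are bounded because `P_{T,n+1} ≤ (1 - ‖T‖)⁻¹ (1 ⊗ P_{T,n})`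
(`IsStrictTwist.re_inner_opP_succ_le`). The vacuum is cyclic for the algebra generated by the
`X_T(e_i)` (`incl_mem_of_field_mem`), which gives uniqueness, and the exponentials `exp(i X_T(ξ))`
have the same commutant as the `X_T(e_i)` (`centralizer_field_eq`) by differentiation at `0`.
-/

noncomputable section

universe u

namespace TwistedArakiWoods

section TensorAlgebra

variable {𝓗 : Type u} [NormedAddCommGroup 𝓗] [InnerProductSpace ℂ 𝓗] [FiniteDimensional ℂ 𝓗]

/-! ### Operators on tensor powers -/

theorem tpow_ext {V : Type*} [AddCommMonoid V] [Module ℂ V] [TopologicalSpace V] {n : ℕ}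
    {A B : TPow 𝓗 (n + 1) →L[ℂ] V} (h : ∀ ξ v, A (tcons ξ n v) = B (tcons ξ n v)) : A = B := by
  apply ContinuousLinearMap.coe_inj.1
  exact TensorProduct.ext' h

@[simp] theorem idTensor_tcons {n m : ℕ} (A : TPow 𝓗 n →L[ℂ] TPow 𝓗 m) (ξ : 𝓗) (v : TPow 𝓗 n) :
    idTensor A (tcons ξ n v) = tcons ξ m (A v) := rfl

theorem tcons_smul_left (c : ℂ) (ξ : 𝓗) (n : ℕ) (v : TPow 𝓗 n) :
    tcons (c • ξ) n v = c • tcons ξ n v :=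
  (TensorProduct.smul_tmul' c ξ v).symm

theorem tcons_add_left (ξ η : 𝓗) (n : ℕ) (v : TPow 𝓗 n) :
    tcons (ξ + η) n v = tcons ξ n v + tcons η n v :=
  TensorProduct.add_tmul ξ η v

theorem tcons_zero_left (n : ℕ) (v : TPow 𝓗 n) : tcons (0 : 𝓗) n v = 0 :=
  TensorProduct.zero_tmul _ v

theorem idTensor_comp {n m k : ℕ} (A : TPow 𝓗 m →L[ℂ] TPow 𝓗 k) (B : TPow 𝓗 n →L[ℂ] TPow 𝓗 m) :
    idTensor (A ∘L B) = idTensor A ∘L idTensor B := tpow_ext fun _ _ => rfl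

theorem idTensor_mul {n : ℕ} (A B : TPow 𝓗 n →L[ℂ] TPow 𝓗 n) :
    idTensor (A * B) = idTensor A * idTensor B := idTensor_comp A B

theorem idTensor_one (n : ℕ) : idTensor (1 : TPow 𝓗 n →L[ℂ] TPow 𝓗 n) = 1 :=
  tpow_ext fun _ _ => rfl

theorem idTensor_id (n : ℕ) : idTensor (.id ℂ (TPow 𝓗 n)) = .id ℂ (TPow 𝓗 (n + 1)) :=
  tpow_ext fun _ _ => rfl

theorem idTensor_add {n m : ℕ} (A B : TPow 𝓗 n →L[ℂ] TPow 𝓗 m) :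
    idTensor (A + B) = idTensor A + idTensor B :=
  tpow_ext fun ξ v => by simp

@[simp] theorem idTensor_zero (n m : ℕ) :
    idTensor (0 : TPow 𝓗 n →L[ℂ] TPow 𝓗 m) = 0 :=
  tpow_ext fun ξ v => by simp

theorem idTensor_sum {n m : ℕ} {ι : Type*} (s : Finset ι) (A : ι → TPow 𝓗 n →L[ℂ] TPow 𝓗 m) :
    idTensor (∑ i ∈ s, A i) = ∑ i ∈ s, idTensor (A i) := by
  classical
  induction s using Finset.induction_on with
  | empty => simp
  | insert a s ha ih => rw [Finset.sum_insert ha, Finset.sum_insert ha, idTensor_add, ih]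

/-- The vector `u ⊗ v` for `u ∈ 𝓗 ⊗ 𝓗` and `v ∈ 𝓗^{⊗ n}`. -/
def tpair {n : ℕ} (u : 𝓗 ⊗[ℂ] 𝓗) (v : TPow 𝓗 n) : TPow 𝓗 (n + 2) :=
  (tpowSuccSucc 𝓗 n).symm (u ⊗ₜ[ℂ] v)

theorem tpair_tmul {n : ℕ} (ξ η : 𝓗) (v : TPow 𝓗 n) :
    tpair (ξ ⊗ₜ[ℂ] η) v = tcons ξ (n + 1) (tcons η n v) := rfl

theorem tpair_add {n : ℕ} (u u' : 𝓗 ⊗[ℂ] 𝓗) (v : TPow 𝓗 n) :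
    tpair (u + u') v = tpair u v + tpair u' v := by
  simp [tpair, TensorProduct.add_tmul]

theorem tpair_zero {n : ℕ} (v : TPow 𝓗 n) : tpair (0 : 𝓗 ⊗[ℂ] 𝓗) v = 0 := by
  rw [tpair, TensorProduct.zero_tmul]; exact LinearIsometryEquiv.map_zero _

theorem twistAt_zero_tpair (T : 𝓗 ⊗[ℂ] 𝓗 →L[ℂ] 𝓗 ⊗[ℂ] 𝓗) {n : ℕ} (u : 𝓗 ⊗[ℂ] 𝓗)
    (v : TPow 𝓗 n) : twistAt T 0 (n + 2) (tpair u v) = tpair (T u) v := by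
  simp [tpair, twistAt]; rfl

theorem idTensor_idTensor_tpair {n m : ℕ} (A : TPow 𝓗 n →L[ℂ] TPow 𝓗 m) (u : 𝓗 ⊗[ℂ] 𝓗)
    (v : TPow 𝓗 n) : idTensor (idTensor A) (tpair u v) = tpair u (A v) := by
  induction u using TensorProduct.induction_on with
  | zero => simp [tpair_zero]
  | tmul x y => rfl
  | add x y hx hy => rw [tpair_add, tpair_add, map_add, hx, hy]

theorem tpow_ext₂ {V : Type*} [AddCommMonoid V] [Module ℂ V] [TopologicalSpace V] {n : ℕ}
    {A B : TPow 𝓗 (n + 2) →L[ℂ] V}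
    (h : ∀ ξ η v, A (tcons ξ _ (tcons η n v)) = B (tcons ξ _ (tcons η n v))) : A = B :=
  tpow_ext fun ξ v => DFunLike.congr_fun
    (tpow_ext (A := A ∘L LinearMap.toContinuousLinearMap (tcons ξ (n + 1)))
      (B := B ∘L LinearMap.toContinuousLinearMap (tcons ξ (n + 1))) fun η w => h ξ η w) v

theorem tpow_ext₃ {V : Type*} [AddCommMonoid V] [Module ℂ V] [TopologicalSpace V] {n : ℕ}
    {A B : TPow 𝓗 (n + 3) →L[ℂ] V}
    (h : ∀ ξ η ζ v, A (tcons ξ _ (tcons η _ (tcons ζ n v))) =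
      B (tcons ξ _ (tcons η _ (tcons ζ n v)))) : A = B :=
  tpow_ext fun ξ v => DFunLike.congr_fun
    (tpow_ext₂ (A := A ∘L LinearMap.toContinuousLinearMap (tcons ξ (n + 2)))
      (B := B ∘L LinearMap.toContinuousLinearMap (tcons ξ (n + 2))) fun η ζ w => h ξ η ζ w) v

/-- `T_1` commutes with operators acting on the tensor factors from the third on. -/
theorem twistAt_zero_comp_idTensor (T : 𝓗 ⊗[ℂ] 𝓗 →L[ℂ] 𝓗 ⊗[ℂ] 𝓗) {n m : ℕ}
    (A : TPow 𝓗 n →L[ℂ] TPow 𝓗 m) :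
    twistAt T 0 (m + 2) ∘L idTensor (idTensor A) = idTensor (idTensor A) ∘L twistAt T 0 (n + 2) :=
  tpow_ext₂ fun ξ η v => by
    simp only [ContinuousLinearMap.comp_apply, ← tpair_tmul,
      idTensor_idTensor_tpair, twistAt_zero_tpair]

theorem twistAt_succ (T : 𝓗 ⊗[ℂ] 𝓗 →L[ℂ] 𝓗 ⊗[ℂ] 𝓗) (k n : ℕ) :
    twistAt T (k + 1) (n + 1) = idTensor (twistAt T k n) := rfl

theorem twistAt_of_lt (T : 𝓗 ⊗[ℂ] 𝓗 →L[ℂ] 𝓗 ⊗[ℂ] 𝓗) {k n : ℕ} (h : n < k + 2) :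
    twistAt T k n = 0 := by
  induction k generalizing n with
  | zero =>
    match n, h with
    | 0, _ => rfl
    | 1, _ => rfl
  | succ k ih =>
    match n, h with
    | 0, _ => rfl
    | n + 1, h => rw [twistAt_succ, ih (by omega), idTensor_zero]

theorem twistAt_commute (T : 𝓗 ⊗[ℂ] 𝓗 →L[ℂ] 𝓗 ⊗[ℂ] 𝓗) {i j : ℕ} (h : i + 2 ≤ j) (n : ℕ) :
    Commute (twistAt T i n) (twistAt T j n) := by
  induction i generalizing j n with
  | zero =>
    match n, j, h with
    | 0, _, _ => exact Commute.zero_left _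
    | 1, _, _ => exact Commute.zero_left _
    | n + 2, j + 2, _ => exact twistAt_zero_comp_idTensor T (twistAt T j n)
  | succ i ih =>
    match n, j, h with
    | 0, _, _ => exact Commute.zero_left _
    | n + 1, j + 1, h =>
      change twistAt T (i + 1) (n + 1) * _ = _
      rw [twistAt_succ, twistAt_succ, ← idTensor_mul, (ih (by omega) n).eq, idTensor_mul]

@[simp] theorem norm_tvac : ‖tvac 𝓗‖ = 1 :=
  (PiLp.norm_single 2 (fun _ : PUnit.{u + 1} => ℂ) PUnit.unit 1).trans norm_one

/-- An identity between operators which are natural in the tensor factors from the fourth on holds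
on all tensor powers if it holds on `𝓗^{⊗ 3}`. -/
theorem eq_of_natural {p : ℕ} {A B : ∀ n, TPow 𝓗 (n + 3) →L[ℂ] TPow 𝓗 (n + p)}
    {s : ∀ {n m}, (TPow 𝓗 n →L[ℂ] TPow 𝓗 m) → (TPow 𝓗 (n + p) →L[ℂ] TPow 𝓗 (m + p))}
    (hA : ∀ {n m} (F : TPow 𝓗 n →L[ℂ] TPow 𝓗 m),
      A m ∘L idTensor (idTensor (idTensor F)) = s F ∘L A n)
    (hB : ∀ {n m} (F : TPow 𝓗 n →L[ℂ] TPow 𝓗 m),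
      B m ∘L idTensor (idTensor (idTensor F)) = s F ∘L B n)
    (h : A 0 = B 0) (n : ℕ) : A n = B n := by
  refine tpow_ext₃ fun ξ η ζ v => ?_
  -- the vector `v` is the image of the unit vector of `𝓗^{⊗ 0}` under some operator
  let F : TPow 𝓗 0 →L[ℂ] TPow 𝓗 n := (innerSL ℂ (tvac 𝓗)).smulRight v
  have hF : F (tvac 𝓗) = v := by
    simp [F, norm_tvac]
  have hv : tcons ξ _ (tcons η _ (tcons ζ n v)) =
      idTensor (idTensor (idTensor F)) (tcons ξ _ (tcons η _ (tcons ζ 0 (tvac 𝓗)))) := by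
    rw [idTensor_tcons, idTensor_tcons, idTensor_tcons, hF]
  rw [hv, ← ContinuousLinearMap.comp_apply, ← ContinuousLinearMap.comp_apply, hA, hB, h]

theorem IsBraided.twistAt_zero {T : 𝓗 ⊗[ℂ] 𝓗 →L[ℂ] 𝓗 ⊗[ℂ] 𝓗} (hT : IsBraided T) (n : ℕ) :
    twistAt T 0 (n + 3) * twistAt T 1 (n + 3) * twistAt T 0 (n + 3) =
      twistAt T 1 (n + 3) * twistAt T 0 (n + 3) * twistAt T 1 (n + 3) := by
  have h0 : ∀ {n m} (F : TPow 𝓗 n →L[ℂ] TPow 𝓗 m),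
      twistAt T 0 (m + 3) ∘L idTensor (idTensor (idTensor F)) =
        idTensor (idTensor (idTensor F)) ∘L twistAt T 0 (n + 3) :=
    fun F => twistAt_zero_comp_idTensor T (idTensor F)
  have h1 : ∀ {n m} (F : TPow 𝓗 n →L[ℂ] TPow 𝓗 m),
      twistAt T 1 (m + 3) ∘L idTensor (idTensor (idTensor F)) =
        idTensor (idTensor (idTensor F)) ∘L twistAt T 1 (n + 3) := fun {n m} F => by
    rw [twistAt_succ, ← idTensor_comp, twistAt_zero_comp_idTensor, idTensor_comp]; rfl
  refine eq_of_natural (p := 3)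
    (A := fun n => twistAt T 0 (n + 3) * twistAt T 1 (n + 3) * twistAt T 0 (n + 3))
    (B := fun n => twistAt T 1 (n + 3) * twistAt T 0 (n + 3) * twistAt T 1 (n + 3))
    (s := fun F => idTensor (idTensor (idTensor F))) ?_ ?_ hT n
  · intro n m F
    simp only [ContinuousLinearMap.mul_def, ContinuousLinearMap.comp_assoc]
    rw [h0, ← ContinuousLinearMap.comp_assoc (twistAt T 1 (m + 3)), h1,
      ContinuousLinearMap.comp_assoc, ← ContinuousLinearMap.comp_assoc (twistAt T 0 (m + 3)), h0]
    simp only [ContinuousLinearMap.comp_assoc]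
  · intro n m F
    simp only [ContinuousLinearMap.mul_def, ContinuousLinearMap.comp_assoc]
    rw [h1, ← ContinuousLinearMap.comp_assoc (twistAt T 0 (m + 3)), h0,
      ContinuousLinearMap.comp_assoc, ← ContinuousLinearMap.comp_assoc (twistAt T 1 (m + 3)), h1]
    simp only [ContinuousLinearMap.comp_assoc]

theorem IsBraided.braid {T : 𝓗 ⊗[ℂ] 𝓗 →L[ℂ] 𝓗 ⊗[ℂ] 𝓗} (hT : IsBraided T) (k n : ℕ) :
    twistAt T k n * twistAt T (k + 1) n * twistAt T k n =
      twistAt T (k + 1) n * twistAt T k n * twistAt T (k + 1) n := by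
  induction k generalizing n with
  | zero =>
    rcases lt_or_ge n 3 with h | h
    · rw [twistAt_of_lt T (k := 0 + 1) (by omega)]; simp
    · obtain ⟨n, rfl⟩ := Nat.exists_eq_add_of_le' h
      exact hT.twistAt_zero n
  | succ k ih =>
    match n with
    | 0 => rw [twistAt_of_lt T (k := k + 1 + 1) (by omega)]; simp
    | n + 1 => simp only [twistAt_succ, ← idTensor_mul, ih]

/-! ### Products of the twists -/

theorem twistProd_self (T : 𝓗 ⊗[ℂ] 𝓗 →L[ℂ] 𝓗 ⊗[ℂ] 𝓗) (a n : ℕ) : twistProd T a a n = 1 := by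
  simp [twistProd]

theorem twistProd_succ (T : 𝓗 ⊗[ℂ] 𝓗 →L[ℂ] 𝓗 ⊗[ℂ] 𝓗) {a b : ℕ} (h : a ≤ b) (n : ℕ) :
    twistProd T a (b + 1) n = twistProd T a b n * twistAt T b n := by
  rw [twistProd, Nat.succ_sub h, List.range'_1_concat]
  simp [twistProd, h]

theorem twistProd_eq_mul (T : 𝓗 ⊗[ℂ] 𝓗 →L[ℂ] 𝓗 ⊗[ℂ] 𝓗) {a b : ℕ} (h : a < b) (n : ℕ) :
    twistProd T a b n = twistAt T a n * twistProd T (a + 1) b n := by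
  obtain ⟨c, rfl⟩ := Nat.exists_eq_add_of_lt h
  rw [twistProd, show a + c + 1 - a = c + 1 by omega, List.range'_succ]
  simp [twistProd, show a + c + 1 - (a + 1) = c by omega]

theorem twistProd_succ_succ (T : 𝓗 ⊗[ℂ] 𝓗 →L[ℂ] 𝓗 ⊗[ℂ] 𝓗) (a b n : ℕ) :
    twistProd T (a + 1) (b + 1) (n + 1) = idTensor (twistProd T a b n) := by
  rcases le_or_gt b a with h | h
  · simp [twistProd, Nat.sub_eq_zero_of_le h, idTensor_one]
  · induction b, h using Nat.le_induction with
    | base => simp [twistProd_succ, twistProd_self, twistAt_succ]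
    | succ b h ih =>
      rw [twistProd_succ T (by omega), ih, twistProd_succ T (by omega), idTensor_mul, twistAt_succ]

/-- `T_1 ⋯ T_j T_k = T_{k+1} T_1 ⋯ T_j` for `1 ≤ k < j`: here the product runs from `a` to
`b - 1`. -/
theorem IsBraided.twistProd_mul {T : 𝓗 ⊗[ℂ] 𝓗 →L[ℂ] 𝓗 ⊗[ℂ] 𝓗} (hT : IsBraided T) {a b k : ℕ}
    (hak : a ≤ k) (hkb : k + 1 < b) (n : ℕ) :
    twistProd T a b n * twistAt T k n =
      twistAt T (k + 1) n * twistProd T a b n := by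
  induction b, hkb using Nat.le_induction with
  | base =>
    rw [twistProd_succ T (by omega), twistProd_succ T (by omega)]
    have hc : Commute (twistProd T a k n) (twistAt T (k + 1) n) := by
      clear hT
      induction k, hak using Nat.le_induction with
      | base => rw [twistProd_self]; exact Commute.one_left _
      | succ k hk _ =>
        rw [twistProd]
        refine Commute.list_prod_left _ _ fun A hA => ?_
        obtain ⟨i, hi, rfl⟩ := List.mem_map.1 hA
        rw [List.mem_range'_1] at hi
        exact twistAt_commute T (by omega) n
    rw [mul_assoc, mul_assoc, ← mul_assoc (twistAt T k n), hT.braid,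
      mul_assoc, ← mul_assoc, hc.eq, mul_assoc, mul_assoc]
  | succ b h ih =>
    rw [twistProd_succ T (by omega), mul_assoc,
      ← (twistAt_commute T (show k + 2 ≤ b by omega) n).eq, ← mul_assoc, ih, mul_assoc]

theorem IsBraided.twistProd_mul_twistProd {T : 𝓗 ⊗[ℂ] 𝓗 →L[ℂ] 𝓗 ⊗[ℂ] 𝓗} (hT : IsBraided T)
    {a b c e : ℕ} (hac : a ≤ c) (heb : e < b) (n : ℕ) :
    twistProd T a b n * twistProd T c e n = twistProd T (c + 1) (e + 1) n * twistProd T a b n := by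
  rcases le_or_gt e c with h | h
  · simp [twistProd, Nat.sub_eq_zero_of_le h]
  · induction e, h using Nat.le_induction with
    | base =>
      rw [twistProd_succ T le_rfl, twistProd_succ T le_rfl, twistProd_self, twistProd_self,
        one_mul, one_mul, hT.twistProd_mul hac (by omega)]
    | succ e h ih =>
      rw [twistProd_succ T (by omega), ← mul_assoc, ih (by omega), mul_assoc,
        hT.twistProd_mul (by omega) (by omega), twistProd_succ T (b := e + 1) (by omega), mul_assoc]

end TensorAlgebra

section Contr

variable {𝓗 : Type u} [NormedAddCommGroup 𝓗] [InnerProductSpace ℂ 𝓗] [FiniteDimensional ℂ 𝓗]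
  (H : StandardSubspace 𝓗) {T : 𝓗 ⊗[ℂ] 𝓗 →L[ℂ] 𝓗 ⊗[ℂ] 𝓗}

/-! ### Contractions and the algebraic form of crossing symmetry -/

theorem contractAt_zero_tpair {n : ℕ} (u : 𝓗 ⊗[ℂ] 𝓗) (v : TPow 𝓗 n) :
    contractAt H 0 n (tpair u v) = contraction H u • v := by
  simp [tpair, contractAt]

theorem contractAt_zero_tcons {n : ℕ} (ξ η : 𝓗) (v : TPow 𝓗 n) :
    contractAt H 0 n (tcons ξ _ (tcons η _ v)) = ⟪tomita H ξ, η⟫_ℂ • v := by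
  rw [← tpair_tmul, contractAt_zero_tpair]; rfl

/-- The contraction of the first two tensor factors commutes with operators acting on the others. -/
theorem contractAt_zero_comp_idTensor {n m : ℕ} (A : TPow 𝓗 n →L[ℂ] TPow 𝓗 m) :
    contractAt H 0 m ∘L idTensor (idTensor A) = A ∘L contractAt H 0 n :=
  tpow_ext₂ fun ξ η v => by
    simp only [ContinuousLinearMap.comp_apply, ← tpair_tmul,
      idTensor_idTensor_tpair, contractAt_zero_tpair, map_smul]

/-- The algebraic form of crossing symmetry: contracting the factors `1, 2` after `T_2` is the same
as contracting the factors `2, 3` after `T_1`. -/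
def ContractsThrough (H : StandardSubspace 𝓗) (T : 𝓗 ⊗[ℂ] 𝓗 →L[ℂ] 𝓗 ⊗[ℂ] 𝓗) : Prop :=
  contractAt H 0 1 ∘L twistAt T 1 3 = contractAt H 1 1 ∘L twistAt T 0 3

variable {H}

theorem ContractsThrough.comp_eq (hC : ContractsThrough H T) (n : ℕ) :
    contractAt H 0 (n + 1) ∘L twistAt T 1 (n + 3) =
      contractAt H 1 (n + 1) ∘L twistAt T 0 (n + 3) := by
  refine eq_of_natural (p := 1)
    (A := fun n => contractAt H 0 (n + 1) ∘L twistAt T 1 (n + 3))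
    (B := fun n => contractAt H 1 (n + 1) ∘L twistAt T 0 (n + 3))
    (s := fun F => idTensor F) ?_ ?_ hC n
  · intro n m F
    rw [ContinuousLinearMap.comp_assoc, twistAt_succ, ← idTensor_comp, twistAt_zero_comp_idTensor,
      idTensor_comp, ← ContinuousLinearMap.comp_assoc, contractAt_zero_comp_idTensor,
      ContinuousLinearMap.comp_assoc]
    rfl
  · intro n m F
    rw [ContinuousLinearMap.comp_assoc, twistAt_zero_comp_idTensor, ← ContinuousLinearMap.comp_assoc,
      show contractAt H 1 (m + 1) = idTensor (contractAt H 0 m) from rfl, ← idTensor_comp,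
      contractAt_zero_comp_idTensor, idTensor_comp, ContinuousLinearMap.comp_assoc]
    rfl

/-- Contracting the factor `2` with the factor `j + 2` after moving the factor `i + 1` to the front
amounts to the corresponding operations in the reverse order. -/
theorem ContractsThrough.idTensor_comp_twistProd (hC : ContractsThrough H T) (hT : IsBraided T)
    {i j : ℕ} (hij : i < j) (m : ℕ) :
    idTensor (contractAt H 0 m ∘L twistProd T 1 j (m + 2)) ∘L twistProd T 0 (i + 1) (m + 3) =
      twistProd T 0 i (m + 1) ∘L contractAt H 0 (m + 1) ∘L twistProd T 1 (j + 1) (m + 3) := by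
  have e1 : twistProd T 0 i (m + 1) ∘L contractAt H 0 (m + 1) =
      contractAt H 0 (m + 1) ∘L twistProd T 2 (i + 2) (m + 3) := by
    rw [twistProd_succ_succ, twistProd_succ_succ, contractAt_zero_comp_idTensor]
  have e2 : twistProd T 2 (i + 2) (m + 3) * twistProd T 1 (j + 1) (m + 3) =
      twistProd T 1 (j + 1) (m + 3) * twistProd T 1 (i + 1) (m + 3) :=
    (hT.twistProd_mul_twistProd le_rfl (by omega) _).symm
  have e3 : twistProd T 1 (j + 1) (m + 3) = twistAt T 1 (m + 3) * twistProd T 2 (j + 1) (m + 3) :=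
    twistProd_eq_mul T (by omega) _
  have e4 : Commute (twistAt T 0 (m + 3)) (twistProd T 2 (j + 1) (m + 3)) := by
    rw [twistProd]
    refine Commute.list_prod_right _ _ fun A hA => ?_
    obtain ⟨k, hk, rfl⟩ := List.mem_map.1 hA
    rw [List.mem_range'_1] at hk
    exact twistAt_commute T (by omega) _
  rw [← ContinuousLinearMap.comp_assoc, e1, ContinuousLinearMap.comp_assoc,
    ← ContinuousLinearMap.mul_def, e2, e3, mul_assoc, ContinuousLinearMap.mul_def,
    ← ContinuousLinearMap.comp_assoc, hC.comp_eq, idTensor_comp,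
    twistProd_eq_mul T (a := 0) (by omega), ← twistProd_succ_succ]
  simp only [ContinuousLinearMap.comp_assoc, ← ContinuousLinearMap.mul_def]
  rw [← mul_assoc, ← e4.eq, mul_assoc]
  rfl

/-! ### The operators `R` and the contractions across a middle factor -/

/-- The operator `R_{T,p} ⊗ 1` on `𝓗^{⊗ n}`: the sum `1 + T_1 + ⋯ + T_1 ⋯ T_{p-1}`. -/
def opRPart (T : 𝓗 ⊗[ℂ] 𝓗 →L[ℂ] 𝓗 ⊗[ℂ] 𝓗) (p n : ℕ) : TPow 𝓗 n →L[ℂ] TPow 𝓗 n :=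
  ∑ k ∈ Finset.range p, twistProd T 0 k n

variable (H T) in
/-- The sum over `a ≤ j < b` of the twisted contractions `C_1 T_2 ⋯ T_j` of the tensor factor with
number `0` with that of number `j` (factors numbered from `0`). -/
def contractRange (a b m : ℕ) : TPow 𝓗 (m + 2) →L[ℂ] TPow 𝓗 m :=
  ∑ j ∈ Finset.Ico a b, contractAt H 0 m ∘L twistProd T 1 j (m + 2)

theorem opRPart_succ (p n : ℕ) :
    opRPart T (p + 1) (n + 1) = 1 + twistAt T 0 (n + 1) * idTensor (opRPart T p n) := by
  rw [opRPart, Finset.sum_range_succ', twistProd_self]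
  refine (add_comm _ _).trans (congrArg (1 + ·) ?_)
  rw [opRPart, idTensor_sum, Finset.mul_sum]
  exact Finset.sum_congr rfl fun k _ => by
    rw [twistProd_eq_mul T (by omega), twistProd_succ_succ]

theorem contractRange_one (p m : ℕ) :
    contractRange H T 1 (p + 1) m = contractAt H 0 m ∘L idTensor (opRPart T p (m + 1)) := by
  rw [contractRange, opRPart, idTensor_sum, ContinuousLinearMap.comp_finsetSum,
    Finset.range_eq_Ico, ← Finset.sum_Ico_add' _ 0 p 1]
  exact Finset.sum_congr rfl fun k _ => by rw [← twistProd_succ_succ]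

/-- A factor inserted on the left of a right contraction may be moved past the operators `R`. -/
theorem ContractsThrough.contractRange_comp (hC : ContractsThrough H T) (hT : IsBraided T)
    {p b : ℕ} (m : ℕ) :
    idTensor (contractRange H T (p + 1) b m) ∘L twistAt T 0 (m + 3) ∘L
        idTensor (opRPart T p (m + 2)) =
      opRPart T p (m + 1) ∘L contractRange H T (p + 2) (b + 1) (m + 1) := by
  have h1 : twistAt T 0 (m + 3) ∘L idTensor (opRPart T p (m + 2)) =
      ∑ i ∈ Finset.range p, twistProd T 0 (i + 1) (m + 3) := by
    rw [opRPart, idTensor_sum, ContinuousLinearMap.comp_finsetSum]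
    refine Finset.sum_congr rfl fun k _ => ?_
    rw [← ContinuousLinearMap.mul_def, twistProd_eq_mul T (b := k + 1) (by omega),
      twistProd_succ_succ]
  rw [h1, contractRange, idTensor_sum, ContinuousLinearMap.finsetSum_comp, contractRange, opRPart,
    ContinuousLinearMap.comp_finsetSum, ← Finset.sum_Ico_add' _ (p + 1) b 1]
  refine Finset.sum_congr rfl fun j hj => ?_
  rw [ContinuousLinearMap.comp_finsetSum, ContinuousLinearMap.finsetSum_comp]
  refine Finset.sum_congr rfl fun i hi => ?_
  rw [Finset.mem_range] at hi
  rw [Finset.mem_Ico] at hj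
  exact hC.idTensor_comp_twistProd hT (by omega) m

variable (H T) in
/-- The sum of the twisted contractions `W_π : 𝓗^{⊗ m} → 𝓗^{⊗ (l+1)}`, `m = l + 1 + 2N`, over the
incomplete matchings `π` in which each of the `N` factors on the right of the factor number `l + N`
is paired with one of the `l + N` factors on its left: if the first factor is a singleton, it is
kept, and otherwise it is contracted with a factor on the right of the middle one. (The value is
of no importance if `m ≠ l + 1 + 2N`.) -/
def crossContract : (N l m : ℕ) → (TPow 𝓗 m →L[ℂ] TPow 𝓗 (l + 1))
  | _, _, 0 => 0
  | 0, 0, 1 => .id ℂ _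
  | 0, 0, _ + 2 => 0
  | 0, l + 1, m + 1 => idTensor (crossContract 0 l m)
  | _ + 1, _, 1 => 0
  | N + 1, 0, m + 2 => crossContract N 0 m ∘L contractRange H T (N + 2) (m + 2) m
  | N + 1, l + 1, m + 2 => idTensor (crossContract (N + 1) l (m + 1)) +
      crossContract N (l + 1) m ∘L contractRange H T (l + N + 3) (m + 2) m

theorem crossContract_zero_right (N l : ℕ) : crossContract H T N l 0 = 0 := by
  rw [crossContract]

theorem crossContract_succ_one (N l : ℕ) : crossContract H T (N + 1) l 1 = 0 := by
  rw [crossContract]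

theorem crossContract_zero_succ (l m : ℕ) :
    crossContract H T 0 (l + 1) (m + 1) = idTensor (crossContract H T 0 l m) := by
  rw [crossContract]

theorem crossContract_zero_add_two (m : ℕ) : crossContract H T 0 0 (m + 2) = 0 := by
  rw [crossContract]

theorem crossContract_succ_zero (N m : ℕ) : crossContract H T (N + 1) 0 (m + 2) =
    crossContract H T N 0 m ∘L contractRange H T (N + 2) (m + 2) m := by
  rw [crossContract]

theorem crossContract_succ_succ (N l m : ℕ) : crossContract H T (N + 1) (l + 1) (m + 2) =
    idTensor (crossContract H T (N + 1) l (m + 1)) +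
      crossContract H T N (l + 1) m ∘L contractRange H T (l + N + 3) (m + 2) m := by
  rw [crossContract]

/-- The induction step for `ContractsThrough.idTensor_crossContract_comp`. The operator `W` splits
into a part `W₁` which keeps the first factor and a part which contracts it. -/
theorem ContractsThrough.idTensor_comp_opRPart_step (hC : ContractsThrough H T)
    (hT : IsBraided T) {p b l m : ℕ} {W W₁ : TPow 𝓗 (m + 2) →L[ℂ] TPow 𝓗 (l + 1)}
    {X : TPow 𝓗 m →L[ℂ] TPow 𝓗 (l + 1)} {Y : TPow 𝓗 (m + 1) →L[ℂ] TPow 𝓗 (l + 2)}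
    (hW : W = W₁ + X ∘L contractRange H T (p + 1) b m)
    (hXY : idTensor X ∘L opRPart T p (m + 1) = opRPart T (l + 1) (l + 2) ∘L Y)
    (hW₁ : idTensor W₁ ∘L twistAt T 0 (m + 3) ∘L idTensor (opRPart T p (m + 2)) =
      twistAt T 0 (l + 2) ∘L idTensor (opRPart T l (l + 1)) ∘L idTensor W) :
    idTensor W ∘L opRPart T (p + 1) (m + 3) =
      opRPart T (l + 1) (l + 2) ∘L
        (idTensor W + Y ∘L contractRange H T (p + 2) (b + 1) (m + 1)) := by
  have h1 : idTensor W ∘L opRPart T (p + 1) (m + 3) = idTensor W +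
      idTensor W ∘L (twistAt T 0 (m + 3) ∘L idTensor (opRPart T p (m + 2))) := by
    rw [opRPart_succ, ContinuousLinearMap.comp_add]; rfl
  have h2 : opRPart T (l + 1) (l + 2) ∘L idTensor W = idTensor W +
      twistAt T 0 (l + 2) ∘L idTensor (opRPart T l (l + 1)) ∘L idTensor W := by
    rw [opRPart_succ, ContinuousLinearMap.add_comp]; rfl
  have h3 : idTensor W ∘L (twistAt T 0 (m + 3) ∘L idTensor (opRPart T p (m + 2))) =
      idTensor W₁ ∘L (twistAt T 0 (m + 3) ∘L idTensor (opRPart T p (m + 2))) +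
      idTensor X ∘L idTensor (contractRange H T (p + 1) b m) ∘L
        (twistAt T 0 (m + 3) ∘L idTensor (opRPart T p (m + 2))) := by
    rw [hW, idTensor_add, ContinuousLinearMap.add_comp, idTensor_comp,
      ContinuousLinearMap.comp_assoc (idTensor X)]
  rw [h1, h3, hW₁, hC.contractRange_comp hT, ← ContinuousLinearMap.comp_assoc (idTensor X), hXY,
    ContinuousLinearMap.comp_add, h2]
  exact (add_assoc _ _ _).symm

/-- The contractions across the middle factor intertwine the operators `R_{T,l+N+1}` and
`R_{T,l+1}` of the factors on the left of the middle one: annihilating one of these factors commutes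
with contracting the others. -/
theorem ContractsThrough.idTensor_crossContract_comp (hC : ContractsThrough H T)
    (hT : IsBraided T) {p N l : ℕ} (hp : p = l + N + 1) (m : ℕ) :
    idTensor (crossContract H T N l m) ∘L opRPart T p (m + 1) =
      opRPart T (l + 1) (l + 2) ∘L crossContract H T N (l + 1) (m + 1) := by
  have hone : ∀ n, opRPart T 1 n = .id ℂ (TPow 𝓗 n) := fun n => by
    rw [opRPart, Finset.sum_range_one, twistProd_self]; rfl
  have hzero : ∀ n, opRPart T 0 n = 0 := fun n => by rw [opRPart, Finset.sum_range_zero]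
  -- the part of the identity in which the first of the factors on the left is kept
  have key : ∀ {p N l m}, idTensor (crossContract H T N l m) ∘L opRPart T p (m + 1) =
      opRPart T (l + 1) (l + 2) ∘L crossContract H T N (l + 1) (m + 1) →
      idTensor (idTensor (crossContract H T N l m)) ∘L
        twistAt T 0 (m + 2) ∘L idTensor (opRPart T p (m + 1)) =
      twistAt T 0 (l + 3) ∘L idTensor (opRPart T (l + 1) (l + 2)) ∘L
        idTensor (crossContract H T N (l + 1) (m + 1)) := fun {p N l m} h => by
    rw [← ContinuousLinearMap.comp_assoc, ← twistAt_zero_comp_idTensor,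
      ContinuousLinearMap.comp_assoc, ← idTensor_comp, h, idTensor_comp]
  induction m using Nat.strong_induction_on generalizing p N l with
  | _ m ih =>
  match m, N, l with
  | 0, 0, l => simp [crossContract_zero_right, crossContract_zero_succ]
  | 0, N + 1, l => simp [crossContract_zero_right, crossContract_succ_one]
  | 1, 0, 0 =>
    subst hp
    rw [crossContract_zero_succ, hone]; rfl
  | m + 2, 0, 0 => simp [crossContract_zero_add_two, crossContract_zero_succ]
  | m + 1, 0, l + 1 =>
    obtain ⟨p, rfl⟩ : ∃ q, p = q + 1 := ⟨_, hp⟩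
    have h := key (ih m (by omega) (p := p) (N := 0) (l := l) (by omega))
    rw [crossContract_zero_succ] at h
    rw [crossContract_zero_succ, crossContract_zero_succ, crossContract_zero_succ,
      opRPart_succ, opRPart_succ, ContinuousLinearMap.comp_add, ContinuousLinearMap.add_comp,
      ContinuousLinearMap.mul_def, ContinuousLinearMap.mul_def, ContinuousLinearMap.comp_assoc, ← h]
    rfl
  | 1, N + 1, l =>
    match l with
    | 0 => simp [crossContract_succ_one, crossContract_succ_succ, crossContract_zero_right]
    | l + 1 => simp [crossContract_succ_one, crossContract_succ_succ, crossContract_zero_right]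
  | m + 2, N + 1, 0 =>
    obtain ⟨p, rfl⟩ : ∃ q, p = q + 1 := ⟨_, hp⟩
    obtain rfl : p = N + 1 := by omega
    rw [crossContract_succ_succ, show 0 + N + 3 = N + 3 by omega]
    refine hC.idTensor_comp_opRPart_step hT (W₁ := 0) (X := crossContract H T N 0 m) ?_
      (ih m (by omega) (by omega)) ?_
    · exact (crossContract_succ_zero N m).trans (zero_add _).symm
    · rw [hzero]; simp
  | m + 2, N + 1, l + 1 =>
    obtain ⟨p, rfl⟩ : ∃ q, p = q + 1 := ⟨_, hp⟩
    rw [crossContract_succ_succ N (l + 1), show l + 1 + N + 3 = p + 2 by omega]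
    refine hC.idTensor_comp_opRPart_step hT (X := crossContract H T N (l + 1) m) ?_
      (ih m (by omega) (by omega)) (key (ih (m + 1) (by omega) (by omega)))
    rw [crossContract_succ_succ, show l + N + 3 = p + 1 by omega]

end Contr

section WickWords

variable {𝓗 : Type u} [NormedAddCommGroup 𝓗] [InnerProductSpace ℂ 𝓗] [FiniteDimensional ℂ 𝓗]
  (H : StandardSubspace 𝓗) (T : 𝓗 ⊗[ℂ] 𝓗 →L[ℂ] 𝓗 ⊗[ℂ] 𝓗)

/-! ### Words in the field operators applied to the vacuum -/

/-- The `n`-particle component of `X_T(ξ_1) ⋯ X_T(ξ_k) Ω`, for the word `ξ_1 ⋯ ξ_k`. -/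
def fieldWord : List 𝓗 → (n : ℕ) → TPow 𝓗 n
  | [], 0 => tvac 𝓗
  | [], _ + 1 => 0
  | ξ :: L, 0 => contractRange H T 1 2 0 (tcons ξ 1 (fieldWord L 1))
  | ξ :: L, n + 1 => tcons ξ n (fieldWord L n) +
      contractRange H T 1 (n + 3) (n + 1) (tcons ξ (n + 2) (fieldWord L (n + 2)))

/-- The vacuum expectation value of `X_T(ξ_1) ⋯ X_T(ξ_k)`. -/
def wordState (L : List 𝓗) : ℂ := ⟪tvac 𝓗, fieldWord H T L 0⟫_ℂ

theorem eq_inner_smul_tvac (v : TPow 𝓗 0) : v = ⟪tvac 𝓗, v⟫_ℂ • tvac 𝓗 := by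
  have h : ∀ w : EuclideanSpace ℂ PUnit.{u + 1}, w =
      ⟪EuclideanSpace.single PUnit.unit (1 : ℂ), w⟫_ℂ • EuclideanSpace.single PUnit.unit 1 := by
    intro w
    ext i
    simp [EuclideanSpace.inner_single_left]
  exact h v

variable {H T}

theorem fieldWord_eq_zero {L : List 𝓗} {n : ℕ} (h : L.length < n) : fieldWord H T L n = 0 := by
  induction L generalizing n with
  | nil =>
    match n, h with
    | n + 1, _ => rw [fieldWord]
  | cons ξ L ih =>
    match n, h with
    | n + 1, h =>
      rw [List.length_cons] at h
      rw [fieldWord, ih (by omega), ih (by omega)]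
      simp

/-- Tensoring on the right: `v ↦ v ⊗ x` from `𝓗^{⊗ n}` to `𝓗^{⊗ (n+1)}`. -/
def tsnoc (x : 𝓗) : (n : ℕ) → (TPow 𝓗 n →L[ℂ] TPow 𝓗 (n + 1))
  | 0 => (innerSL ℂ (tvac 𝓗)).smulRight (tcons x 0 (tvac 𝓗))
  | n + 1 => idTensor (tsnoc x n)

theorem tsnoc_tvac (x : 𝓗) : tsnoc x 0 (tvac 𝓗) = tcons x 0 (tvac 𝓗) := by
  simp [tsnoc]

theorem twistAt_comp_tsnoc (x : 𝓗) {k n : ℕ} (h : k + 2 ≤ n) :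
    twistAt T k (n + 1) ∘L tsnoc x n = tsnoc x n ∘L twistAt T k n := by
  induction k generalizing n with
  | zero =>
    obtain ⟨n, rfl⟩ := Nat.exists_eq_add_of_le' h
    exact twistAt_zero_comp_idTensor T (tsnoc x n)
  | succ k ih =>
    match n, h with
    | n + 1, h =>
      change idTensor (twistAt T k (n + 1)) ∘L idTensor (tsnoc x n) =
        idTensor (tsnoc x n) ∘L idTensor (twistAt T k n)
      rw [← idTensor_comp, ← idTensor_comp, ih (by omega)]

theorem opRPart_comp_tsnoc (x : 𝓗) {p n : ℕ} (h : p ≤ n) :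
    opRPart T p (n + 1) ∘L tsnoc x n = tsnoc x n ∘L opRPart T p n := by
  have hprod : ∀ k, k + 1 ≤ n → twistProd T 0 k (n + 1) ∘L tsnoc x n =
      tsnoc x n ∘L twistProd T 0 k n := fun k hk => by
    induction k with
    | zero => rw [twistProd_self, twistProd_self]; rfl
    | succ k ih =>
      rw [twistProd_succ T (by omega), twistProd_succ T (by omega), ContinuousLinearMap.mul_def,
        ContinuousLinearMap.comp_assoc, twistAt_comp_tsnoc x (by omega),
        ← ContinuousLinearMap.comp_assoc, ih (by omega)]
      rfl
  rw [opRPart, ContinuousLinearMap.finsetSum_comp, opRPart, ContinuousLinearMap.comp_finsetSum]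
  exact Finset.sum_congr rfl fun k hk => hprod k (by have := Finset.mem_range.1 hk; omega)

theorem contractRange_comp_tsnoc (x : 𝓗) (n : ℕ) :
    contractRange H T 1 (n + 2) (n + 1) ∘L tsnoc x (n + 2) =
      tsnoc x n ∘L contractRange H T 1 (n + 2) n := by
  rw [contractRange_one, contractRange_one, ContinuousLinearMap.comp_assoc]
  change contractAt H 0 (n + 1) ∘L idTensor _ ∘L idTensor (tsnoc x (n + 1)) = _
  rw [← idTensor_comp, opRPart_comp_tsnoc x le_rfl, idTensor_comp, ← ContinuousLinearMap.comp_assoc]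
  change (contractAt H 0 (n + 1) ∘L idTensor (idTensor (tsnoc x n))) ∘L _ = _
  rw [contractAt_zero_comp_idTensor, ContinuousLinearMap.comp_assoc]

variable (H T)

/-- The sum over all splittings `L = A ξ B` of the word `L` of the vectors
`⟪Ω, X(B) Ω⟫ (X(A) Ω)_l ⊗ ξ`. -/
def splitSum (L : List 𝓗) (l : ℕ) : TPow 𝓗 (l + 1) :=
  ∑ k : Fin L.length, wordState H T (L.drop (k + 1)) •
    tsnoc (L.get k) l (fieldWord H T (L.take k) l)

/-- The alternating sum over `N` of the contractions of the components of `X(L) Ω` across a middle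
factor. -/
def crossSum (B : ℕ) (L : List 𝓗) (l : ℕ) : TPow 𝓗 (l + 1) :=
  ∑ N ∈ Finset.range B, (-1 : ℂ) ^ N •
    crossContract H T N l (2 * N + l + 1) (fieldWord H T L (2 * N + l + 1))

variable {H T}

theorem splitSum_cons_zero (ξ : 𝓗) (L : List 𝓗) :
    splitSum H T (ξ :: L) 0 = wordState H T L • tcons ξ 0 (tvac 𝓗) +
      contractRange H T 1 2 1 (tcons ξ 2 (splitSum H T L 1)) := by
  simp only [splitSum, List.length_cons]
  rw [Fin.sum_univ_succ]
  simp only [Fin.val_zero, List.drop_succ_cons, List.drop_zero, List.get_cons_zero,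
    List.take_zero, Fin.val_succ, List.take_succ_cons, map_sum, map_smul]
  congr 1
  · rw [fieldWord, tsnoc_tvac]
  · refine Finset.sum_congr rfl fun k _ => ?_
    rw [fieldWord]
    exact congrArg _ (DFunLike.congr_fun (contractRange_comp_tsnoc (H := H) (T := T) (L.get k) 0)
      (tcons ξ 1 _)).symm

theorem splitSum_cons_succ (ξ : 𝓗) (L : List 𝓗) (l : ℕ) :
    splitSum H T (ξ :: L) (l + 1) = tcons ξ (l + 1) (splitSum H T L l) +
      contractRange H T 1 (l + 3) (l + 2) (tcons ξ (l + 3) (splitSum H T L (l + 2))) := by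
  simp only [splitSum, List.length_cons]
  rw [Fin.sum_univ_succ]
  simp only [Fin.val_zero, List.drop_succ_cons, List.drop_zero, List.get_cons_zero,
    List.take_zero, Fin.val_succ, List.take_succ_cons, map_sum, map_smul]
  rw [fieldWord, map_zero, smul_zero, zero_add, ← Finset.sum_add_distrib]
  refine Finset.sum_congr rfl fun k _ => ?_
  rw [fieldWord, map_add, smul_add]
  congr 1
  exact congrArg _ (DFunLike.congr_fun (contractRange_comp_tsnoc (H := H) (T := T) (L.get k) (l + 1))
      (tcons ξ (l + 2) _)).symm

/-- Splitting off from `X(ξ) Φ` the part in which `ξ` is contracted with a factor on the left of the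
middle one. -/
theorem ContractsThrough.crossContract_contractRange (hC : ContractsThrough H T) (hT : IsBraided T)
    (N l m : ℕ) (hm : l + N + 1 ≤ m + 1) (ξ : 𝓗) (v : TPow 𝓗 (m + 1)) :
    crossContract H T N l m (contractRange H T 1 (m + 2) m (tcons ξ _ v)) =
      contractRange H T 1 (l + 2) (l + 1) (tcons ξ _ (crossContract H T N (l + 1) (m + 1) v)) +
      crossContract H T N l m (contractRange H T (l + N + 2) (m + 2) m (tcons ξ _ v)) := by
  have hsplit : contractRange H T 1 (m + 2) m = contractRange H T 1 (l + N + 2) m +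
      contractRange H T (l + N + 2) (m + 2) m :=
    (Finset.sum_Ico_consecutive _ (by omega) (by omega)).symm
  rw [hsplit, add_apply, map_add]
  congr 1
  have h := hC.idTensor_crossContract_comp hT (p := l + N + 1) rfl m
  have e : crossContract H T N l m ∘L contractRange H T 1 (l + N + 2) m =
      contractRange H T 1 (l + 2) (l + 1) ∘L idTensor (crossContract H T N (l + 1) (m + 1)) := by
    rw [contractRange_one, contractRange_one, ← ContinuousLinearMap.comp_assoc,
      ← contractAt_zero_comp_idTensor, ContinuousLinearMap.comp_assoc, ← idTensor_comp, h,
      idTensor_comp, ← ContinuousLinearMap.comp_assoc]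
  exact DFunLike.congr_fun e (tcons ξ _ v)

theorem sum_range_alternating_telescope {V : Type*} [AddCommGroup V] [Module ℂ V] (P : ℕ → V)
    (B : ℕ) : ∑ N ∈ Finset.range (B + 1),
      (-1 : ℂ) ^ N • (P N + if N = 0 then 0 else P (N - 1)) = (-1 : ℂ) ^ B • P B := by
  induction B with
  | zero => simp
  | succ B ih =>
    rw [Finset.sum_range_succ, ih]
    simp only [Nat.add_eq_zero_iff, one_ne_zero, and_false, if_false, Nat.add_sub_cancel, pow_succ]
    module

/-- The recursion for `crossSum` under left multiplication by a field operator. The contractions of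
the new factor with factors on the right of the middle one telescope. -/
theorem ContractsThrough.crossSum_cons (hC : ContractsThrough H T) (hT : IsBraided T) {B : ℕ}
    (ξ : 𝓗) {L : List 𝓗} (hL : L.length < B) (l : ℕ) (F : ℕ → TPow 𝓗 (l + 1))
    (hF : ∀ N, crossContract H T N l (2 * N + l + 1) (tcons ξ _ (fieldWord H T L (2 * N + l))) =
      F N + if N = 0 then 0 else
        crossContract H T (N - 1) l (2 * (N - 1) + l + 1)
          (contractRange H T (l + (N - 1) + 2) (2 * (N - 1) + l + 1 + 2) (2 * (N - 1) + l + 1)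
            (tcons ξ _ (fieldWord H T L (2 * (N - 1) + l + 1 + 1))))) :
    crossSum H T B (ξ :: L) l = ∑ N ∈ Finset.range B, (-1 : ℂ) ^ N • F N +
      contractRange H T 1 (l + 2) (l + 1) (tcons ξ _ (crossSum H T B L (l + 1))) := by
  let P : ℕ → TPow 𝓗 (l + 1) := fun N => crossContract H T N l (2 * N + l + 1)
    (contractRange H T (l + N + 2) (2 * N + l + 1 + 2) (2 * N + l + 1)
      (tcons ξ _ (fieldWord H T L (2 * N + l + 1 + 1))))
  obtain ⟨B, rfl⟩ : ∃ B', B = B' + 1 := ⟨B - 1, by omega⟩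
  have hP : P B = 0 := by
    simp only [P]
    rw [fieldWord_eq_zero (by omega)]
    simp
  have htel := sum_range_alternating_telescope P B
  rw [hP, smul_zero] at htel
  rw [← add_zero (∑ N ∈ Finset.range (B + 1), (-1 : ℂ) ^ N • F N + _), ← htel, crossSum, crossSum,
    map_sum, map_sum, ← Finset.sum_add_distrib, ← Finset.sum_add_distrib]
  refine Finset.sum_congr rfl fun N _ => ?_
  rw [fieldWord, map_add, hF, hC.crossContract_contractRange hT _ _ _ (by omega), map_smul, map_smul,
    ← smul_add, ← smul_add]
  congr 1
  have habel : ∀ a b c e : TPow 𝓗 (l + 1), a + b + (c + e) = a + c + (e + b) := by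
    intros; abel
  exact habel _ _ _ _

theorem ContractsThrough.crossSum_cons_zero (hC : ContractsThrough H T) (hT : IsBraided T) {B : ℕ}
    (ξ : 𝓗) {L : List 𝓗} (hL : L.length < B) :
    crossSum H T B (ξ :: L) 0 = wordState H T L • tcons ξ 0 (tvac 𝓗) +
      contractRange H T 1 2 1 (tcons ξ 2 (crossSum H T B L 1)) := by
  rw [hC.crossSum_cons hT ξ hL 0
    (fun N => if N = 0 then wordState H T L • tcons ξ 0 (tvac 𝓗) else 0)]
  · congr 1
    rw [Finset.sum_eq_single_of_mem 0 (Finset.mem_range.2 (by omega))]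
    · simp
    · intro N _ hN
      simp [hN]
  · intro N
    match N with
    | 0 =>
      simp only [if_true, add_zero]
      rw [wordState, ← map_smul, ← eq_inner_smul_tvac]
      rfl
    | N + 1 =>
      have h : ∀ (k m a : ℕ), k = m + 1 → a = N + 2 → ∀ v : (n : ℕ) → TPow 𝓗 n,
          crossContract H T (N + 1) 0 (k + 1) (tcons ξ _ (v k)) =
            crossContract H T N 0 m (contractRange H T a (m + 2) m (tcons ξ _ (v (m + 1)))) := by
        rintro _ m _ rfl rfl v
        exact DFunLike.congr_fun (crossContract_succ_zero N m) (tcons ξ _ _)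
      rw [if_neg (by omega), if_neg (by omega)]
      exact (h _ _ _ (by omega) (by omega) (fieldWord H T L)).trans (zero_add _).symm

theorem ContractsThrough.crossSum_cons_succ (hC : ContractsThrough H T) (hT : IsBraided T) {B : ℕ}
    (ξ : 𝓗) {L : List 𝓗} (hL : L.length < B) (l : ℕ) :
    crossSum H T B (ξ :: L) (l + 1) = tcons ξ (l + 1) (crossSum H T B L l) +
      contractRange H T 1 (l + 3) (l + 2) (tcons ξ (l + 3) (crossSum H T B L (l + 2))) := by
  rw [hC.crossSum_cons hT ξ hL (l + 1) (fun N => tcons ξ (l + 1)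
    (crossContract H T N l (2 * N + l + 1) (fieldWord H T L (2 * N + l + 1))))]
  · congr 1
    simp only [crossSum, map_sum, map_smul]
  · intro N
    match N with
    | 0 =>
      simp only [if_true, add_zero]
      exact DFunLike.congr_fun (crossContract_zero_succ l (2 * 0 + l + 1)) (tcons ξ _ _)
    | N + 1 =>
      have h : ∀ (k m a : ℕ), k = m + 1 → a = l + N + 3 → ∀ v : (n : ℕ) → TPow 𝓗 n,
          crossContract H T (N + 1) (l + 1) (k + 1) (tcons ξ _ (v k)) =
          tcons ξ (l + 1) (crossContract H T (N + 1) l k (v k)) +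
            crossContract H T N (l + 1) m
              (contractRange H T a (m + 2) m (tcons ξ _ (v (m + 1)))) := by
        rintro _ m _ rfl rfl v
        exact DFunLike.congr_fun (crossContract_succ_succ N l m) (tcons ξ _ _)
      rw [if_neg (by omega)]
      exact h _ _ _ (by omega) (by omega) (fieldWord H T L)

/-- The alternating sum of the contractions across a middle factor splits the word at this factor. -/
theorem ContractsThrough.crossSum_eq_splitSum (hC : ContractsThrough H T) (hT : IsBraided T) {B : ℕ}
    {L : List 𝓗} (hL : L.length ≤ B) (l : ℕ) : crossSum H T B L l = splitSum H T L l := by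
  induction L generalizing l with
  | nil =>
    rw [crossSum, splitSum, Finset.sum_eq_zero fun N _ => ?_]
    · simp
    · rw [fieldWord, map_zero, smul_zero]
  | cons ξ L ih =>
    rw [List.length_cons] at hL
    match l with
    | 0 => rw [hC.crossSum_cons_zero hT ξ hL, splitSum_cons_zero, ih (by omega)]
    | l + 1 =>
      rw [hC.crossSum_cons_succ hT ξ hL, splitSum_cons_succ, ih (by omega), ih (by omega)]

end WickWords

/-! ### Uniqueness of the continuation to the strip -/

theorem eqOn_strip_of_eq_on_real {F : ℂ → ℂ} (hF : DiffContOnCl ℂ F {z : ℂ | 0 < z.im ∧ z.im < 1 / 2})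
    (hb : ∃ C : ℝ, ∀ z : ℂ, 0 ≤ z.im → z.im ≤ 1 / 2 → ‖F z‖ ≤ C) (a : ℝ) (c : ℂ)
    (h : ∀ t : ℝ, F t = Complex.exp (t * Complex.I * a) * c) :
    F (Complex.I / 2) = Complex.exp (-(a / 2)) * c := by
  obtain ⟨C, hC⟩ := hb
  have hE : ∀ z : ℂ, 0 ≤ z.im → z.im ≤ 1 / 2 →
      ‖Complex.exp (z * Complex.I * a) * c‖ ≤ Real.exp |a| * ‖c‖ := fun z h0 h1 => by
    rw [norm_mul, Complex.norm_exp]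
    gcongr
    have e : (z * Complex.I * a).re = -(z.im * a) := by simp
    rw [e]
    refine (neg_le_abs _).trans ?_
    rw [abs_mul, abs_of_nonneg h0]
    nlinarith [abs_nonneg a]
  set G : ℂ → ℂ := fun z => F z - Complex.exp (z * Complex.I * a) * c with hG
  have hGd : DiffContOnCl ℂ G {z : ℂ | 0 < z.im ∧ z.im < 1 / 2} :=
    hF.sub (Differentiable.diffContOnCl (by fun_prop))
  have hGb : ∀ z : ℂ, 0 ≤ z.im → z.im ≤ 1 / 2 → ‖G z‖ ≤ C + Real.exp |a| * ‖c‖ :=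
    fun z h0 h1 => (norm_sub_le _ _).trans (add_le_add (hC z h0 h1) (hE z h0 h1))
  have hG0 : ∀ t : ℝ, G t = 0 := fun t => by simp [hG, h]
  have hzero : Set.EqOn G 0 {z : ℂ | 0 < z.im ∧ z.im < 1 / 2} := by
    rintro z ⟨hz0, hz1⟩
    -- the three lines theorem applies to `w ↦ G (i w)`, which vanishes on the line `re w = 0`
    have hmaps : Set.MapsTo (fun w : ℂ => Complex.I * w)
        (Complex.HadamardThreeLines.verticalStrip 0 (1 / 2)) {z : ℂ | 0 < z.im ∧ z.im < 1 / 2} := by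
      intro w hw
      simpa [Complex.HadamardThreeLines.verticalStrip] using hw
    have hd : DiffContOnCl ℂ (G ∘ fun w : ℂ => Complex.I * w)
        (Complex.HadamardThreeLines.verticalStrip 0 (1 / 2)) :=
      hGd.comp (Differentiable.diffContOnCl (by fun_prop)) hmaps
    have h3 := Complex.HadamardThreeLines.norm_le_interp_of_mem_verticalClosedStrip'
      (f := G ∘ fun w : ℂ => Complex.I * w) (z := -Complex.I * z) (a := 0)
      (b := C + Real.exp |a| * ‖c‖) (l := 0) (u := 1 / 2) (by norm_num) ?_ hd ?_ ?_ ?_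
    · have e : Complex.I * (-Complex.I * z) = z := by
        rw [← mul_assoc]; simp
      have hne : 1 - ((-Complex.I * z).re - 0) / (1 / 2 - 0) ≠ 0 := by
        have : (-Complex.I * z).re = z.im := by simp
        rw [this]
        intro h0
        norm_num at h0
        linarith
      rw [Real.zero_rpow hne, zero_mul] at h3
      rw [Function.comp_apply, e] at h3
      simpa using h3
    · simp only [Complex.HadamardThreeLines.verticalClosedStrip, Set.mem_preimage, Set.mem_Icc]
      have : (-Complex.I * z).re = z.im := by simp
      rw [this]
      exact ⟨hz0.le, hz1.le⟩
    · refine ⟨C + Real.exp |a| * ‖c‖, ?_⟩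
      rintro _ ⟨w, hw, rfl⟩
      simp only [Complex.HadamardThreeLines.verticalClosedStrip, Set.mem_preimage, Set.mem_Icc] at hw
      exact hGb _ (by simpa using hw.1) (by simpa using hw.2)
    · intro w hw
      have hw0 : w.re = 0 := hw
      have e : Complex.I * w = ((-w.im : ℝ) : ℂ) := by
        apply Complex.ext <;> simp [hw0]
      simp only [Function.comp_apply]
      rw [e, hG0]; simp
    · intro w hw
      have hw0 : w.re = 1 / 2 := hw
      exact hGb _ (by simp [hw0]) (by simp [hw0])
  have hcl : closure {z : ℂ | 0 < z.im ∧ z.im < 1 / 2} = Complex.im ⁻¹' Set.Icc 0 (1 / 2) := by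
    have := Complex.closure_preimage_im (Set.Ioo (0 : ℝ) (1 / 2))
    rwa [closure_Ioo (by norm_num)] at this
  have hI := hzero.of_subset_closure hGd.continuousOn continuousOn_const subset_closure le_rfl
    (show Complex.I / 2 ∈ _ by rw [hcl]; norm_num)
  have hI' : F (Complex.I / 2) = Complex.exp (Complex.I / 2 * Complex.I * a) * c :=
    sub_eq_zero.1 hI
  rw [hI']
  congr 2
  linear_combination (a / 2 : ℂ) * Complex.I_mul_I

section ModularTheory

variable {𝓗 : Type u} [NormedAddCommGroup 𝓗] [InnerProductSpace ℂ 𝓗] [FiniteDimensional ℂ 𝓗]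
  (H : StandardSubspace 𝓗)

/-! ### The modular operator on its eigenvectors -/

@[simp] theorem tomita_tomita (x : 𝓗) : tomita H (tomita H x) = x := by
  obtain ⟨h, hh, h', hh', rfl⟩ := exists_real_add_imag H x
  change tomitaReal H (tomitaReal H _) = _
  rw [tomitaReal_apply H hh hh', sub_eq_add_neg, ← smul_neg, tomitaReal_apply H hh (neg_mem hh')]
  simp

variable [CompleteSpace 𝓗]

theorem modularOp_apply (x : 𝓗) : modularOp H x = tomitaAdjoint H (tomita H x) := rfl

theorem inner_modularOp_left (x y : 𝓗) : ⟪modularOp H x, y⟫_ℂ = ⟪tomita H y, tomita H x⟫_ℂ := by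
  rw [modularOp_apply, inner_tomitaAdjoint_left]

theorem inner_modularOp_right (x y : 𝓗) : ⟪x, modularOp H y⟫_ℂ = ⟪tomita H y, tomita H x⟫_ℂ := by
  rw [← inner_conj_symm, inner_modularOp_left, inner_conj_symm]

theorem isSymmetric_modularOp : (modularOp H : 𝓗 →ₗ[ℂ] 𝓗).IsSymmetric := fun x y =>
  (inner_modularOp_left H x y).trans (inner_modularOp_right H x y).symm

theorem modularOp_injective : Function.Injective (modularOp H) := by
  rw [injective_iff_map_eq_zero]
  intro x hx
  have h : ⟪modularOp H x, x⟫_ℂ = 0 := by rw [hx, inner_zero_left]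
  rw [inner_modularOp_left, inner_self_eq_zero] at h
  rw [← tomita_tomita H x, h, map_zero]

/-- An eigenvector of `a` is an eigenvector of `f(a)`. In finite dimension `f` is a polynomial on
the spectrum. -/
theorem cfc_apply_of_eigenvector {a : 𝓗 →L[ℂ] 𝓗} (ha : IsStarNormal a) (f : ℂ → ℂ) {c : ℂ} {v : 𝓗}
    (hv : a v = c • v) : cfc f a v = f c • v := by
  rcases eq_or_ne v 0 with rfl | hv0
  · simp
  have hfin : (spectrum ℂ a).Finite := by
    rw [ContinuousLinearMap.spectrum_eq]
    exact Module.End.finite_spectrum _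
  have heig : Module.End.HasEigenvector (a : Module.End ℂ 𝓗) c v :=
    ⟨Module.End.mem_eigenspace_iff.2 hv, hv0⟩
  have hc : c ∈ spectrum ℂ a := by
    rw [ContinuousLinearMap.spectrum_eq]
    exact (Module.End.hasEigenvalue_of_hasEigenvector heig).mem_spectrum
  let p := Lagrange.interpolate hfin.toFinset id f
  have hp : Set.EqOn f (fun x => p.eval x) (spectrum ℂ a) := fun x hx =>
    (Lagrange.eval_interpolate_at_node (v := id) f Function.injective_id.injOn
      (hfin.mem_toFinset.2 hx)).symm
  rw [cfc_congr hp, cfc_polynomial p a, hp hc]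
  have e : a = Module.End.toContinuousLinearMap 𝓗 (a : 𝓗 →ₗ[ℂ] 𝓗) := rfl
  rw [e, Polynomial.aeval_algHom_apply]
  exact Module.End.aeval_apply_of_hasEigenvector heig

theorem modularPow_apply_of_eigenvector (s : ℂ) {c : ℂ} {v : 𝓗} (hv : modularOp H v = c • v) :
    modularPow H s v = c ^ s • v :=
  cfc_apply_of_eigenvector
    (ContinuousLinearMap.isSelfAdjoint_iff_isSymmetric.2 (isSymmetric_modularOp H)).isStarNormal _ hv

/-- The eigenvalues of the modular operator are positive. -/
theorem exists_orthonormalBasis_modularOp : ∃ (b : OrthonormalBasis (Fin (Module.finrank ℂ 𝓗)) ℂ 𝓗)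
    (c : Fin (Module.finrank ℂ 𝓗) → ℝ), (∀ i, 0 < c i) ∧
      ∀ i, modularOp H (b i) = ((c i : ℝ) : ℂ) • b i := by
  let b := (isSymmetric_modularOp H).eigenvectorBasis rfl
  let c := (isSymmetric_modularOp H).eigenvalues rfl
  have hb : ∀ i, modularOp H (b i) = ((c i : ℝ) : ℂ) • b i :=
    (isSymmetric_modularOp H).apply_eigenvectorBasis rfl
  refine ⟨b, c, fun i => ?_, hb⟩
  have h := inner_modularOp_right H (b i) (b i)
  rw [hb, inner_smul_right, inner_self_eq_norm_sq_to_K, inner_self_eq_norm_sq_to_K,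
    b.norm_eq_one] at h
  have h' : c i = ‖tomita H (b i)‖ ^ 2 := by
    have : ((c i : ℝ) : ℂ) = ((‖tomita H (b i)‖ ^ 2 : ℝ) : ℂ) := by simpa using h
    exact_mod_cast this
  rw [h']
  have hne : tomita H (b i) ≠ 0 := fun h0 => by
    have := b.orthonormal.ne_zero i
    rw [← tomita_tomita H (b i), h0, map_zero] at this
    exact this rfl
  positivity

variable {H} {T : 𝓗 ⊗[ℂ] 𝓗 →L[ℂ] 𝓗 ⊗[ℂ] 𝓗}

theorem modularUnitary_of_eigenvector (t : ℝ) {c : ℝ} (hc : 0 < c) {v : 𝓗}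
    (hv : modularOp H v = (c : ℂ) • v) :
    modularUnitary H t v = Complex.exp (t * Complex.I * Real.log c) • v := by
  rw [modularUnitary, modularPow_apply_of_eigenvector H _ hv,
    Complex.cpow_def_of_ne_zero (by exact_mod_cast hc.ne'), Complex.ofReal_log hc.le, mul_comm]

theorem modularConj_of_eigenvector {c : ℝ} (hc : 0 < c) {v : 𝓗}
    (hv : modularOp H v = (c : ℂ) • v) :
    modularConj H v = (Complex.exp (-(Real.log c / 2))) • tomita H v := by
  have h1 : modularPow H (-(1 / 2)) v = (Complex.exp (-(Real.log c / 2))) • v := by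
    rw [modularPow_apply_of_eigenvector H _ hv,
      Complex.cpow_def_of_ne_zero (by exact_mod_cast hc.ne'), ← Complex.ofReal_log hc.le]
    congr 2; ring
  have h2 : (starRingEnd ℂ) (Complex.exp (-(Real.log c / 2))) = Complex.exp (-(Real.log c / 2)) := by
    rw [← Complex.exp_conj, ← Complex.ofReal_ofNat, ← Complex.ofReal_div, ← Complex.ofReal_neg,
      Complex.conj_ofReal]
  change tomita H (modularPow H (-(1 / 2)) v) = _
  rw [h1, ContinuousLinearMap.map_smulₛₗ, h2]

theorem inner_smul_right_tmul {V W : Type*} [NormedAddCommGroup V] [InnerProductSpace ℂ V]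
    [NormedAddCommGroup W] [InnerProductSpace ℂ W] (c : ℂ) (u v : V ⊗[ℂ] W) :
    ⟪u, c • v⟫_ℂ = c * ⟪u, v⟫_ℂ :=
  inner_smul_right u v c

theorem inner_smul_left_tmul {V W : Type*} [NormedAddCommGroup V] [InnerProductSpace ℂ V]
    [NormedAddCommGroup W] [InnerProductSpace ℂ W] (c : ℂ) (u v : V ⊗[ℂ] W) :
    ⟪c • u, v⟫_ℂ = (starRingEnd ℂ) c * ⟪u, v⟫_ℂ :=
  inner_smul_left u v c

/-- Crossing symmetry, evaluated at the point `i/2`, on eigenvectors of the modular operator. -/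
theorem IsCrossingSymmetric.inner_of_eigenvector (hT : IsCrossingSymmetric H T)
    {b : OrthonormalBasis (Fin (Module.finrank ℂ 𝓗)) ℂ 𝓗} {c : Fin (Module.finrank ℂ 𝓗) → ℝ}
    (hc : ∀ i, 0 < c i) (hb : ∀ i, modularOp H (b i) = ((c i : ℝ) : ℂ) • b i)
    (i j : Fin (Module.finrank ℂ 𝓗)) (ψ₁ ψ₃ : 𝓗) :
    ⟪b i ⊗ₜ[ℂ] ψ₁, T (ψ₃ ⊗ₜ[ℂ] modularOp H (b j))⟫_ℂ =
      ⟪ψ₁ ⊗ₜ[ℂ] tomita H (b j), T (tomita H (b i) ⊗ₜ[ℂ] ψ₃)⟫_ℂ := by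
  obtain ⟨F, hF, hFb, hF0, hF1⟩ := hT ψ₁ (b i) ψ₃ (b j)
  have hU : ∀ (t : ℝ) (x : 𝓗), ⟪b i, modularUnitary H t x⟫_ℂ =
      Complex.exp (t * Complex.I * Real.log (c i)) * ⟪b i, x⟫_ℂ := fun t x => by
    conv_lhs => rw [← b.sum_repr' x]
    simp only [map_sum, map_smul, modularUnitary_of_eigenvector _ (hc _) (hb _), inner_sum,
      inner_smul_right, b.inner_eq_ite]
    simp [mul_comm]
  have hU' : ∀ (t : ℝ) (u : 𝓗 ⊗[ℂ] 𝓗), ⟪b i ⊗ₜ[ℂ] ψ₁, (modularUnitary H t).rTensor 𝓗 u⟫_ℂ =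
      Complex.exp (t * Complex.I * Real.log (c i)) * ⟪b i ⊗ₜ[ℂ] ψ₁, u⟫_ℂ := fun t u => by
    induction u using TensorProduct.induction_on with
    | zero => simp
    | tmul x y =>
      rw [ContinuousLinearMap.rTensor_tmul, TensorProduct.inner_tmul, TensorProduct.inner_tmul, hU,
        mul_assoc]
    | add x y hx hy => rw [map_add, inner_add_right, inner_add_right, hx, hy, mul_add]
  have hreal : ∀ t : ℝ, F t = Complex.exp (t * Complex.I * (Real.log (c i) - Real.log (c j) : ℝ)) *
      ⟪b i ⊗ₜ[ℂ] ψ₁, T (ψ₃ ⊗ₜ[ℂ] b j)⟫_ℂ := fun t => by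
    rw [hF0, hU', ContinuousLinearMap.lTensor_tmul,
      modularUnitary_of_eigenvector _ (hc _) (hb _), TensorProduct.tmul_smul, map_smul,
      inner_smul_right_tmul, ← mul_assoc, ← Complex.exp_add]
    congr 2
    push_cast; ring
  have hone : modularUnitary H 0 = 1 := by
    refine ContinuousLinearMap.coe_inj.1 (b.toBasis.ext fun k => ?_)
    simpa using modularUnitary_of_eigenvector 0 (hc k) (hb k)
  have h1 := eqOn_strip_of_eq_on_real hF hFb _ _ hreal
  have h2 := hF1 0
  rw [Complex.ofReal_zero, zero_add, neg_zero, hone, h1, modularConj_of_eigenvector (hc _) (hb _),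
    modularConj_of_eigenvector (hc _) (hb _)] at h2
  simp only [ContinuousLinearMap.lTensor_one, ContinuousLinearMap.rTensor_one,
    TensorProduct.tmul_smul, ← TensorProduct.smul_tmul',
    map_smul, inner_smul_left_tmul, inner_smul_right_tmul] at h2
  have hconj : (starRingEnd ℂ) (Complex.exp (-(Real.log (c j) / 2))) =
      Complex.exp (-(Real.log (c j) / 2)) := by
    rw [← Complex.exp_conj, ← Complex.ofReal_ofNat, ← Complex.ofReal_div, ← Complex.ofReal_neg,
      Complex.conj_ofReal]
  have hcj : (c j : ℂ) = Complex.exp (Real.log (c j)) := by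
    rw [← Complex.ofReal_exp, Real.exp_log (hc j)]
  rw [hconj] at h2
  rw [hb, TensorProduct.tmul_smul, map_smul, inner_smul_right_tmul, hcj]
  have e1 : Complex.exp (-((Real.log (c i) - Real.log (c j) : ℝ) / 2)) =
      Complex.exp (-(Real.log (c j) / 2)) * Complex.exp (-(Real.log (c i) / 2)) *
        Complex.exp (Real.log (c j)) := by
    rw [← Complex.exp_add, ← Complex.exp_add]
    congr 1
    push_cast; ring
  rw [e1] at h2
  have hne : Complex.exp (-(Real.log (c j) / 2)) * Complex.exp (-(Real.log (c i) / 2)) ≠ 0 :=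
    mul_ne_zero (Complex.exp_ne_zero _) (Complex.exp_ne_zero _)
  apply mul_left_cancel₀ hne
  refine Eq.trans (by ring) (h2.trans ?_)
  change _ * (_ * ⟪ψ₁ ⊗ₜ[ℂ] tomita H (b j), T (tomita H (b i) ⊗ₜ[ℂ] ψ₃)⟫_ℂ) = _
  ring

theorem IsCrossingSymmetric.inner_eq (hT : IsCrossingSymmetric H T) (ψ₁ ψ₂ ψ₃ ψ₄ : 𝓗) :
    ⟪ψ₂ ⊗ₜ[ℂ] ψ₁, T (ψ₃ ⊗ₜ[ℂ] modularOp H ψ₄)⟫_ℂ =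
      ⟪ψ₁ ⊗ₜ[ℂ] tomita H ψ₄, T (tomita H ψ₂ ⊗ₜ[ℂ] ψ₃)⟫_ℂ := by
  obtain ⟨b, c, hc, hb⟩ := exists_orthonormalBasis_modularOp H
  rw [← b.sum_repr' ψ₂, ← b.sum_repr' ψ₄]
  simp only [map_sum, TensorProduct.sum_tmul, TensorProduct.tmul_sum, sum_inner, inner_sum]
  rw [Finset.sum_comm]
  refine Finset.sum_congr rfl fun j _ => Finset.sum_congr rfl fun i _ => ?_
  simp only [ContinuousLinearMap.map_smulₛₗ, TensorProduct.tmul_smul, ← TensorProduct.smul_tmul',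
    map_smul, inner_smul_left_tmul, inner_smul_right_tmul, hT.inner_of_eigenvector hc hb,
    starRingEnd_self_apply]
  ring

/-- Crossing symmetry in its algebraic form. -/
theorem IsCrossingSymmetric.contractsThrough (hT : IsCrossingSymmetric H T) :
    ContractsThrough H T := by
  refine tpow_ext₃ fun ξ η ζ v => ?_
  obtain ⟨ψ, rfl⟩ : ∃ ψ, modularOp H ψ = ζ :=
    (LinearMap.injective_iff_surjective (f := (modularOp H : 𝓗 →ₗ[ℂ] 𝓗))).1
      (modularOp_injective H) ζ
  -- the partial contractions `x ⊗ y ↦ ⟪S ξ, x⟫ y` and `x ⊗ y ↦ ⟪S ψ, y⟫ x`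
  let A : 𝓗 ⊗[ℂ] 𝓗 →ₗ[ℂ] 𝓗 := TensorProduct.lid ℂ 𝓗 ∘ₗ
    (innerSL ℂ (tomita H ξ)).toLinearMap.rTensor 𝓗
  let B : 𝓗 ⊗[ℂ] 𝓗 →ₗ[ℂ] 𝓗 := TensorProduct.rid ℂ 𝓗 ∘ₗ
    (innerSL ℂ (tomita H ψ)).toLinearMap.lTensor 𝓗
  have hA : ∀ u, contractAt H 0 1 (tcons ξ _ (tpair u v)) = tcons (A u) 0 v := fun u => by
    induction u using TensorProduct.induction_on with
    | zero => simp [tpair_zero, tcons_zero_left]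
    | tmul x y =>
      rw [tpair_tmul, contractAt_zero_tcons]
      simp [A, tcons_smul_left]
    | add x y hx hy => rw [tpair_add, map_add, map_add, hx, hy, map_add, tcons_add_left]
  have hB : ∀ u, contractAt H 1 1 (tpair u (tcons (modularOp H ψ) _ v)) = tcons (B u) 0 v :=
    fun u => by
    induction u using TensorProduct.induction_on with
    | zero => simp [tpair_zero, tcons_zero_left]
    | tmul x y =>
      rw [tpair_tmul]
      change tcons x 0 (contractAt H 0 0 _) = _
      rw [contractAt_zero_tcons, inner_modularOp_right, tomita_tomita]
      simp [B, tcons_smul_left]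
    | add x y hx hy => rw [tpair_add, map_add, hx, hy, map_add, tcons_add_left]
  have hAB : A (T (η ⊗ₜ[ℂ] modularOp H ψ)) = B (T (ξ ⊗ₜ[ℂ] η)) := by
    refine ext_inner_left ℂ fun φ => ?_
    have hA' : ∀ u, ⟪φ, A u⟫_ℂ = ⟪tomita H ξ ⊗ₜ[ℂ] φ, u⟫_ℂ := fun u => by
      induction u using TensorProduct.induction_on with
      | zero => simp
      | tmul x y => simp [A]
      | add x y hx hy => rw [map_add, inner_add_right, inner_add_right, hx, hy]
    have hB' : ∀ u, ⟪φ, B u⟫_ℂ = ⟪φ ⊗ₜ[ℂ] tomita H ψ, u⟫_ℂ := fun u => by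
      induction u using TensorProduct.induction_on with
      | zero => simp
      | tmul x y => simp [B, mul_comm]
      | add x y hx hy => rw [map_add, inner_add_right, inner_add_right, hx, hy]
    rw [hA', hB', hT.inner_eq, tomita_tomita]
  change contractAt H 0 1 (tcons ξ _ (twistAt T 0 2 (tcons η _ (tcons _ 0 v)))) =
    contractAt H 1 1 (twistAt T 0 3 (tpair (ξ ⊗ₜ[ℂ] η) (tcons _ 0 v)))
  rw [← tpair_tmul, twistAt_zero_tpair, twistAt_zero_tpair, hA, hB, hAB]

end ModularTheory

section Norms

variable {𝓗 : Type u} [NormedAddCommGroup 𝓗] [InnerProductSpace ℂ 𝓗] [FiniteDimensional ℂ 𝓗]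
  {H : StandardSubspace 𝓗} {T : 𝓗 ⊗[ℂ] 𝓗 →L[ℂ] 𝓗 ⊗[ℂ] 𝓗}

/-! ### Norm estimates -/

theorem norm_idTensor_le {n m : ℕ} (A : TPow 𝓗 n →L[ℂ] TPow 𝓗 m) : ‖idTensor A‖ ≤ ‖A‖ := by
  refine ContinuousLinearMap.opNorm_le_bound _ (norm_nonneg _) fun x => ?_
  exact ((A.lTensor 𝓗).le_opNorm x).trans
    (mul_le_mul_of_nonneg_right (ContinuousLinearMap.norm_lTensor_le 𝓗 A) (norm_nonneg _))

theorem norm_twistAt_le (k n : ℕ) : ‖twistAt T k n‖ ≤ ‖T‖ := by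
  induction k generalizing n with
  | zero =>
    match n with
    | 0 => rw [twistAt_of_lt T (by omega), norm_zero]; exact T.opNorm_nonneg
    | 1 => rw [twistAt_of_lt T (by omega), norm_zero]; exact T.opNorm_nonneg
    | n + 2 =>
      refine ContinuousLinearMap.opNorm_le_bound _ T.opNorm_nonneg fun x => ?_
      have h : ‖twistAt T 0 (n + 2) x‖ = ‖T.rTensor (TPow 𝓗 n) (tpowSuccSucc 𝓗 n x)‖ :=
        (tpowSuccSucc 𝓗 n).symm.norm_map _
      rw [h, ← (tpowSuccSucc 𝓗 n).norm_map x]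
      exact ((T.rTensor (TPow 𝓗 n)).le_opNorm _).trans
        (mul_le_mul_of_nonneg_right (ContinuousLinearMap.norm_rTensor_le _ T) (norm_nonneg _))
  | succ k ih =>
    match n with
    | 0 => rw [twistAt_of_lt T (by omega), norm_zero]; exact T.opNorm_nonneg
    | n + 1 => exact (norm_idTensor_le _).trans (ih n)

theorem norm_twistProd_le {a b : ℕ} (h : a ≤ b) (n : ℕ) :
    ‖twistProd T a b n‖ ≤ ‖T‖ ^ (b - a) := by
  induction b, h using Nat.le_induction with
  | base =>
    rw [twistProd_self, Nat.sub_self, pow_zero]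
    exact ContinuousLinearMap.norm_id_le
  | succ b h ih =>
    rw [twistProd_succ T h, Nat.succ_sub h, pow_succ]
    exact (norm_mul_le _ _).trans (mul_le_mul ih (norm_twistAt_le _ _) (norm_nonneg _) (by positivity))

theorem norm_opRPart_le (hq : ‖T‖ < 1) (p n : ℕ) : ‖opRPart T p n‖ ≤ (1 - ‖T‖)⁻¹ := by
  refine (norm_sum_le _ _).trans ?_
  have h1 : ∀ k ∈ Finset.range p, ‖twistProd T 0 k n‖ ≤ ‖T‖ ^ k := fun k _ =>
    norm_twistProd_le (Nat.zero_le k) n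
  refine (Finset.sum_le_sum h1).trans ?_
  rw [← tsum_geometric_of_lt_one (T.opNorm_nonneg) hq]
  exact (summable_geometric_of_lt_one (T.opNorm_nonneg) hq).sum_le_tsum _ fun _ _ => by positivity

/-- The contraction is the inner product with the vector `∑ b_i ⊗ S b_i`, for any orthonormal basis
`b_i`, whence its norm is the Hilbert-Schmidt norm of `S`. -/
theorem norm_contraction_le :
    ‖contraction H‖ ≤ Real.sqrt (Module.finrank ℂ 𝓗) * ‖tomita H‖ := by
  let b := stdOrthonormalBasis ℂ 𝓗
  let w : 𝓗 ⊗[ℂ] 𝓗 := ∑ i, b i ⊗ₜ[ℂ] tomita H (b i)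
  have hw : ∀ u, contraction H u = ⟪w, u⟫_ℂ := fun u => by
    induction u using TensorProduct.induction_on with
    | zero => simp
    | tmul x y =>
      change ⟪tomita H x, y⟫_ℂ = _
      conv_lhs => rw [← b.sum_repr' x]
      simp only [w, sum_inner, TensorProduct.inner_tmul, map_sum,
        ContinuousLinearMap.map_smulₛₗ, inner_smul_left, starRingEnd_self_apply]
    | add x y hx hy => rw [map_add, inner_add_right, hx, hy]
  have hw2 : ‖w‖ ^ 2 = ∑ i, ‖tomita H (b i)‖ ^ 2 := by
    have : ((‖w‖ ^ 2 : ℝ) : ℂ) = ((∑ i, ‖tomita H (b i)‖ ^ 2 : ℝ) : ℂ) := by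
      push_cast
      have h := inner_self_eq_norm_sq_to_K (𝕜 := ℂ) w
      refine h.symm.trans ?_
      simp only [w, sum_inner, inner_sum, TensorProduct.inner_tmul, b.inner_eq_ite]
      simp [inner_self_eq_norm_sq_to_K]
    exact_mod_cast this
  have hw3 : ‖w‖ ≤ Real.sqrt (Module.finrank ℂ 𝓗) * ‖tomita H‖ := by
    refine abs_le_of_sq_le_sq' ?_ (by positivity) |>.2
    rw [hw2, mul_pow, Real.sq_sqrt (by positivity)]
    calc ∑ i, ‖tomita H (b i)‖ ^ 2 ≤ ∑ _i : Fin (Module.finrank ℂ 𝓗), ‖tomita H‖ ^ 2 := by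
          refine Finset.sum_le_sum fun i _ => ?_
          have := (tomita H).le_opNorm (b i)
          rw [b.norm_eq_one, mul_one] at this
          gcongr
      _ = _ := by simp
  refine ContinuousLinearMap.opNorm_le_bound _ (by positivity) fun u => ?_
  rw [hw]
  exact (norm_inner_le_norm w u).trans (mul_le_mul_of_nonneg_right hw3 (norm_nonneg _))

theorem norm_contractAt_zero_le (n : ℕ) :
    ‖contractAt H 0 n‖ ≤ Real.sqrt (Module.finrank ℂ 𝓗) * ‖tomita H‖ := by
  refine le_trans ?_ norm_contraction_le
  refine ContinuousLinearMap.opNorm_le_bound _ (contraction H).opNorm_nonneg fun x => ?_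
  have h : ‖contractAt H 0 n x‖ = ‖(contraction H).rTensor (TPow 𝓗 n) (tpowSuccSucc 𝓗 n x)‖ :=
    (TensorProduct.lidIsometry ℂ (TPow 𝓗 n)).norm_map _
  rw [h, ← (tpowSuccSucc 𝓗 n).norm_map x]
  exact (((contraction H).rTensor (TPow 𝓗 n)).le_opNorm _).trans
    (mul_le_mul_of_nonneg_right (ContinuousLinearMap.norm_rTensor_le _ _) (norm_nonneg _))

theorem norm_contractAt_comp_twistProd_le (hq : ‖T‖ ≤ 1) {a j : ℕ} (h : a < j) (n : ℕ) :
    ‖contractAt H 0 n ∘L twistProd T 1 j (n + 2)‖ ≤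
      Real.sqrt (Module.finrank ℂ 𝓗) * ‖tomita H‖ * ‖T‖ ^ a := by
  refine (ContinuousLinearMap.opNorm_comp_le _ _).trans
    (mul_le_mul (norm_contractAt_zero_le n) ?_ (norm_nonneg _) (by positivity))
  exact (norm_twistProd_le (by omega) _).trans
    (pow_le_pow_of_le_one (T.opNorm_nonneg) hq (by omega))

/-! ### The inverses of the operators `R` and `P` -/

theorem IsBraided.opRPart_mul (hT : IsBraided T) (p n : ℕ) :
    opRPart T (p + 1) n * (1 - twistProd T 0 p n) =
      (1 - twistAt T 0 n * twistProd T 0 p n) * opRPart T p n := by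
  have h1 : opRPart T (p + 1) n * twistProd T 0 p n =
      twistProd T 0 p n + twistAt T 0 n * twistProd T 0 p n * opRPart T p n := by
    rw [opRPart, Finset.sum_range_succ', add_mul, twistProd_self, one_mul, add_comm, Finset.sum_mul,
      opRPart, Finset.mul_sum]
    congr 1
    refine Finset.sum_congr rfl fun k hk => ?_
    rw [Finset.mem_range] at hk
    rw [twistProd_eq_mul T (by omega : 0 < k + 1), mul_assoc, mul_assoc,
      hT.twistProd_mul_twistProd le_rfl hk]
  have h2 : opRPart T (p + 1) n = opRPart T p n + twistProd T 0 p n := Finset.sum_range_succ _ _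
  rw [mul_sub, h1, mul_one, h2, sub_mul, one_mul]
  abel

theorem exists_one_sub_mul_eq_one {V : Type*} [NormedAddCommGroup V] [NormedSpace ℂ V]
    [CompleteSpace V] {A : V →L[ℂ] V} {r : ℝ} (hA : ‖A‖ ≤ r) (hr : r < 1) :
    ∃ B : V →L[ℂ] V, (1 - A) * B = 1 ∧ ‖B‖ ≤ (1 - r)⁻¹ := by
  have hA1 : ‖A‖ < 1 := hA.trans_lt hr
  refine ⟨∑' k : ℕ, A ^ k, mul_neg_geom_series A hA1, ?_⟩
  refine (tsum_geometric_le_of_norm_lt_one A hA1).trans ?_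
  have h1 : ‖(1 : V →L[ℂ] V)‖ ≤ 1 := ContinuousLinearMap.norm_id_le
  have h2 : (1 - ‖A‖)⁻¹ ≤ (1 - r)⁻¹ := by
    apply inv_anti₀ <;> linarith
  linarith

/-- The Bożejko-Speicher estimate for the inverse of `R_{T,p}`. The factors `1 ± T_1 ⋯ T_k` of the
inverse are so close to `1` that the bound does not depend on `p`. -/
theorem IsBraided.exists_opRPart_mul_eq_one (hT : IsBraided T) (hq : ‖T‖ < 1) {p : ℕ} (hp : 1 ≤ p)
    (n : ℕ) : ∃ B : TPow 𝓗 n →L[ℂ] TPow 𝓗 n, opRPart T p n * B = 1 ∧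
      ‖B‖ ≤ Real.exp ((1 + (1 - ‖T‖)⁻¹) * ∑ k ∈ Finset.range p, ‖T‖ ^ k) := by
  have hq0 := T.opNorm_nonneg
  have h1q : 0 < 1 - ‖T‖ := by linarith
  induction p, hp using Nat.le_induction with
  | base =>
    refine ⟨1, by rw [opRPart, Finset.sum_range_one, twistProd_self, one_mul],
      ContinuousLinearMap.norm_id_le.trans (Real.one_le_exp (by positivity))⟩
  | succ p hp ih =>
    obtain ⟨B, hB, hBn⟩ := ih
    have hc : ‖twistProd T 0 p n‖ ≤ ‖T‖ ^ p := norm_twistProd_le (Nat.zero_le p) n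
    have hd : ‖twistAt T 0 n * twistProd T 0 p n‖ ≤ ‖T‖ ^ (p + 1) := by
      rw [pow_succ']
      exact (norm_mul_le _ _).trans (mul_le_mul (norm_twistAt_le _ _) hc (norm_nonneg _) hq0)
    have hlt : ‖T‖ ^ (p + 1) < 1 := pow_lt_one₀ hq0 hq (by omega)
    obtain ⟨D, hD, hDn⟩ := exists_one_sub_mul_eq_one hd hlt
    refine ⟨(1 - twistProd T 0 p n) * B * D, ?_, ?_⟩
    · rw [← mul_assoc, ← mul_assoc, hT.opRPart_mul, mul_assoc _ _ B, hB, mul_one, hD]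
    · have h1 : ‖1 - twistProd T 0 p n‖ ≤ Real.exp (‖T‖ ^ p) := by
        refine (norm_sub_le _ _).trans ?_
        have := Real.add_one_le_exp (‖T‖ ^ p)
        have h1 : ‖(1 : TPow 𝓗 n →L[ℂ] TPow 𝓗 n)‖ ≤ 1 := ContinuousLinearMap.norm_id_le
        linarith
      have h2 : (1 - ‖T‖ ^ (p + 1))⁻¹ ≤ Real.exp ((1 - ‖T‖)⁻¹ * ‖T‖ ^ p) := by
        refine le_trans ?_ (Real.add_one_le_exp _)
        have hle : ‖T‖ ^ (p + 1) ≤ ‖T‖ := by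
          simpa using pow_le_pow_of_le_one hq0 hq.le (show 1 ≤ p + 1 by omega)
        have hle' : ‖T‖ ^ (p + 1) ≤ ‖T‖ ^ p := pow_le_pow_of_le_one hq0 hq.le (by omega)
        have hpos : 0 < 1 - ‖T‖ ^ (p + 1) := by linarith
        have e : (1 - ‖T‖ ^ (p + 1))⁻¹ = (1 - ‖T‖ ^ (p + 1))⁻¹ * ‖T‖ ^ (p + 1) + 1 := by
          field_simp; ring
        rw [e]
        gcongr
      calc ‖(1 - twistProd T 0 p n) * B * D‖
          ≤ ‖1 - twistProd T 0 p n‖ * ‖B‖ * ‖D‖ :=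
            (norm_mul_le _ _).trans (mul_le_mul_of_nonneg_right (norm_mul_le _ _) (norm_nonneg _))
        _ ≤ Real.exp (‖T‖ ^ p) *
            Real.exp ((1 + (1 - ‖T‖)⁻¹) * ∑ k ∈ Finset.range p, ‖T‖ ^ k) *
            Real.exp ((1 - ‖T‖)⁻¹ * ‖T‖ ^ p) := by
            gcongr
            exact hDn.trans h2
        _ = _ := by
            rw [← Real.exp_add, ← Real.exp_add, Finset.sum_range_succ]
            congr 1; ring

/-- The constant in the estimate `‖P_{T,n}^{-1}‖ ≤ Kⁿ`. -/
def invBound (T : 𝓗 ⊗[ℂ] 𝓗 →L[ℂ] 𝓗 ⊗[ℂ] 𝓗) : ℝ :=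
  Real.exp ((1 + (1 - ‖T‖)⁻¹) * (1 - ‖T‖)⁻¹)

theorem one_le_invBound {𝓗 : Type u} [NormedAddCommGroup 𝓗] [InnerProductSpace ℂ 𝓗]
    {T : 𝓗 ⊗[ℂ] 𝓗 →L[ℂ] 𝓗 ⊗[ℂ] 𝓗} (hq : ‖T‖ < 1) : 1 ≤ invBound T := by
  have : 0 < 1 - ‖T‖ := by linarith
  exact Real.one_le_exp (by positivity)

theorem opP_succ (n : ℕ) : opP T (n + 1) = idTensor (opP T n) * opR T (n + 1) := rfl

theorem opRPart_self (n : ℕ) : opRPart T n n = opR T n := rfl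

theorem IsBraided.exists_opP_mul_eq_one (hT : IsBraided T) (hq : ‖T‖ < 1) (n : ℕ) :
    ∃ B : TPow 𝓗 n →L[ℂ] TPow 𝓗 n, opP T n * B = 1 ∧ ‖B‖ ≤ invBound T ^ n := by
  have hq0 := T.opNorm_nonneg
  have h1q : 0 < 1 - ‖T‖ := by linarith
  induction n with
  | zero => exact ⟨1, mul_one _, by rw [pow_zero]; exact ContinuousLinearMap.norm_id_le⟩
  | succ n ih =>
    obtain ⟨B, hB, hBn⟩ := ih
    obtain ⟨D, hD, hDn⟩ := hT.exists_opRPart_mul_eq_one hq (show 1 ≤ n + 1 by omega) (n + 1)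
    refine ⟨D * idTensor B, ?_, ?_⟩
    · rw [opP_succ, mul_assoc, ← mul_assoc (opR T (n + 1)), ← opRPart_self, hD, one_mul,
        ← idTensor_mul, hB, idTensor_one]
    · rw [pow_succ']
      refine (norm_mul_le _ _).trans (mul_le_mul (hDn.trans (Real.exp_le_exp.2 ?_))
        ((norm_idTensor_le B).trans hBn) (norm_nonneg _) (Real.exp_pos _).le)
      refine mul_le_mul_of_nonneg_left ?_ (by positivity)
      rw [← tsum_geometric_of_lt_one (T.opNorm_nonneg) hq]
      exact (summable_geometric_of_lt_one (T.opNorm_nonneg) hq).sum_le_tsum _ fun _ _ => by positivity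

theorem IsStrictlyPos.injective {V : Type*} [NormedAddCommGroup V] [InnerProductSpace ℂ V]
    {A : V →L[ℂ] V} (hA : IsStrictlyPos A) : Function.Injective A := by
  rw [injective_iff_map_eq_zero]
  intro v hv
  by_contra hne
  have := hA.2 v hne
  rw [hv, inner_zero_left] at this
  exact lt_irrefl _ this

theorem IsStrictlyPos.mul_eq_one_comm {V : Type*} [NormedAddCommGroup V] [InnerProductSpace ℂ V]
    {A B : V →L[ℂ] V} (hA : IsStrictlyPos A) (h : A * B = 1) : B * A = 1 := by
  ext v
  apply hA.injective
  exact DFunLike.congr_fun h (A v)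

theorem IsStrictTwist.isUnit_opP (hT : IsStrictTwist T) (hB : IsBraided T) (hq : ‖T‖ < 1) (n : ℕ) :
    IsUnit (opP T n) := by
  obtain ⟨B, h, _⟩ := hB.exists_opP_mul_eq_one hq n
  exact ⟨⟨_, B, h, (hT.strictlyPos n).mul_eq_one_comm h⟩, rfl⟩

theorem IsStrictTwist.norm_inverse_opP_le (hT : IsStrictTwist T) (hB : IsBraided T) (hq : ‖T‖ < 1)
    (n : ℕ) : ‖Ring.inverse (opP T n)‖ ≤ invBound T ^ n := by
  obtain ⟨B, h, hn⟩ := hB.exists_opP_mul_eq_one hq n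
  have : Ring.inverse (opP T n) = B :=
    Ring.inverse_unit ⟨_, B, h, (hT.strictlyPos n).mul_eq_one_comm h⟩
  rwa [this]

/-! ### The norm of the contractions across the middle factor -/

/-- The bound `n! Cⁿ ‖T‖^{n(n+1)/2}`, in recursive form. -/
def crossBound (q C : ℝ) : ℕ → ℝ
  | 0 => 1
  | n + 1 => crossBound q C n * ((n + 1) * (C * q ^ (n + 1)))

theorem crossBound_nonneg {q C : ℝ} (hq : 0 ≤ q) (hC : 0 ≤ C) (n : ℕ) : 0 ≤ crossBound q C n := by
  induction n with
  | zero => exact zero_le_one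
  | succ n ih => rw [crossBound]; positivity

theorem norm_crossContract_le (hq : ‖T‖ ≤ 1) (n : ℕ) : ‖crossContract H T n 0 (2 * n + 1)‖ ≤
    crossBound ‖T‖ (Real.sqrt (Module.finrank ℂ 𝓗) * ‖tomita H‖) n := by
  induction n with
  | zero => exact ContinuousLinearMap.norm_id_le
  | succ n ih =>
    have e : crossContract H T (n + 1) 0 (2 * (n + 1) + 1) =
        crossContract H T n 0 (2 * n + 1) ∘L contractRange H T (n + 2) (2 * n + 3) (2 * n + 1) :=
      crossContract_succ_zero n (2 * n + 1)
    have hD : 0 ≤ Real.sqrt (Module.finrank ℂ 𝓗) * ‖tomita H‖ := by positivity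
    rw [e, crossBound]
    refine (ContinuousLinearMap.opNorm_comp_le _ _).trans (mul_le_mul ih ?_ (norm_nonneg _)
      (crossBound_nonneg T.opNorm_nonneg hD n))
    refine (norm_sum_le _ _).trans ((Finset.sum_le_card_nsmul _ _
      (Real.sqrt (Module.finrank ℂ 𝓗) * ‖tomita H‖ * ‖T‖ ^ (n + 1)) fun j hj => ?_).trans ?_)
    · rw [Finset.mem_Ico] at hj
      exact norm_contractAt_comp_twistProd_le hq (by omega) _
    · rw [Nat.card_Ico, nsmul_eq_mul, show 2 * n + 3 - (n + 2) = n + 1 by omega]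
      push_cast
      exact le_rfl

theorem summable_crossBound {q C K : ℝ} (hq0 : 0 ≤ q) (hq : q < 1) (hC : 0 ≤ C) (hK : 0 ≤ K) :
    Summable fun n : ℕ => K ^ (2 * n + 1) * crossBound q C n := by
  have hlim : Filter.Tendsto (fun n : ℕ => K ^ 2 * C * (((n + 1 : ℕ) : ℝ) * q ^ (n + 1)))
      Filter.atTop (nhds 0) := by
    have h := (tendsto_self_mul_const_pow_of_lt_one hq0 hq).comp (Filter.tendsto_add_atTop_nat 1)
    simpa using h.const_mul (K ^ 2 * C)
  refine summable_of_ratio_norm_eventually_le (r := 1 / 2) (by norm_num) ?_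
  filter_upwards [hlim.eventually_le_const (show (0 : ℝ) < 1 / 2 by norm_num)] with n hn
  have h0 := crossBound_nonneg hq0 hC n
  rw [Real.norm_of_nonneg (mul_nonneg (by positivity) (crossBound_nonneg hq0 hC _)),
    Real.norm_of_nonneg (by positivity), crossBound]
  calc K ^ (2 * (n + 1) + 1) * (crossBound q C n * ((n + 1) * (C * q ^ (n + 1))))
      = (K ^ 2 * C * (((n + 1 : ℕ) : ℝ) * q ^ (n + 1))) * (K ^ (2 * n + 1) * crossBound q C n) := by
        push_cast; ring
    _ ≤ 1 / 2 * (K ^ (2 * n + 1) * crossBound q C n) := by gcongr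

end Norms

/-! ### Incomplete matchings as lists of pairs -/

section MatchLists

/-- The lists `(k, j_0), (k + 1, j_1), …, (k + N - 1, j_{N-1})` in which `j_0, …, j_{N-1}` is an
enumeration of `R` (if `R` has `N` elements). -/
def matchLists : ℕ → ℕ → Finset ℕ → Finset (List (ℕ × ℕ))
  | 0, _, _ => {[]}
  | N + 1, k, R => R.biUnion fun j => (matchLists N (k + 1) (R.erase j)).image ((k, j) :: ·)

theorem mem_matchLists_succ {N k : ℕ} {R : Finset ℕ} {L : List (ℕ × ℕ)} :
    L ∈ matchLists (N + 1) k R ↔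
      ∃ j ∈ R, ∃ L' ∈ matchLists N (k + 1) (R.erase j), (k, j) :: L' = L := by
  simp [matchLists]

theorem sum_matchLists_succ {M : Type*} [AddCommMonoid M] (N k : ℕ) (R : Finset ℕ)
    (F : List (ℕ × ℕ) → M) : ∑ L ∈ matchLists (N + 1) k R, F L =
      ∑ j ∈ R, ∑ L ∈ matchLists N (k + 1) (R.erase j), F ((k, j) :: L) := by
  rw [matchLists, Finset.sum_biUnion]
  · refine Finset.sum_congr rfl fun j _ => Finset.sum_image fun L _ L' _ h => ?_
    exact (List.cons.inj h).2
  · intro j _ j' _ hne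
    refine Finset.disjoint_left.2 fun L h h' => hne ?_
    obtain ⟨L₁, _, rfl⟩ := Finset.mem_image.1 h
    obtain ⟨L₂, _, h₂⟩ := Finset.mem_image.1 h'
    exact (congrArg Prod.snd (List.cons.inj h₂).1).symm

theorem mem_matchLists {N k : ℕ} {R : Finset ℕ} {L : List (ℕ × ℕ)} (hR : R.card = N) :
    L ∈ matchLists N k R ↔
      L.map Prod.fst = List.range' k N ∧ (L.map Prod.snd).Nodup ∧
        ∀ j, j ∈ L.map Prod.snd ↔ j ∈ R := by
  induction N generalizing k R L with
  | zero =>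
    rw [Finset.card_eq_zero] at hR
    subst hR
    rw [matchLists, Finset.mem_singleton]
    constructor
    · rintro rfl
      simp
    · rintro ⟨h, _⟩
      simpa using h
  | succ N ih =>
    rw [mem_matchLists_succ]
    constructor
    · rintro ⟨j, hj, L', hL', rfl⟩
      rw [ih (by rw [Finset.card_erase_of_mem hj, hR]; rfl)] at hL'
      obtain ⟨h1, h2, h3⟩ := hL'
      refine ⟨by rw [List.map_cons, h1, List.range'_succ], ?_, fun x => ?_⟩
      · rw [List.map_cons, List.nodup_cons]
        exact ⟨fun h => by simpa using (h3 _).1 h, h2⟩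
      · rw [List.map_cons, List.mem_cons, h3, Finset.mem_erase]
        by_cases hx : x = j
        · simp [hx, hj]
        · simp [hx]
    · rintro ⟨h1, h2, h3⟩
      match L with
      | [] => simp at h1
      | (a, j) :: L' =>
        rw [List.map_cons, List.range'_succ, List.cons.injEq] at h1
        rw [List.map_cons, List.nodup_cons] at h2
        obtain ⟨h0, h1⟩ := h1
        simp only at h0 h2
        subst h0
        have hj : j ∈ R := (h3 j).1 (by simp)
        refine ⟨j, hj, L', ?_, rfl⟩
        rw [ih (by rw [Finset.card_erase_of_mem hj, hR]; rfl)]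
        refine ⟨h1, h2.2, fun x => ?_⟩
        rw [Finset.mem_erase, ← h3, List.map_cons, List.mem_cons]
        constructor
        · intro hx
          exact ⟨fun e => h2.1 (e ▸ hx), Or.inr hx⟩
        · rintro ⟨hne, rfl | hx⟩
          · exact absurd rfl hne
          · exact hx

/-- The position `#{r ∈ R | r < j}` of `j ∈ R` runs exactly once through `0, …, |R| - 1`. -/
theorem sum_card_filter_lt {M : Type*} [AddCommMonoid M] (R : Finset ℕ) (F : ℕ → M) :
    ∑ j ∈ R, F (R.filter (· < j)).card = ∑ r ∈ Finset.range R.card, F r := by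
  have hinj : Set.InjOn (fun j => (R.filter (· < j)).card) R := by
    have hlt : ∀ a ∈ R, ∀ b, a < b → (R.filter (· < a)).card < (R.filter (· < b)).card := by
      intro a ha b hab
      refine Finset.card_lt_card (Finset.ssubset_iff_of_subset ?_ |>.2 ⟨a, ?_, ?_⟩)
      · intro x
        simp only [Finset.mem_filter]
        exact fun ⟨h1, h2⟩ => ⟨h1, h2.trans hab⟩
      · simp [ha, hab]
      · simp
    intro a ha b hb hab
    rcases lt_trichotomy a b with h | h | h
    · exact absurd hab (hlt a ha b h).ne
    · exact h
    · exact absurd hab (hlt b hb a h).ne'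
  have hmaps : Set.MapsTo (fun j => (R.filter (· < j)).card) R (Finset.range R.card) := by
    intro j hj
    rw [Finset.coe_range, Set.mem_Iio]
    refine Finset.card_lt_card (Finset.ssubset_iff_of_subset (Finset.filter_subset _ _) |>.2
      ⟨j, hj, by simp⟩)
  exact Finset.sum_nbij _ hmaps hinj
    (Finset.surjOn_of_injOn_of_card_le _ hmaps hinj (by simp)) fun _ _ => rfl

/-- The situation in the course of the contraction of a matching of the type considered: the `k`
first elements and their partners are used up, the elements `k, …, k + N - 1` are still to be paired
with the `N` elements of `R`, and `k + N` is the middle element. Thus `k` is now the first factor of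
the tensor, and an element `j` of `R` is preceded by `N` factors on the left, by the middle one, and
by the smaller elements of `R`. -/
structure PartialMatching (used : List ℕ) (R : Finset ℕ) (k N : ℕ) : Prop where
  card_eq : R.card = N
  countP_left : ∀ i, k ≤ i → i ≤ k + N → used.countP (· < i) = k
  lt_of_mem : ∀ j ∈ R, k + N < j
  countP_right : ∀ j ∈ R, used.countP (· < j) + (N + 1 + (R.filter (· < j)).card) = j

theorem PartialMatching.erase {used : List ℕ} {R : Finset ℕ} {k N j : ℕ}
    (h : PartialMatching used R k (N + 1)) (hj : j ∈ R) :
    PartialMatching (k :: j :: used) (R.erase j) (k + 1) N where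
  card_eq := by rw [Finset.card_erase_of_mem hj, h.card_eq]; rfl
  countP_left i hi hi' := by
    have h1 := h.lt_of_mem j hj
    rw [List.countP_cons_of_pos (by simpa using hi), List.countP_cons_of_neg (by simp; omega),
      h.countP_left i (by omega) (by omega)]
  lt_of_mem x hx := by
    have := h.lt_of_mem x (Finset.mem_of_mem_erase hx)
    omega
  countP_right x hx := by
    have hx' := Finset.mem_of_mem_erase hx
    have hne := Finset.ne_of_mem_erase hx
    have h1 := h.lt_of_mem x hx'
    have h2 := h.countP_right x hx'
    rw [List.countP_cons_of_pos (by simp; omega), Finset.filter_erase]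
    by_cases hjx : j < x
    · have h3 : j ∈ R.filter (· < x) := by simp [hj, hjx]
      have h4 := Finset.card_pos.2 ⟨j, h3⟩
      rw [List.countP_cons_of_pos (by simpa using hjx), Finset.card_erase_of_mem h3]
      omega
    · have h3 : j ∉ R.filter (· < x) := by simp [hjx]
      rw [List.countP_cons_of_neg (by simpa using hjx), Finset.erase_eq_of_notMem h3]
      omega

theorem partialMatching_init (n : ℕ) :
    PartialMatching [] (Finset.Ioc n (2 * n)) 0 n where
  card_eq := by rw [Nat.card_Ioc]; omega
  countP_left i _ _ := rfl
  lt_of_mem j hj := by rw [Finset.mem_Ioc] at hj; omega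
  countP_right j hj := by
    rw [Finset.mem_Ioc] at hj
    have : (Finset.Ioc n (2 * n)).filter (· < j) = Finset.Ioo n j := by
      ext x
      simp only [Finset.mem_filter, Finset.mem_Ioc, Finset.mem_Ioo]
      omega
    rw [this, Nat.card_Ioo, List.countP_nil]
    omega

variable {𝓗 : Type u} [NormedAddCommGroup 𝓗] [InnerProductSpace ℂ 𝓗] [FiniteDimensional ℂ 𝓗]
  {H : StandardSubspace 𝓗} {T : 𝓗 ⊗[ℂ] 𝓗 →L[ℂ] 𝓗 ⊗[ℂ] 𝓗}

/-- After the renumbering, the next pair `(k, j)` contracts the first factor with the one that is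
preceded by `N + 2` factors and the smaller elements of `R`. -/
theorem PartialMatching.contractSeq_cons {used : List ℕ} {R : Finset ℕ} {k N j : ℕ}
    (h : PartialMatching used R k (N + 1)) (hj : j ∈ R) (L : List (ℕ × ℕ)) (n : ℕ) :
    contractSeq H T 1 ((k, j) :: L) used (n + 2) =
      contractSeq H T 1 L (k :: j :: used) n ∘L
        (contractAt H 0 n ∘L twistProd T 1 (N + 2 + (R.filter (· < j)).card) (n + 2)) := by
  have h1 : k - used.countP (· < k) = 0 := by
    rw [h.countP_left k le_rfl (by omega)]; omega
  have h2 : j - used.countP (· < j) = N + 2 + (R.filter (· < j)).card := by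
    have := h.countP_right j hj
    omega
  rw [contractSeq]
  simp only [h1, h2]

theorem PartialMatching.sum_contractSeq {used : List ℕ} {R : Finset ℕ} {k N : ℕ}
    (h : PartialMatching used R k N) :
    ∑ L ∈ matchLists N k R, contractSeq H T 1 L used (2 * N + 1) =
      crossContract H T N 0 (2 * N + 1) := by
  induction N generalizing used R k with
  | zero =>
    rw [matchLists, Finset.sum_singleton]
    rfl
  | succ N ih =>
    have e : crossContract H T (N + 1) 0 (2 * (N + 1) + 1) =
        crossContract H T N 0 (2 * N + 1) ∘L contractRange H T (N + 2) (2 * N + 3) (2 * N + 1) :=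
      crossContract_succ_zero N (2 * N + 1)
    rw [sum_matchLists_succ, e, contractRange, ContinuousLinearMap.comp_finsetSum,
      Finset.sum_Ico_eq_sum_range, show 2 * N + 3 - (N + 2) = R.card by rw [h.card_eq]; omega,
      ← sum_card_filter_lt R fun r => crossContract H T N 0 (2 * N + 1) ∘L
        (contractAt H 0 (2 * N + 1) ∘L twistProd T 1 (N + 2 + r) (2 * N + 1 + 2))]
    refine Finset.sum_congr rfl fun j hj => ?_
    rw [← ih (h.erase hj), ContinuousLinearMap.finsetSum_comp]
    exact Finset.sum_congr rfl fun L _ => h.contractSeq_cons hj L (2 * N + 1)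

theorem PartialMatching.norm_contractSeq_le (hq : ‖T‖ ≤ 1) {used : List ℕ} {R : Finset ℕ}
    {k N : ℕ} (h : PartialMatching used R k N) {L : List (ℕ × ℕ)} (hL : L ∈ matchLists N k R) :
    ‖contractSeq H T 1 L used (2 * N + 1)‖ ≤
      (Real.sqrt (Module.finrank ℂ 𝓗) * ‖tomita H‖) ^ N * ‖T‖ ^ (N * (N + 1) / 2) := by
  induction N generalizing used R k L with
  | zero =>
    rw [matchLists, Finset.mem_singleton] at hL
    subst hL
    have h1 : ‖contractSeq H T 1 [] used 1‖ ≤ 1 := ContinuousLinearMap.norm_id_le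
    simpa using h1
  | succ N ih =>
    obtain ⟨j, hj, L', hL', rfl⟩ := mem_matchLists_succ.1 hL
    have e := h.contractSeq_cons (H := H) (T := T) hj L' (2 * N + 1)
    have hT := T.opNorm_nonneg
    have hexp : (N + 1) * (N + 1 + 1) / 2 = N * (N + 1) / 2 + (N + 1) := by
      rw [show (N + 1) * (N + 1 + 1) = N * (N + 1) + (N + 1) * 2 by ring,
        Nat.add_mul_div_right _ _ two_pos]
    -- the first factor is contracted across at least the `N` others on the left and the middle one
    refine (le_of_eq (congrArg norm e)).trans ((ContinuousLinearMap.opNorm_comp_le _ _).trans ?_)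
    refine (mul_le_mul (ih (h.erase hj) hL')
      (norm_contractAt_comp_twistProd_le (a := N + 1) hq (by omega) _) (norm_nonneg _)
      (by positivity)).trans (le_of_eq ?_)
    rw [hexp, pow_add ‖T‖, pow_succ (Real.sqrt _ * _)]
    ring

end MatchLists

/-! ### The incomplete matchings in `B(2n+1)` -/

section MatchingsB

variable {n : ℕ}

/-- The element `k < n` of `{0, …, 2n}`. -/
def leftElem (k : Fin n) : Fin (2 * n + 1) := ⟨k, by omega⟩

/-- The middle element `n` of `{0, …, 2n}`. -/
def midElem (n : ℕ) : Fin (2 * n + 1) := ⟨n, by omega⟩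

/-- The blocks `{n}` and `{k, p k}`, `k < n`. -/
def pairBlocks (p : Fin n → Fin (2 * n + 1)) : Finset (Finset (Fin (2 * n + 1))) :=
  insert {midElem n} (Finset.univ.image fun k => {leftElem k, p k})

theorem mem_pairBlocks {p : Fin n → Fin (2 * n + 1)} {V : Finset (Fin (2 * n + 1))} :
    V ∈ pairBlocks p ↔ V = {midElem n} ∨ ∃ k, {leftElem k, p k} = V := by
  simp [pairBlocks]

/-- The blocks cover `{0, …, 2n}`: an injection from the `n` elements on the left to the `n` elements
on the right is onto. -/
theorem exists_mem_pairBlocks {p : Fin n → Fin (2 * n + 1)} (hp : ∀ k, n < (p k : ℕ))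
    (hinj : Function.Injective p) (x : Fin (2 * n + 1)) : ∃ V ∈ pairBlocks p, x ∈ V := by
  rcases lt_trichotomy (x : ℕ) n with h | h | h
  · exact ⟨_, mem_pairBlocks.2 (Or.inr ⟨⟨x, h⟩, rfl⟩), Finset.mem_insert_self _ _⟩
  · exact ⟨_, mem_pairBlocks.2 (Or.inl rfl), Finset.mem_singleton.2 (Fin.ext h)⟩
  · let g : Fin n → Fin n := fun k => ⟨p k - n - 1, by have := (p k).2; have := hp k; omega⟩
    have hg : Function.Injective g := fun a b hab => hinj (Fin.ext (by
      have h1 := congrArg Fin.val hab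
      have h2 := hp a
      have h3 := hp b
      simp only [g] at h1
      omega))
    obtain ⟨k, hk⟩ := Finite.surjective_of_injective hg ⟨x - n - 1, by have := x.2; omega⟩
    have hx : p k = x := Fin.ext (by
      have h1 := congrArg Fin.val hk
      have h2 := hp k
      simp only [g] at h1
      omega)
    exact ⟨_, mem_pairBlocks.2 (Or.inr ⟨k, rfl⟩), by simp [hx]⟩

theorem pairBlocks_eq_of_mem {p : Fin n → Fin (2 * n + 1)} (hp : ∀ k, n < (p k : ℕ))
    (hinj : Function.Injective p) {x : Fin (2 * n + 1)} {V W : Finset (Fin (2 * n + 1))}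
    (hV : V ∈ pairBlocks p) (hW : W ∈ pairBlocks p) (hxV : x ∈ V) (hxW : x ∈ W) : V = W := by
  have hmid : ∀ k, midElem n ∉ ({leftElem k, p k} : Finset _) := fun k h => by
    have h1 := hp k
    have h2 := k.2
    rw [Finset.mem_insert, Finset.mem_singleton, Fin.ext_iff, Fin.ext_iff] at h
    simp only [midElem, leftElem] at h
    omega
  rw [mem_pairBlocks] at hV hW
  rcases hV with rfl | ⟨k, rfl⟩ <;> rcases hW with rfl | ⟨l, rfl⟩
  · rfl
  · rw [Finset.mem_singleton] at hxV
    exact absurd (hxV ▸ hxW) (hmid l)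
  · rw [Finset.mem_singleton] at hxW
    exact absurd (hxW ▸ hxV) (hmid k)
  · have h1 := hp k
    have h2 := k.2
    have h3 := hp l
    have h4 := l.2
    suffices k = l by rw [this]
    rw [Finset.mem_insert, Finset.mem_singleton] at hxV hxW
    rcases hxV with rfl | rfl <;> rcases hxW with h | h
    · have h5 := congrArg Fin.val h
      exact Fin.ext h5
    · have := congrArg Fin.val h
      simp only [leftElem] at this
      omega
    · have := congrArg Fin.val h
      simp only [leftElem] at this
      omega
    · exact hinj h

/-- The incomplete matching with blocks `{n}` and `{k, p k}`, `k < n`. -/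
def pairPartition (p : Fin n → Fin (2 * n + 1)) (hp : ∀ k, n < (p k : ℕ))
    (hinj : Function.Injective p) : Finpartition (Finset.univ : Finset (Fin (2 * n + 1))) :=
  Finpartition.ofExistsUnique (pairBlocks p) (fun _ _ => Finset.subset_univ _)
    (fun x _ => by
      obtain ⟨V, hV, hx⟩ := exists_mem_pairBlocks hp hinj x
      exact ⟨V, ⟨hV, hx⟩, fun W hW => pairBlocks_eq_of_mem hp hinj hW.1 hV hW.2 hx⟩)
    (fun h => by
      rcases mem_pairBlocks.1 h with h | ⟨k, h⟩
      · exact Finset.singleton_ne_empty _ h.symm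
      · exact Finset.insert_ne_empty _ _ h)

/-- The elements of `B(2n+1)` are given by the injections `p` from `{0, …, n - 1}` to
`{n + 1, …, 2n}`. -/
theorem mem_matchingsB_iff {π : Finpartition (Finset.univ : Finset (Fin (2 * n + 1)))} :
    π ∈ matchingsB n ↔ ∃ p : Fin n → Fin (2 * n + 1), (∀ k, n < (p k : ℕ)) ∧
      Function.Injective p ∧ π.parts = pairBlocks p := by
  simp only [matchingsB, Finset.mem_filter]
  constructor
  · rintro ⟨-, -, hmid, hleft⟩
    choose p hp hparts using fun k : Fin n => hleft (leftElem k) k.2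
    have hinj : Function.Injective p := fun a b hab => by
      have h := π.eq_of_mem_parts (hparts a) (hparts b) (a := p a) (by simp) (by simp [hab])
      have h1 : leftElem a ∈ ({leftElem b, p b} : Finset _) := h ▸ Finset.mem_insert_self _ _
      rw [Finset.mem_insert, Finset.mem_singleton] at h1
      rcases h1 with h1 | h1
      · have h2 := congrArg Fin.val h1
        exact Fin.ext h2
      · have h2 := congrArg Fin.val h1
        have := hp b
        simp only [leftElem] at h2
        omega
    have hsub : pairBlocks p ⊆ π.parts := fun V hV => by
      rcases mem_pairBlocks.1 hV with rfl | ⟨k, rfl⟩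
      · exact hmid _ rfl
      · exact hparts k
    refine ⟨p, hp, hinj, Finset.Subset.antisymm (fun V hV => ?_) hsub⟩
    obtain ⟨x, hx⟩ := π.nonempty_of_mem_parts hV
    obtain ⟨W, hW, hxW⟩ := exists_mem_pairBlocks hp hinj x
    rwa [π.eq_of_mem_parts hV (hsub hW) hx hxW]
  · rintro ⟨p, hp, -, hπ⟩
    refine ⟨Finset.mem_univ _, fun V hV => ?_, fun k hk => ?_, fun k hk => ⟨p ⟨k, hk⟩, hp _, ?_⟩⟩
    · rw [hπ, mem_pairBlocks] at hV
      rcases hV with rfl | ⟨k, rfl⟩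
      · exact Or.inl (Finset.card_singleton _)
      · refine Or.inr (Finset.card_pair fun h => ?_)
        have h1 := congrArg Fin.val h
        have h2 := hp k
        simp only [leftElem] at h1
        omega
    · rw [hπ, mem_pairBlocks]
      exact Or.inl (congrArg _ (Fin.ext hk))
    · rw [hπ, mem_pairBlocks]
      exact Or.inr ⟨⟨k, hk⟩, rfl⟩

theorem pairings_eq_ofFn {π : Finpartition (Finset.univ : Finset (Fin (2 * n + 1)))}
    {p : Fin n → Fin (2 * n + 1)} (hp : ∀ k, n < (p k : ℕ))
    (hπ : π.parts = pairBlocks p) :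
    pairings π = List.ofFn fun k : Fin n => ((k : ℕ), (p k : ℕ)) := by
  have hlt : ∀ k, leftElem k < p k := fun k => by
    have := hp k
    rw [Fin.lt_def]
    simp only [leftElem]
    omega
  have hP : List.Pairwise (· < ·) (List.ofFn fun k : Fin n => toLex (leftElem k, p k)) := by
    rw [List.pairwise_ofFn]
    intro i j hij
    rw [Prod.Lex.toLex_lt_toLex]
    exact Or.inl hij
  rw [pairings]
  refine (congrArg (List.map _) (List.Perm.eq_of_pairwise (le := (· < ·))
    (fun a b _ _ h h' => absurd h h'.not_gt) (Finset.sortedLT_sort _).pairwise hP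
    ((List.perm_ext_iff_of_nodup (Finset.sort_nodup _ _) hP.nodup).2 fun v => ?_))).trans ?_
  · rw [Finset.mem_sort, Finset.mem_filter, List.mem_ofFn]
    constructor
    · rintro ⟨-, hv, hv'⟩
      rw [hπ, mem_pairBlocks] at hv'
      rcases hv' with h | ⟨k, hk⟩
      · have h1 : (ofLex v).1 ∈ ({midElem n} : Finset _) := h ▸ Finset.mem_insert_self _ _
        have h2 : (ofLex v).2 ∈ ({midElem n} : Finset _) := h ▸ by simp
        rw [Finset.mem_singleton] at h1 h2
        rw [h1, h2] at hv
        exact absurd hv (lt_irrefl _)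
      · refine ⟨k, ?_⟩
        have h1 : (ofLex v).1 ∈ ({leftElem k, p k} : Finset _) := hk ▸ Finset.mem_insert_self _ _
        have h2 : (ofLex v).2 ∈ ({leftElem k, p k} : Finset _) := hk ▸ by simp
        rw [Finset.mem_insert, Finset.mem_singleton] at h1 h2
        have h3 := hlt k
        rcases h1 with h1 | h1 <;> rcases h2 with h2 | h2
        · rw [h1, h2] at hv
          exact absurd hv (lt_irrefl _)
        · rw [← h1, ← h2]; rfl
        · rw [h1, h2] at hv
          exact absurd hv h3.not_gt
        · rw [h1, h2] at hv
          exact absurd hv (lt_irrefl _)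
    · rintro ⟨k, rfl⟩
      refine ⟨Finset.mem_univ _, hlt k, ?_⟩
      rw [hπ, mem_pairBlocks]
      exact Or.inr ⟨k, rfl⟩
  · rw [List.map_ofFn]
    rfl

theorem pairings_mem_matchLists {π : Finpartition (Finset.univ : Finset (Fin (2 * n + 1)))}
    (hπ : π ∈ matchingsB n) : pairings π ∈ matchLists n 0 (Finset.Ioc n (2 * n)) := by
  obtain ⟨p, hp, hinj, h⟩ := mem_matchingsB_iff.1 hπ
  rw [mem_matchLists (partialMatching_init n).card_eq, pairings_eq_ofFn hp h, List.map_ofFn,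
    List.map_ofFn]
  have hinj' : Function.Injective (Prod.snd ∘ fun k : Fin n => ((k : ℕ), (p k : ℕ))) :=
    Fin.val_injective.comp hinj
  refine ⟨?_, List.nodup_ofFn.2 hinj', fun j => ?_⟩
  · rw [← List.range_eq_range']
    exact List.ofFn_eq_map.trans List.map_coe_finRange_eq_range
  · rw [List.mem_ofFn, Finset.mem_Ioc]
    constructor
    · rintro ⟨k, rfl⟩
      have h1 := hp k
      have h2 := (p k).2
      simp only [Function.comp_apply]
      omega
    · rintro ⟨h1, h2⟩
      obtain ⟨V, hV, hx⟩ := exists_mem_pairBlocks hp hinj ⟨j, by omega⟩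
      rcases mem_pairBlocks.1 hV with rfl | ⟨k, rfl⟩
      · have := congrArg Fin.val (Finset.mem_singleton.1 hx)
        simp only [midElem] at this
        omega
      · rw [Finset.mem_insert, Finset.mem_singleton] at hx
        rcases hx with hx | hx
        · have h3 := congrArg Fin.val hx
          simp only [leftElem] at h3
          omega
        · exact ⟨k, (congrArg Fin.val hx).symm⟩

theorem pairings_injOn : Set.InjOn (pairings (n := 2 * n + 1)) (matchingsB n : Set _) := by
  intro π hπ π' hπ' he
  obtain ⟨p, hp, hinj, h⟩ := mem_matchingsB_iff.1 hπ
  obtain ⟨p', hp', hinj', h'⟩ := mem_matchingsB_iff.1 hπ'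
  rw [pairings_eq_ofFn hp h, pairings_eq_ofFn hp' h'] at he
  have hpp : p = p' := by
    ext k
    exact congrArg Prod.snd (congrFun (List.ofFn_injective he) k)
  exact Finpartition.ext (by rw [h, h', hpp])

theorem exists_pairings_eq {L : List (ℕ × ℕ)} (hL : L ∈ matchLists n 0 (Finset.Ioc n (2 * n))) :
    ∃ π ∈ matchingsB n, pairings π = L := by
  obtain ⟨h1, h2, h3⟩ := (mem_matchLists (partialMatching_init n).card_eq).1 hL
  have hlen : L.length = n := by
    have := congrArg List.length h1
    simpa using this
  subst hlen
  have hmem : ∀ k : Fin L.length, L.length < (L.get k).2 ∧ (L.get k).2 < 2 * L.length + 1 :=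
    fun k => by
      have := (h3 (L.get k).2).1 (List.mem_map_of_mem (List.get_mem L k))
      rw [Finset.mem_Ioc] at this
      omega
  let p : Fin L.length → Fin (2 * L.length + 1) := fun k => ⟨(L.get k).2, (hmem k).2⟩
  have hp : ∀ k, L.length < (p k : ℕ) := fun k => (hmem k).1
  have hinj : Function.Injective p := fun a b hab => by
    have h4 : (L.get a).2 = (L.get b).2 := congrArg Fin.val hab
    refine Fin.ext ((h2.getElem_inj_iff (hi := by simp) (hj := by simp)).1 ?_)
    simpa using h4
  refine ⟨pairPartition p hp hinj, mem_matchingsB_iff.2 ⟨p, hp, hinj, rfl⟩, ?_⟩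
  rw [pairings_eq_ofFn hp rfl]
  conv_rhs => rw [← List.ofFn_get L]
  congr 1
  funext k
  refine Prod.ext ?_ rfl
  have h4 : (L.map Prod.fst)[(k : ℕ)]'(by simp) = k := by
    simp only [h1, List.getElem_range']
    omega
  rw [List.getElem_map] at h4
  exact h4.symm

variable {𝓗 : Type u} [NormedAddCommGroup 𝓗] [InnerProductSpace ℂ 𝓗] [FiniteDimensional ℂ 𝓗]
  {H : StandardSubspace 𝓗} {T : 𝓗 ⊗[ℂ] 𝓗 →L[ℂ] 𝓗 ⊗[ℂ] 𝓗}

/-- The contractions across the middle factor are the sums of the twisted contractions `W^T_π`,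
`π ∈ B(2n+1)`. -/
theorem sum_opW_eq_crossContract (n : ℕ) :
    ∑ π ∈ matchingsB n, opW H T π 1 = crossContract H T n 0 (2 * n + 1) := by
  rw [← (partialMatching_init n).sum_contractSeq]
  exact Finset.sum_nbij pairings (fun _ => pairings_mem_matchLists) pairings_injOn
    (fun _ hL => exists_pairings_eq hL) fun _ _ => rfl

theorem norm_opW_le (hq : ‖T‖ ≤ 1)
    {π : Finpartition (Finset.univ : Finset (Fin (2 * n + 1)))} (hπ : π ∈ matchingsB n) :
    ‖opW H T π 1‖ ≤
      (Real.sqrt (Module.finrank ℂ 𝓗) * ‖tomita H‖) ^ n * ‖T‖ ^ (n * (n + 1) / 2) :=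
  (partialMatching_init n).norm_contractSeq_le hq (pairings_mem_matchLists hπ)

end MatchingsB

/-! ### Boundedness of the creation operators -/

section Positivity

/-- If `B > 0` and `B R` is symmetric, then `B R ≤ ‖R‖ B`: the operator `R` is symmetric for the
inner product `⟪x, B y⟫`, and its eigenvalues are bounded by `‖R‖`. -/
theorem IsStrictlyPos.re_inner_comp_le {V : Type*} [NormedAddCommGroup V] [InnerProductSpace ℂ V]
    [FiniteDimensional ℂ V] {B R : V →L[ℂ] V} (hB : IsStrictlyPos B)
    (hR : ∀ x y, ⟪R x, B y⟫_ℂ = ⟪x, B (R y)⟫_ℂ) (x : V) :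
    (⟪x, B (R x)⟫_ℂ).re ≤ ‖R‖ * (⟪x, B x⟫_ℂ).re := by
  let Rw : Weighted B hB →ₗ[ℂ] Weighted B hB := (R : V →ₗ[ℂ] V)
  have hs : Rw.IsSymmetric := hR
  set b := hs.eigenvectorBasis rfl with hb
  have hev : ∀ i, hs.eigenvalues rfl i ≤ ‖R‖ := fun i => by
    have h1 : R ((toWeighted hB).symm (b i)) =
        (hs.eigenvalues rfl i : ℂ) • (toWeighted hB).symm (b i) := hs.apply_eigenvectorBasis rfl i
    have h2 : (toWeighted hB).symm (b i) ≠ 0 := by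
      simpa using b.toBasis.ne_zero i
    have h3 := R.le_opNorm ((toWeighted hB).symm (b i))
    rw [h1, norm_smul, Complex.norm_real] at h3
    exact (le_abs_self _).trans (le_of_mul_le_mul_right h3 (norm_pos_iff.2 h2))
  let y : Weighted B hB := toWeighted hB x
  have hterm : ∀ i, ⟪y, b i⟫_ℂ * ⟪b i, Rw y⟫_ℂ =
      ((hs.eigenvalues rfl i * ‖⟪b i, y⟫_ℂ‖ ^ 2 : ℝ) : ℂ) := fun i => by
    have h1 := hs.eigenvectorBasis_apply_self_apply rfl y i
    rw [OrthonormalBasis.repr_apply_apply, OrthonormalBasis.repr_apply_apply] at h1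
    rw [h1, ← inner_conj_symm y]
    push_cast
    rw [← Complex.conj_mul']
    ring_nf
    rfl
  have e1 : (⟪x, B (R x)⟫_ℂ).re = ∑ i, hs.eigenvalues rfl i * ‖⟪b i, y⟫_ℂ‖ ^ 2 := by
    change (⟪y, Rw y⟫_ℂ).re = _
    rw [← b.sum_inner_mul_inner, Finset.sum_congr rfl fun i _ => hterm i, ← Complex.ofReal_sum,
      Complex.ofReal_re]
  have e2 : (⟪x, B x⟫_ℂ).re = ∑ i, ‖⟪b i, y⟫_ℂ‖ ^ 2 := by
    rw [b.sum_sq_norm_inner_right]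
    exact inner_self_eq_norm_sq (𝕜 := ℂ) y
  rw [e1, e2, Finset.mul_sum]
  exact Finset.sum_le_sum fun i _ => mul_le_mul_of_nonneg_right (hev i) (by positivity)

variable {𝓗 : Type u} [NormedAddCommGroup 𝓗] [InnerProductSpace ℂ 𝓗] [FiniteDimensional ℂ 𝓗]
  {T : 𝓗 ⊗[ℂ] 𝓗 →L[ℂ] 𝓗 ⊗[ℂ] 𝓗}

theorem adjoint_idTensor {n m : ℕ} (A : TPow 𝓗 n →L[ℂ] TPow 𝓗 m) :
    ContinuousLinearMap.adjoint (idTensor A) = idTensor (ContinuousLinearMap.adjoint A) :=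
  ContinuousLinearMap.adjoint_lTensor 𝓗 A

theorem inner_tcons_tcons {n : ℕ} (ξ η : 𝓗) (v w : TPow 𝓗 n) :
    ⟪tcons ξ n v, tcons η n w⟫_ℂ = ⟪ξ, η⟫_ℂ * ⟪v, w⟫_ℂ := TensorProduct.inner_tmul _ _ _ _ _

theorem idTensor_injective {n : ℕ} {A : TPow 𝓗 n →L[ℂ] TPow 𝓗 n} (hA : Function.Injective A) :
    Function.Injective (idTensor A) := by
  obtain ⟨B, hB⟩ := LinearMap.exists_leftInverse_of_injective (A : TPow 𝓗 n →ₗ[ℂ] TPow 𝓗 n)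
    (LinearMap.ker_eq_bot.2 hA)
  have h : idTensor (LinearMap.toContinuousLinearMap B) ∘L idTensor A = .id ℂ _ := by
    rw [← idTensor_comp, ← idTensor_id]
    congr 1
    ext v
    exact LinearMap.congr_fun hB v
  exact Function.LeftInverse.injective (g := idTensor (LinearMap.toContinuousLinearMap B))
    fun v => DFunLike.congr_fun h v

/-- If `A = S²` with `S` self-adjoint, then `1 ⊗ A = (1 ⊗ S)^* (1 ⊗ S)`. -/
theorem IsStrictlyPos.idTensor {n : ℕ} {A : TPow 𝓗 n →L[ℂ] TPow 𝓗 n} (hA : IsStrictlyPos A) :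
    IsStrictlyPos (TwistedArakiWoods.idTensor A) := by
  have h0 : 0 ≤ A := (ContinuousLinearMap.nonneg_iff_isPositive A).2 hA.1
  set S := CFC.sqrt A with hS
  have hSS : S * S = A := CFC.sqrt_mul_sqrt_self A
  have hadj : ContinuousLinearMap.adjoint S = S :=
    ((ContinuousLinearMap.nonneg_iff_isPositive S).1 (CFC.sqrt_nonneg A)).isSelfAdjoint
  have hinj : Function.Injective S := by
    refine Function.Injective.of_comp (f := S) ?_
    have := hA.injective
    rwa [← hSS] at this
  have e : TwistedArakiWoods.idTensor A =
      ContinuousLinearMap.adjoint (TwistedArakiWoods.idTensor S) ∘L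
        TwistedArakiWoods.idTensor S := by
    rw [adjoint_idTensor, hadj, ← idTensor_comp, ← hSS]
    rfl
  rw [e]
  refine ⟨ContinuousLinearMap.isPositive_adjoint_comp_self _, fun v hv => ?_⟩
  have hv' : TwistedArakiWoods.idTensor S v ≠ 0 := fun h =>
    hv (idTensor_injective hinj (h.trans (map_zero _).symm))
  rw [ContinuousLinearMap.comp_apply, ContinuousLinearMap.adjoint_inner_left]
  have h := inner_self_eq_norm_sq (𝕜 := ℂ) (TwistedArakiWoods.idTensor S v)
  rw [RCLike.re_to_complex] at h
  rw [h]
  positivity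

theorem IsStrictTwist.inner_opP_left (hT : IsStrictTwist T) {n : ℕ} (v w : TPow 𝓗 n) :
    ⟪opP T n v, w⟫_ℂ = ⟪v, opP T n w⟫_ℂ := (hT.strictlyPos n).1.isSymmetric v w

/-- `P_{T,n+1} ≤ (1 - ‖T‖)⁻¹ (1 ⊗ P_{T,n})`. -/
theorem IsStrictTwist.re_inner_opP_succ_le (hT : IsStrictTwist T) (hq : ‖T‖ < 1) {n : ℕ}
    (x : TPow 𝓗 (n + 1)) : (⟪x, opP T (n + 1) x⟫_ℂ).re ≤
      (1 - ‖T‖)⁻¹ * (⟪x, idTensor (opP T n) x⟫_ℂ).re := by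
  have hB := (hT.strictlyPos n).idTensor
  have hnorm : ‖opR T (n + 1)‖ ≤ (1 - ‖T‖)⁻¹ := by
    rw [← opRPart_self]
    exact norm_opRPart_le hq _ _
  refine (hB.re_inner_comp_le (R := opR T (n + 1)) (fun x y => ?_) x).trans
    (mul_le_mul_of_nonneg_right hnorm (hB.1.re_inner_nonneg_right x))
  have h := hT.inner_opP_left (n := n + 1) x y
  rw [opP_succ] at h
  exact (hB.1.isSymmetric _ _).symm.trans h

end Positivity

section FockSpace

variable {𝓗 : Type u} [NormedAddCommGroup 𝓗] [InnerProductSpace ℂ 𝓗] [FiniteDimensional ℂ 𝓗]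
  {T : 𝓗 ⊗[ℂ] 𝓗 →L[ℂ] 𝓗 ⊗[ℂ] 𝓗} {hT : IsStrictTwist T}

theorem inner_incl_left {n : ℕ} (v : TPow 𝓗 n) (x : Fock hT) :
    ⟪incl hT n v, x⟫_ℂ = ⟪toWeighted (hT.strictlyPos n) v, x n⟫_ℂ :=
  lp.inner_single_left n _ x

theorem inner_incl_incl {n : ℕ} (v w : TPow 𝓗 n) :
    ⟪incl hT n v, incl hT n w⟫_ℂ = ⟪v, opP T n w⟫_ℂ := by
  rw [inner_incl_left, ← inner_toWeighted (hT.strictlyPos n)]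
  congr 1
  exact lp.single_apply_self 2 n _

theorem inner_incl_incl_of_ne {n m : ℕ} (h : n ≠ m) (v : TPow 𝓗 n) (w : TPow 𝓗 m) :
    ⟪incl hT n v, incl hT m w⟫_ℂ = 0 := by
  rw [inner_incl_left]
  have : incl hT m w n = 0 := lp.single_apply_ne 2 m _ h
  rw [this, inner_zero_right]

theorem norm_incl_sq {n : ℕ} (v : TPow 𝓗 n) :
    ‖incl hT n v‖ ^ 2 = (⟪v, opP T n v⟫_ℂ).re := by
  rw [← inner_incl_incl (hT := hT)]
  exact (inner_self_eq_norm_sq (𝕜 := ℂ) _).symm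

theorem norm_incl {n : ℕ} (v : TPow 𝓗 n) :
    ‖incl hT n v‖ = ‖toWeighted (hT.strictlyPos n) v‖ :=
  lp.norm_single (by norm_num) n _

theorem hasSum_incl (x : Fock hT) :
    HasSum (fun n => incl hT n ((toWeighted (hT.strictlyPos n)).symm (x n))) x :=
  lp.hasSum_single ENNReal.ofNat_ne_top x

theorem finiteParticle_of (n : ℕ) (v : TPow 𝓗 n) :
    finiteParticle hT (DirectSum.lof ℂ ℕ (fun n => TPow 𝓗 n) n v) = incl hT n v :=
  DirectSum.toModule_lof ℂ n v

theorem finiteCreation_of (ξ : 𝓗) (n : ℕ) (v : TPow 𝓗 n) :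
    finiteCreation hT ξ (DirectSum.lof ℂ ℕ (fun n => TPow 𝓗 n) n v) =
      incl hT (n + 1) (tcons ξ n v) :=
  DirectSum.toModule_lof ℂ n v

/-- A closed subspace containing all the vectors of finite particle number is everything. -/
theorem mem_of_incl_mem {S : Submodule ℂ (Fock hT)} (hS : IsClosed (S : Set (Fock hT)))
    (h : ∀ n v, incl hT n v ∈ S) (x : Fock hT) : x ∈ S :=
  hS.mem_of_tendsto (hasSum_incl x) (Filter.Eventually.of_forall fun _ => S.sum_mem fun n _ => h n _)

theorem denseRange_finiteParticle : DenseRange (finiteParticle hT) := by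
  intro x
  have : closure (Set.range (finiteParticle hT)) =
      ((LinearMap.range (finiteParticle hT)).topologicalClosure : Set (Fock hT)) := by
    rw [Submodule.topologicalClosure_coe, LinearMap.coe_range]
  rw [this]
  exact mem_of_incl_mem (Submodule.isClosed_topologicalClosure _) (fun n v =>
    Submodule.le_topologicalClosure _ (LinearMap.mem_range.2 ⟨_, finiteParticle_of n v⟩)) x

theorem clm_ext_incl {V : Type*} [NormedAddCommGroup V] [NormedSpace ℂ V]
    {A B : Fock hT →L[ℂ] V} (h : ∀ n v, A (incl hT n v) = B (incl hT n v)) : A = B := by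
  ext x
  exact mem_of_incl_mem (S := LinearMap.eqLocus (A : Fock hT →ₗ[ℂ] V) B)
    (isClosed_eq A.continuous B.continuous) h x

/-- A vector is determined by its inner products with the vectors of finite particle number. -/
theorem eq_of_inner_incl {x y : Fock hT} (h : ∀ n v, ⟪incl hT n v, x⟫_ℂ = ⟪incl hT n v, y⟫_ℂ) :
    x = y := by
  refine ext_inner_right ℂ fun z => ?_
  refine mem_of_incl_mem (S := LinearMap.eqLocus (innerSL ℂ x : Fock hT →ₗ[ℂ] ℂ) (innerSL ℂ y))
    (isClosed_eq (innerSL ℂ x).continuous (innerSL ℂ y).continuous) (fun n v => ?_) z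
  have := congrArg (starRingEnd ℂ) (h n v)
  rwa [inner_conj_symm, inner_conj_symm] at this

theorem norm_incl_tcons_le (hq : ‖T‖ < 1) (ξ : 𝓗) {n : ℕ} (v : TPow 𝓗 n) :
    ‖incl hT (n + 1) (tcons ξ n v)‖ ^ 2 ≤ (1 - ‖T‖)⁻¹ * ‖ξ‖ ^ 2 * ‖incl hT n v‖ ^ 2 := by
  rw [norm_incl_sq, norm_incl_sq]
  refine (hT.re_inner_opP_succ_le hq _).trans (le_of_eq ?_)
  rw [idTensor_tcons, inner_tcons_tcons, inner_self_eq_norm_sq_to_K, mul_assoc]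
  congr 1
  rw [← Complex.re_ofReal_mul]
  norm_num

theorem finiteParticle_apply (x : DirectSum ℕ fun n => TPow 𝓗 n) (n : ℕ) :
    finiteParticle hT x n = toWeighted (hT.strictlyPos n) (x n) := by
  induction x using DirectSum.induction_on with
  | zero => simp
  | of m v =>
    refine (congrFun (congrArg _ (finiteParticle_of m v)) n).trans ?_
    by_cases h : n = m
    · subst h
      rw [DirectSum.of_eq_same]
      exact lp.single_apply_self 2 n _
    · rw [DirectSum.of_eq_of_ne _ _ _ h]
      exact (lp.single_apply_ne 2 m _ h).trans (map_zero _).symm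
  | add x y hx hy => rw [map_add, lp.coeFn_add, Pi.add_apply, hx, hy, DirectSum.add_apply, map_add]

theorem finiteCreation_apply_succ (ξ : 𝓗) (x : DirectSum ℕ fun n => TPow 𝓗 n) (n : ℕ) :
    finiteCreation hT ξ x (n + 1) = toWeighted (hT.strictlyPos (n + 1)) (tcons ξ n (x n)) := by
  induction x using DirectSum.induction_on with
  | zero => simp
  | of m v =>
    refine (congrFun (congrArg _ (finiteCreation_of ξ m v)) (n + 1)).trans ?_
    by_cases h : n = m
    · subst h
      rw [DirectSum.of_eq_same]
      exact lp.single_apply_self 2 (n + 1) _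
    · rw [DirectSum.of_eq_of_ne _ _ _ h, map_zero, map_zero]
      exact lp.single_apply_ne 2 (m + 1) _ (by omega)
  | add x y hx hy =>
    rw [map_add, lp.coeFn_add, Pi.add_apply, hx, hy, DirectSum.add_apply, map_add, map_add]

theorem finiteCreation_apply_zero (ξ : 𝓗) (x : DirectSum ℕ fun n => TPow 𝓗 n) :
    finiteCreation hT ξ x 0 = 0 := by
  induction x using DirectSum.induction_on with
  | zero => simp
  | of m v =>
    refine (congrFun (congrArg _ (finiteCreation_of ξ m v)) 0).trans ?_
    exact lp.single_apply_ne 2 (m + 1) _ (by omega)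
  | add x y hx hy => rw [map_add, lp.coeFn_add, Pi.add_apply, hx, hy, add_zero]

theorem hasSum_norm_sq (x : Fock hT) : HasSum (fun n => ‖x n‖ ^ 2) (‖x‖ ^ 2) := by
  have h := lp.hasSum_norm (p := 2) (by norm_num) x
  simpa using h

theorem norm_finiteCreation_le (hq : ‖T‖ < 1) (ξ : 𝓗) (x : DirectSum ℕ fun n => TPow 𝓗 n) :
    ‖finiteCreation hT ξ x‖ ≤ Real.sqrt ((1 - ‖T‖)⁻¹ * ‖ξ‖ ^ 2) * ‖finiteParticle hT x‖ := by
  have h0 : 0 ≤ (1 - ‖T‖)⁻¹ * ‖ξ‖ ^ 2 :=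
    mul_nonneg (inv_nonneg.2 (by linarith)) (by positivity)
  refine le_of_sq_le_sq ?_ (by positivity)
  rw [mul_pow, Real.sq_sqrt h0]
  have h1 := hasSum_norm_sq (finiteCreation hT ξ x)
  have h2 := (hasSum_norm_sq (finiteParticle hT x)).mul_left ((1 - ‖T‖)⁻¹ * ‖ξ‖ ^ 2)
  rw [← hasSum_nat_add_iff' 1] at h1
  simp only [Finset.sum_range_one, finiteCreation_apply_zero, norm_zero] at h1
  have h3 := hasSum_le (fun n => ?_) h1 h2
  · simpa using h3
  · rw [finiteCreation_apply_succ, finiteParticle_apply, ← norm_incl, ← norm_incl]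
    exact norm_incl_tcons_le (hT := hT) hq ξ _

theorem creation_incl (hq : ‖T‖ < 1) (ξ : 𝓗) (n : ℕ) (v : TPow 𝓗 n) :
    creation hT ξ (incl hT n v) = incl hT (n + 1) (tcons ξ n v) := by
  rw [← finiteParticle_of, ← finiteCreation_of]
  exact LinearMap.extendOfNorm_eq denseRange_finiteParticle ⟨_, norm_finiteCreation_le hq ξ⟩ _

end FockSpace

/-! ### The field operators on vectors of finite particle number -/

section FieldOperators

variable {𝓗 : Type u} [NormedAddCommGroup 𝓗] [InnerProductSpace ℂ 𝓗] [FiniteDimensional ℂ 𝓗]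
  {H : StandardSubspace 𝓗} {T : 𝓗 ⊗[ℂ] 𝓗 →L[ℂ] 𝓗 ⊗[ℂ] 𝓗} {hT : IsStrictTwist T}

/-- Contracting with `ξ` on the left is adjoint to tensoring with `S_H ξ` on the left, also for the
inner products deformed by `1 ⊗ A` and `A`. -/
theorem inner_tcons_tomita_idTensor {n : ℕ} {A : TPow 𝓗 n →L[ℂ] TPow 𝓗 n}
    (ξ : 𝓗) (w : TPow 𝓗 n) (u : TPow 𝓗 (n + 1)) :
    ⟪tcons (tomita H ξ) n w, idTensor A u⟫_ℂ =
      ⟪w, A (contractAt H 0 n (tcons ξ (n + 1) u))⟫_ℂ := by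
  have h : (innerSL ℂ (tcons (tomita H ξ) n w)) ∘L idTensor A =
      (innerSL ℂ w) ∘L A ∘L contractAt H 0 n ∘L
        LinearMap.toContinuousLinearMap (tcons ξ (n + 1)) :=
    tpow_ext fun η v => by
      change ⟪tcons (tomita H ξ) n w, tcons η n (A v)⟫_ℂ =
        ⟪w, A (contractAt H 0 n (tcons ξ (n + 1) (tcons η n v)))⟫_ℂ
      rw [inner_tcons_tcons, contractAt_zero_tcons, map_smul, inner_smul_right]
  exact DFunLike.congr_fun h u

theorem annihilation_incl_zero (hq : ‖T‖ < 1) (ξ : 𝓗) (v : TPow 𝓗 0) :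
    annihilation hT ξ (incl hT 0 v) = 0 := by
  refine eq_of_inner_incl fun m w => ?_
  rw [annihilation, ContinuousLinearMap.adjoint_inner_right, creation_incl hq,
    inner_incl_incl_of_ne (by omega), inner_zero_right]

theorem annihilation_tomita_incl_succ (hq : ‖T‖ < 1) (ξ : 𝓗) (n : ℕ) (v : TPow 𝓗 (n + 1)) :
    annihilation hT (tomita H ξ) (incl hT (n + 1) v) =
      incl hT n (contractRange H T 1 (n + 2) n (tcons ξ (n + 1) v)) := by
  refine eq_of_inner_incl fun m w => ?_
  rw [annihilation, ContinuousLinearMap.adjoint_inner_right, creation_incl hq]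
  by_cases h : m = n
  · subst h
    rw [inner_incl_incl, inner_incl_incl, opP_succ, contractRange_one, opRPart_self]
    exact inner_tcons_tomita_idTensor ξ w (opR T (m + 1) v)
  · rw [inner_incl_incl_of_ne (by omega), inner_incl_incl_of_ne h]

theorem field_incl_zero (hq : ‖T‖ < 1) (ξ : 𝓗) (v : TPow 𝓗 0) :
    field H hT ξ (incl hT 0 v) = incl hT 1 (tcons ξ 0 v) := by
  rw [field, add_apply, creation_incl hq, annihilation_incl_zero hq, add_zero]

theorem field_incl_succ (hq : ‖T‖ < 1) (ξ : 𝓗) (n : ℕ) (v : TPow 𝓗 (n + 1)) :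
    field H hT ξ (incl hT (n + 1) v) = incl hT (n + 2) (tcons ξ (n + 1) v) +
      incl hT n (contractRange H T 1 (n + 2) n (tcons ξ (n + 1) v)) := by
  rw [field, add_apply, creation_incl hq, annihilation_tomita_incl_succ hq]

theorem creation_add (hq : ‖T‖ < 1) (ξ η : 𝓗) :
    creation hT (ξ + η) = creation hT ξ + creation hT η :=
  clm_ext_incl fun n v => by
    rw [add_apply, creation_incl hq, creation_incl hq, creation_incl hq,
      tcons_add_left, map_add]

theorem creation_smul (hq : ‖T‖ < 1) (c : ℂ) (ξ : 𝓗) :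
    creation hT (c • ξ) = c • creation hT ξ :=
  clm_ext_incl fun n v => by
    rw [smul_apply, creation_incl hq, creation_incl hq, tcons_smul_left,
      map_smul]

variable (H hT) in
/-- The field operators `X_T(ξ)` depend linearly on `ξ`. -/
def fieldLinear (hq : ‖T‖ < 1) : 𝓗 →ₗ[ℂ] (Fock hT →L[ℂ] Fock hT) where
  toFun := field H hT
  map_add' ξ η := by
    rw [field, field, field, annihilation, annihilation, annihilation, map_add (tomita H),
      creation_add hq, creation_add hq, map_add]
    abel
  map_smul' c ξ := by
    rw [field, field, annihilation, annihilation, ContinuousLinearMap.map_smulₛₗ,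
      creation_smul hq, creation_smul hq, LinearIsometryEquiv.map_smulₛₗ, smul_add]
    simp

/-- `X_T(ξ)^* = X_T(S_H ξ)`. -/
theorem adjoint_field (ξ : 𝓗) :
    ContinuousLinearMap.adjoint (field H hT ξ) = field H hT (tomita H ξ) := by
  rw [field, field, tomita_tomita, map_add, annihilation, annihilation,
    ContinuousLinearMap.adjoint_adjoint, add_comm]

/-- The components of `X_T(ξ_1) ⋯ X_T(ξ_k) Ω` are the vectors `fieldWord`. -/
theorem prod_field_vacuum (hq : ‖T‖ < 1) (L : List 𝓗) {B : ℕ} (hL : L.length ≤ B) :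
    (L.map (field H hT)).prod (vacuum hT) =
      ∑ n ∈ Finset.range (B + 1), incl hT n (fieldWord H T L n) := by
  induction L generalizing B with
  | nil =>
    rw [Finset.sum_range_succ', Finset.sum_eq_zero fun n _ => ?_, zero_add]
    · rfl
    · rw [fieldWord, map_zero]
  | cons ξ L ih =>
    rw [List.length_cons] at hL
    have e : ((ξ :: L).map (field H hT)).prod (vacuum hT) =
        field H hT ξ ((L.map (field H hT)).prod (vacuum hT)) := rfl
    have h1 : incl hT (B + 1) (tcons ξ B (fieldWord H T L B)) = 0 := by
      rw [fieldWord_eq_zero (by omega), map_zero, map_zero]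
    have h2 : incl hT B (contractRange H T 1 (B + 2) B
        (tcons ξ (B + 1) (fieldWord H T L (B + 1)))) = 0 := by
      rw [fieldWord_eq_zero (by omega), map_zero, map_zero, map_zero]
    have h3 : ∑ n ∈ Finset.range (B + 1), incl hT (n + 1) (tcons ξ n (fieldWord H T L n)) =
        ∑ n ∈ Finset.range B, incl hT (n + 1) (tcons ξ n (fieldWord H T L n)) := by
      rw [Finset.sum_range_succ, h1, add_zero]
    have h4 : ∑ n ∈ Finset.range (B + 1), incl hT n (contractRange H T 1 (n + 2) n
          (tcons ξ (n + 1) (fieldWord H T L (n + 1)))) =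
        ∑ n ∈ Finset.range B, incl hT n (contractRange H T 1 (n + 2) n
          (tcons ξ (n + 1) (fieldWord H T L (n + 1)))) := by
      rw [Finset.sum_range_succ, h2, add_zero]
    have h5 : field H hT ξ (∑ n ∈ Finset.range (B + 1), incl hT n (fieldWord H T L n)) =
        ∑ n ∈ Finset.range (B + 1), incl hT (n + 1) (tcons ξ n (fieldWord H T L n)) +
        ∑ n ∈ Finset.range B, incl hT n (contractRange H T 1 (n + 2) n
          (tcons ξ (n + 1) (fieldWord H T L (n + 1)))) := by
      rw [map_sum, Finset.sum_range_succ', Finset.sum_range_succ' (fun n =>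
        incl hT (n + 1) (tcons ξ n (fieldWord H T L n))), field_incl_zero hq,
        Finset.sum_congr rfl fun n _ => field_incl_succ hq ξ n _, Finset.sum_add_distrib]
      abel
    have h6 : ∑ n ∈ Finset.range (B + 1), incl hT n (fieldWord H T (ξ :: L) n) =
        ∑ n ∈ Finset.range B, incl hT (n + 1) (tcons ξ n (fieldWord H T L n)) +
        ∑ n ∈ Finset.range (B + 1), incl hT n (contractRange H T 1 (n + 2) n
          (tcons ξ (n + 1) (fieldWord H T L (n + 1)))) := by
      rw [Finset.sum_range_succ', Finset.sum_range_succ' (fun n =>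
        incl hT n (contractRange H T 1 (n + 2) n (tcons ξ (n + 1) (fieldWord H T L (n + 1))))),
        ← add_assoc, ← Finset.sum_add_distrib]
      congr 1
      exact Finset.sum_congr rfl fun n _ => by rw [fieldWord, map_add]
    rw [e, ih (show L.length ≤ B by omega), h5, h6, h3, h4]

theorem inner_vacuum_prod_field (hq : ‖T‖ < 1) (L : List 𝓗) :
    ⟪vacuum hT, (L.map (field H hT)).prod (vacuum hT)⟫_ℂ = wordState H T L := by
  rw [prod_field_vacuum hq L le_rfl, inner_sum, Finset.sum_range_succ', Finset.sum_eq_zero, zero_add,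
    vacuum, inner_incl_incl]
  · rfl
  · intro n _
    exact inner_incl_incl_of_ne (by omega) _ _

/-- The vacuum is cyclic for the algebra generated by the field operators: up to vectors of lower
particle number, `X_T(ξ)` tensors an `n`-particle vector with `ξ`. -/
theorem incl_mem_of_field_mem (hq : ‖T‖ < 1) {S : Submodule ℂ (Fock hT)} (hΩ : vacuum hT ∈ S)
    {ι : Type*} (e : Module.Basis ι ℂ 𝓗) (hX : ∀ i, ∀ x ∈ S, field H hT (e i) x ∈ S) (n : ℕ)
    (v : TPow 𝓗 n) : incl hT n v ∈ S := by
  have hX' : ∀ ξ, ∀ x ∈ S, field H hT ξ x ∈ S := fun ξ x hx => by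
    have h : (⊤ : Submodule ℂ 𝓗) ≤ S.comap
        ((ContinuousLinearMap.apply ℂ (Fock hT) x).toLinearMap ∘ₗ fieldLinear H hT hq) := by
      rw [← e.span_eq, Submodule.span_le]
      rintro _ ⟨i, rfl⟩
      exact hX i x hx
    exact h (Submodule.mem_top (x := ξ))
  suffices h : ∀ n, (∀ v, incl hT n v ∈ S) ∧ ∀ v, incl hT (n + 1) v ∈ S from (h n).1 v
  intro n
  induction n with
  | zero =>
    have h0 : ∀ v, incl hT 0 v ∈ S := fun v => by
      rw [eq_inner_smul_tvac v, map_smul]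
      exact S.smul_mem _ hΩ
    refine ⟨h0, fun v => ?_⟩
    refine TensorProduct.induction_on v ?_ (fun ξ w => ?_) fun x y hx hy => ?_
    · exact (map_zero (incl hT 1)).symm ▸ S.zero_mem
    · have := hX' ξ _ (h0 w)
      rwa [field_incl_zero hq] at this
    · exact (map_add (incl hT 1) x y).symm ▸ S.add_mem hx hy
  | succ n ih =>
    refine ⟨ih.2, fun v => ?_⟩
    refine TensorProduct.induction_on v ?_ (fun ξ w => ?_) fun x y hx hy => ?_
    · exact (map_zero (incl hT (n + 2))).symm ▸ S.zero_mem
    · have h1 := hX' ξ _ (ih.2 w)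
      rw [field_incl_succ hq] at h1
      exact (S.add_mem_iff_left (ih.1 _)).1 h1
    · exact (map_add (incl hT (n + 2)) x y).symm ▸ S.add_mem hx hy

end FieldOperators

/-! ### The series of the conjugate variables -/

section Series

variable {𝓗 : Type u} [NormedAddCommGroup 𝓗] [InnerProductSpace ℂ 𝓗] [FiniteDimensional ℂ 𝓗]
  {H : StandardSubspace 𝓗} {T : 𝓗 ⊗[ℂ] 𝓗 →L[ℂ] 𝓗 ⊗[ℂ] 𝓗} {hT : IsStrictTwist T}

theorem conjugateTerm_eq (f : 𝓗) (n : ℕ) : conjugateTerm H T f n =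
    (-1 : ℂ) ^ n • Ring.inverse (opP T (2 * n + 1))
      (ContinuousLinearMap.adjoint (crossContract H T n 0 (2 * n + 1)) (tcons f 0 (tvac 𝓗))) := by
  simp only [conjugateTerm, ← sum_opW_eq_crossContract, map_sum, sum_apply]

theorem norm_incl_inverse_le (hB : IsBraided T) (hq : ‖T‖ < 1) {n : ℕ} (u : TPow 𝓗 n) :
    ‖incl hT n (Ring.inverse (opP T n) u)‖ ≤ invBound T ^ n * ‖u‖ := by
  have h1 : 1 ≤ invBound T ^ n := one_le_pow₀ (one_le_invBound hq)
  have h2 : opP T n (Ring.inverse (opP T n) u) = u :=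
    DFunLike.congr_fun (Ring.mul_inverse_cancel _ (hT.isUnit_opP hB hq n)) u
  have h3 : ‖Ring.inverse (opP T n) u‖ ≤ invBound T ^ n * ‖u‖ :=
    (ContinuousLinearMap.le_opNorm _ u).trans
      (mul_le_mul_of_nonneg_right (hT.norm_inverse_opP_le hB hq n) (norm_nonneg u))
  refine le_of_sq_le_sq ?_ (by positivity)
  rw [norm_incl_sq, h2]
  calc (⟪Ring.inverse (opP T n) u, u⟫_ℂ).re ≤ ‖Ring.inverse (opP T n) u‖ * ‖u‖ :=
        re_inner_le_norm (𝕜 := ℂ) _ _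
    _ ≤ (invBound T ^ n * ‖u‖) * (invBound T ^ n * ‖u‖) :=
        mul_le_mul h3 (le_mul_of_one_le_left (norm_nonneg u) h1) (norm_nonneg u) (by positivity)
    _ = (invBound T ^ n * ‖u‖) ^ 2 := (sq _).symm

theorem summable_conjugateTerm (hB : IsBraided T) (hq : ‖T‖ < 1) (f : 𝓗) :
    Summable fun n : ℕ => incl hT (2 * n + 1) (conjugateTerm H T f n) := by
  have hD : 0 ≤ Real.sqrt (Module.finrank ℂ 𝓗) * ‖tomita H‖ := by positivity
  have hK : 0 ≤ invBound T := zero_le_one.trans (one_le_invBound hq)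
  refine Summable.of_norm_bounded ((summable_crossBound T.opNorm_nonneg hq hD hK).mul_right
    ‖tcons f 0 (tvac 𝓗)‖) fun n => ?_
  rw [conjugateTerm_eq, map_smul, norm_smul, norm_pow, norm_neg, norm_one, one_pow, one_mul,
    mul_assoc]
  refine (norm_incl_inverse_le hB hq _).trans (mul_le_mul_of_nonneg_left ?_ (pow_nonneg hK _))
  refine (ContinuousLinearMap.le_opNorm _ _).trans
    (mul_le_mul_of_nonneg_right ?_ (norm_nonneg _))
  rw [LinearIsometryEquiv.norm_map]
  exact norm_crossContract_le hq.le n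

theorem inner_incl_prod_field (hq : ‖T‖ < 1) (L : List 𝓗) (m : ℕ) (v : TPow 𝓗 m) :
    ⟪incl hT m v, (L.map (field H hT)).prod (vacuum hT)⟫_ℂ = ⟪v, opP T m (fieldWord H T L m)⟫_ℂ := by
  rw [prod_field_vacuum hq L (le_max_left _ m), inner_sum, Finset.sum_eq_single m, inner_incl_incl]
  · exact fun n _ h => inner_incl_incl_of_ne h.symm _ _
  · exact fun h => absurd (Finset.mem_range.2 (Nat.lt_succ_of_le (le_max_right _ m))) h

theorem inner_conjugateTerm (hB : IsBraided T) (hq : ‖T‖ < 1) (f : 𝓗) (n : ℕ) (L : List 𝓗) :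
    ⟪incl hT (2 * n + 1) (conjugateTerm H T f n), (L.map (field H hT)).prod (vacuum hT)⟫_ℂ =
      ⟪tcons f 0 (tvac 𝓗), (-1 : ℂ) ^ n •
        crossContract H T n 0 (2 * n + 1) (fieldWord H T L (2 * n + 1))⟫_ℂ := by
  have h2 : ∀ u, opP T (2 * n + 1) (Ring.inverse (opP T (2 * n + 1)) u) = u := fun u =>
    DFunLike.congr_fun (Ring.mul_inverse_cancel _ (hT.isUnit_opP hB hq (2 * n + 1))) u
  rw [inner_incl_prod_field hq, conjugateTerm_eq, inner_smul_left, ← hT.inner_opP_left, h2,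
    ContinuousLinearMap.adjoint_inner_left, inner_smul_right]
  simp

/-- The conjugate relation for monomials: contracting the word `X(L) Ω` across a middle factor in
all possible ways, with alternating signs, removes the correlations between the two sides of the
middle letter. -/
theorem inner_conjugate_prod_field (hB : IsBraided T) (hC : ContractsThrough H T) (hq : ‖T‖ < 1)
    {f : 𝓗} {Ξ : Fock hT}
    (hΞ : HasSum (fun n : ℕ => incl hT (2 * n + 1) (conjugateTerm H T f n)) Ξ) (L : List 𝓗) :
    ⟪Ξ, (L.map (field H hT)).prod (vacuum hT)⟫_ℂ = ∑ k : Fin L.length,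
      ⟪f, L.get k⟫_ℂ * (wordState H T (L.take k) * wordState H T (L.drop (k + 1))) := by
  have h1 := (innerSLFlip ℂ ((L.map (field H hT)).prod (vacuum hT))).hasSum hΞ
  simp only [innerSLFlip_apply_apply, inner_conjugateTerm hB hq] at h1
  have h2 : ∀ n ∉ Finset.range L.length, ⟪tcons f 0 (tvac 𝓗), (-1 : ℂ) ^ n •
      crossContract H T n 0 (2 * n + 1) (fieldWord H T L (2 * n + 1))⟫_ℂ = 0 := fun n hn => by
    rw [Finset.mem_range] at hn
    rw [fieldWord_eq_zero (by omega), map_zero, smul_zero, inner_zero_right]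
  rw [h1.unique (hasSum_sum_of_ne_finset_zero h2), ← inner_sum]
  have h3 : ∑ n ∈ Finset.range L.length, (-1 : ℂ) ^ n •
      crossContract H T n 0 (2 * n + 1) (fieldWord H T L (2 * n + 1)) = splitSum H T L 0 :=
    hC.crossSum_eq_splitSum hB le_rfl 0
  rw [h3, splitSum, inner_sum]
  refine Finset.sum_congr rfl fun k _ => ?_
  have h4 : tsnoc (L.get k) 0 (fieldWord H T (L.take k) 0) =
      wordState H T (L.take k) • tcons (L.get k) 0 (tvac 𝓗) := rfl
  have h5 : ⟪tvac 𝓗, tvac 𝓗⟫_ℂ = 1 := by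
    rw [inner_self_eq_norm_sq_to_K, norm_tvac]
    simp
  rw [h4, inner_smul_right, inner_smul_right, inner_tcons_tcons, h5]
  ring

end Series

/-! ### Conjugate systems -/

section ConjugateSystem

theorem basisFreeMonoid_eq_monomial {d : ℕ} (w : FreeMonoid (Fin d)) :
    FreeAlgebra.basisFreeMonoid ℂ (Fin d) w = monomial w.toList := by
  simp [FreeAlgebra.basisFreeMonoid, FreeAlgebra.equivMonoidAlgebraFreeMonoid, monomial,
    FreeMonoid.lift_apply]

theorem lift_monomial {d : ℕ} {A : Type*} [Ring A] [Algebra ℂ A] (X : Fin d → A)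
    (w : List (Fin d)) : FreeAlgebra.lift ℂ X (monomial w) = (w.map X).prod := by
  rw [monomial, map_list_prod, List.map_map]
  congr 2
  funext i
  exact FreeAlgebra.lift_ι_apply X i

variable {𝓗 : Type u} [NormedAddCommGroup 𝓗] [InnerProductSpace ℂ 𝓗] [FiniteDimensional ℂ 𝓗]
  {H : StandardSubspace 𝓗} {T : 𝓗 ⊗[ℂ] 𝓗 →L[ℂ] 𝓗 ⊗[ℂ] 𝓗} {hT : IsStrictTwist T} {d : ℕ}

theorem vectorState_monomial (hq : ‖T‖ < 1) (e : Fin d → 𝓗) (w : List (Fin d)) :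
    vectorState (vacuum hT) (fun i => field H hT (e i)) (monomial w) = wordState H T (w.map e) := by
  change ⟪vacuum hT, FreeAlgebra.lift ℂ (fun i => field H hT (e i)) (monomial w) (vacuum hT)⟫_ℂ = _
  rw [lift_monomial, ← inner_vacuum_prod_field (hT := hT) hq, List.map_map]
  rfl

theorem vectorStateTensor_freeDiff (hB : IsBraided T) (hC : ContractsThrough H T) (hq : ‖T‖ < 1)
    (e : Fin d → 𝓗) {f : Fin d → 𝓗} (hf : ∀ i j : Fin d, ⟪f i, e j⟫_ℂ = if i = j then 1 else 0)
    (i : Fin d) {Ξ : Fock hT}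
    (hΞ : HasSum (fun n : ℕ => incl hT (2 * n + 1) (conjugateTerm H T (f i) n)) Ξ)
    (p : FreeAlgebra ℂ (Fin d)) :
    vectorStateTensor (vacuum hT) (fun i => field H hT (e i)) (freeDiff i p) =
      ⟪Ξ, FreeAlgebra.lift ℂ (fun i => field H hT (e i)) p (vacuum hT)⟫_ℂ := by
  let F : FreeAlgebra ℂ (Fin d) →ₗ[ℂ] ℂ := (innerSL ℂ Ξ).toLinearMap ∘ₗ
    (ContinuousLinearMap.apply ℂ (Fock hT) (vacuum hT)).toLinearMap ∘ₗ
      (FreeAlgebra.lift ℂ fun i => field H hT (e i)).toLinearMap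
  suffices h : vectorStateTensor (vacuum hT) (fun i => field H hT (e i)) ∘ₗ freeDiff i = F from
    LinearMap.congr_fun h p
  refine (FreeAlgebra.basisFreeMonoid ℂ (Fin d)).ext fun w => ?_
  have h1 : F (FreeAlgebra.basisFreeMonoid ℂ (Fin d) w) =
      ⟪Ξ, ((w.toList.map e).map (field H hT)).prod (vacuum hT)⟫_ℂ := by
    change ⟪Ξ, FreeAlgebra.lift ℂ (fun i => field H hT (e i))
      (FreeAlgebra.basisFreeMonoid ℂ (Fin d) w) (vacuum hT)⟫_ℂ = _
    rw [basisFreeMonoid_eq_monomial, lift_monomial, List.map_map]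
    rfl
  rw [h1, inner_conjugate_prod_field hB hC hq hΞ, LinearMap.comp_apply, freeDiff,
    Module.Basis.constr_basis, map_sum,
    ← Equiv.sum_comp (finCongr (List.length_map (as := w.toList) e)) (fun m => vectorStateTensor _ _ _)]
  refine Finset.sum_congr rfl fun k _ => ?_
  have hk : (w.toList.map e).get k =
      e (w.toList.get (finCongr (List.length_map (as := w.toList) e) k)) := by simp
  rw [hk, hf]
  by_cases h : w.toList.get (finCongr (List.length_map (as := w.toList) e) k) = i
  · rw [if_pos h, if_pos h.symm, one_mul]
    change vectorState _ _ _ * vectorState _ _ _ = _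
    rw [vectorState_monomial hq, vectorState_monomial hq, List.map_take, List.map_drop]
    rfl
  · rw [if_neg h, if_neg (Ne.symm h), zero_mul, map_zero]

theorem subset_generatedBy {K : Type*} [NormedAddCommGroup K] [InnerProductSpace ℂ K]
    [CompleteSpace K] {s : Set (K →L[ℂ] K)} {a : K →L[ℂ] K} (ha : a ∈ s) : a ∈ generatedBy s := by
  change a ∈ StarSubalgebra.centralizer ℂ (StarSubalgebra.centralizer ℂ s : Set (K →L[ℂ] K))
  rw [StarSubalgebra.mem_centralizer_iff]
  intro g hg
  have hg' := (StarSubalgebra.mem_centralizer_iff ℂ).1 hg a ha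
  refine ⟨hg'.1.symm, ?_⟩
  have := congrArg star hg'.2
  rw [star_mul, star_mul, star_star] at this
  exact this

/-- By linearity of the field, `exp(i X_T(t ξ))` is a one parameter group with generator
`i X_T(ξ)`. -/
theorem hasDerivAt_exp_I_field (hq : ‖T‖ < 1) (ξ : 𝓗) :
    HasDerivAt (fun t : ℂ => NormedSpace.exp (Complex.I • field H hT (t • ξ)))
      (Complex.I • field H hT ξ) 0 := by
  have h := hasDerivAt_exp_smul_const (Complex.I • field H hT ξ) (0 : ℂ)
  rw [zero_smul, NormedSpace.exp_zero, one_mul] at h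
  refine h.congr_of_eventuallyEq (Filter.Eventually.of_forall fun t => ?_)
  have : field H hT (t • ξ) = t • field H hT ξ := (fieldLinear H hT hq).map_smul t ξ
  simp only [this]
  rw [smul_comm]

/-- An operator commutes with all `X_T(e_i)` and their adjoints if and only if it commutes with all
`exp(i X_T(ξ))` and their adjoints. -/
theorem centralizer_field_eq (hq : ‖T‖ < 1) {ι : Type*} (e : Module.Basis ι ℂ 𝓗) :
    StarSubalgebra.centralizer ℂ (Set.range fun i => field H hT (e i)) =
      StarSubalgebra.centralizer ℂ
        (Set.range fun ξ : 𝓗 => NormedSpace.exp (Complex.I • field H hT ξ)) := by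
  ext y
  rw [StarSubalgebra.mem_centralizer_iff, StarSubalgebra.mem_centralizer_iff]
  constructor
  · intro h
    have hcomm : ∀ ξ, Commute (field H hT ξ) y := fun ξ => by
      have hle : (⊤ : Submodule ℂ 𝓗) ≤ LinearMap.eqLocus
          (LinearMap.mulRight ℂ y ∘ₗ fieldLinear H hT hq)
          (LinearMap.mulLeft ℂ y ∘ₗ fieldLinear H hT hq) := by
        rw [← e.span_eq, Submodule.span_le]
        rintro _ ⟨i, rfl⟩
        exact (h _ ⟨i, rfl⟩).1
      exact hle (Submodule.mem_top (x := ξ))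
    rintro _ ⟨ξ, rfl⟩
    refine ⟨((hcomm ξ).smul_left Complex.I).exp_left, ?_⟩
    have hstar : star (Complex.I • field H hT ξ) = -Complex.I • field H hT (tomita H ξ) := by
      rw [star_smul, ContinuousLinearMap.star_eq_adjoint, adjoint_field]
      simp
    simp only [NormedSpace.star_exp, hstar]
    exact ((hcomm (tomita H ξ)).smul_left _).exp_left
  · intro h
    -- differentiate `exp(i X_T(t ξ)) y = y exp(i X_T(t ξ))` at `t = 0`
    have hcomm : ∀ ξ, Commute (field H hT ξ) y := fun ξ => by
      have h1 := hasDerivAt_exp_I_field (H := H) (hT := hT) hq ξ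
      have h2 := (h1.mul_const y).unique ((h1.const_mul y).congr_of_eventuallyEq
        (Filter.Eventually.of_forall fun t => (h _ ⟨t • ξ, rfl⟩).1))
      rw [smul_mul_assoc, mul_smul_comm] at h2
      exact smul_right_injective _ Complex.I_ne_zero h2
    rintro _ ⟨i, rfl⟩
    refine ⟨hcomm _, ?_⟩
    rw [ContinuousLinearMap.star_eq_adjoint, adjoint_field]
    exact hcomm _

theorem generatedBy_field (hq : ‖T‖ < 1) {ι : Type*} (e : Module.Basis ι ℂ 𝓗) :
    generatedBy (Set.range fun i => field H hT (e i)) = twistedArakiWoods H hT := by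
  rw [twistedArakiWoods]
  apply VonNeumannAlgebra.ext
  intro a
  have h : ∀ s : Set (Fock hT →L[ℂ] Fock hT), a ∈ generatedBy s ↔
      a ∈ StarSubalgebra.centralizer ℂ
        (StarSubalgebra.centralizer ℂ s : Set (Fock hT →L[ℂ] Fock hT)) := fun _ => Iff.rfl
  rw [h, h, centralizer_field_eq hq e]

/-- `L²` of the twisted Araki-Woods algebra in the vacuum state is the whole Fock space. -/
theorem mem_closure_orbit_vacuum (hq : ‖T‖ < 1) (e : Module.Basis (Fin d) ℂ 𝓗) (x : Fock hT) :
    x ∈ closure {v : Fock hT | ∃ a ∈ twistedArakiWoods H hT, a (vacuum hT) = v} := by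
  let S : Submodule ℂ (Fock hT) :=
    (Subalgebra.toSubmodule (twistedArakiWoods H hT).toStarSubalgebra.toSubalgebra).map
      (ContinuousLinearMap.apply ℂ (Fock hT) (vacuum hT)).toLinearMap
  have hS : ∀ n v, incl hT n v ∈ S := incl_mem_of_field_mem (H := H) hq ⟨1, one_mem (twistedArakiWoods H hT), rfl⟩ e (by
    rintro i _ ⟨a, ha, rfl⟩
    have hX : field H hT (e i) ∈ twistedArakiWoods H hT := by
      rw [← generatedBy_field hq e]
      exact subset_generatedBy ⟨i, rfl⟩
    have ha' : a ∈ twistedArakiWoods H hT := ha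
    have hm : field H hT (e i) * a ∈ twistedArakiWoods H hT := mul_mem hX ha'
    exact ⟨field H hT (e i) * a, hm, rfl⟩)
  exact mem_of_incl_mem (S := S.topologicalClosure) S.isClosed_topologicalClosure
    (fun n v => S.le_topologicalClosure (hS n v)) x

/-- A vector is determined by its inner products with the vectors `p(X) Ω`, which are dense. -/
theorem eq_of_inner_lift_vacuum (hq : ‖T‖ < 1) (e : Module.Basis (Fin d) ℂ 𝓗) {x y : Fock hT}
    (h : ∀ p, ⟪x, FreeAlgebra.lift ℂ (fun i => field H hT (e i)) p (vacuum hT)⟫_ℂ =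
      ⟪y, FreeAlgebra.lift ℂ (fun i => field H hT (e i)) p (vacuum hT)⟫_ℂ) : x = y := by
  let S : Submodule ℂ (Fock hT) := LinearMap.range
    ((ContinuousLinearMap.apply ℂ (Fock hT) (vacuum hT)).toLinearMap ∘ₗ
      (FreeAlgebra.lift ℂ fun i => field H hT (e i)).toLinearMap)
  have hS : ∀ n v, incl hT n v ∈ S := incl_mem_of_field_mem (H := H) hq
    ⟨1, by simp⟩ e (by
      rintro i _ ⟨p, rfl⟩
      exact ⟨FreeAlgebra.ι ℂ i * p, by simp⟩)
  refine eq_of_inner_incl fun n v => ?_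
  obtain ⟨p, hp⟩ := hS n v
  have h1 := congrArg (starRingEnd ℂ) (h p)
  rw [inner_conj_symm, inner_conj_symm] at h1
  rw [← hp]
  exact h1

end ConjugateSystem

end TwistedArakiWoods

end

theorem mainTheorem1 {𝓗 : Type*} [NormedAddCommGroup 𝓗] [InnerProductSpace ℂ 𝓗]
    [FiniteDimensional ℂ 𝓗] [CompleteSpace 𝓗]
    (H : StandardSubspace 𝓗) (T : 𝓗 ⊗[ℂ] 𝓗 →L[ℂ] 𝓗 ⊗[ℂ] 𝓗)
    (hT : IsStrictTwist T) (hcompatible : IsCompatible H T) (hbraided : IsBraided T)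
    (hcrossing : IsCrossingSymmetric H T) (hq : ‖T‖ < 1)
    {d : ℕ} (e : Module.Basis (Fin d) ℂ 𝓗) (f : Fin d → 𝓗)
    (hf : ∀ i j : Fin d, ⟪f i, e j⟫_ℂ = if i = j then 1 else 0) :
    -- the left creation operators are bounded on the Fock space, and the `P_{T,n}` are invertible
    (∀ (ξ : 𝓗) (n : ℕ) (v : TPow 𝓗 n), creation hT ξ (incl hT n v) = incl hT (n + 1) (tcons ξ n v)) ∧
    (∀ n : ℕ, IsUnit (opP T n)) ∧
    -- the norm bound for the twisted contractions
    (∀ (n : ℕ), ∀ π ∈ matchingsB n,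
      ‖opW H T π 1‖ ≤ (Real.sqrt d * ‖tomita H‖) ^ n * ‖T‖ ^ (n * (n + 1) / 2)) ∧
    -- the series converge, and their sums are the conjugate system
    ∃ Ξ : Fin d → Fock hT,
      (∀ i : Fin d, HasSum (fun n : ℕ => incl hT (2 * n + 1) (conjugateTerm H T (f i) n)) (Ξ i)) ∧
      IsConjugateSystem (twistedArakiWoods H hT) (vacuum hT) (fun i => field H hT (e i)) Ξ ∧
      ∀ Ξ' : Fin d → Fock hT,
        IsConjugateSystem (twistedArakiWoods H hT) (vacuum hT) (fun i => field H hT (e i)) Ξ' →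
          Ξ' = Ξ := by
  have hC : ContractsThrough H T := hcrossing.contractsThrough
  have hd : Module.finrank ℂ 𝓗 = d := by
    rw [Module.finrank_eq_card_basis e, Fintype.card_fin]
  refine ⟨creation_incl hq, hT.isUnit_opP hbraided hq, fun n π hπ => ?_, ?_⟩
  · have h := norm_opW_le (H := H) hq.le hπ
    rwa [hd] at h
  · have hconj := vectorStateTensor_freeDiff (hT := hT) hbraided hC hq e hf
    refine ⟨fun i => ∑' n, incl hT (2 * n + 1) (conjugateTerm H T (f i) n), fun i =>
      (summable_conjugateTerm hbraided hq (f i)).hasSum, ⟨generatedBy_field hq e,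
      fun i => mem_closure_orbit_vacuum hq e _, fun i =>
        hconj i (summable_conjugateTerm hbraided hq (f i)).hasSum⟩, fun Ξ' hΞ' => ?_⟩
    funext i
    refine eq_of_inner_lift_vacuum (H := H) hq e fun p => ?_
    exact (hΞ'.conj i p).symm.trans
      (hconj i (summable_conjugateTerm hbraided hq (f i)).hasSum p)
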